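/- All graphs are simple. For a graph $G$, let $L(G)$ denote the set of all lengths of odd cycles in $G$. A graph $G$ is called $4$-critical if $\chi(G)=4$ but no proper subgraph of $G$ has chromatic number $4$. Let $k\ge 5$ and $l\ge 1$ be integers, and let $G$ be a $4$-critical graph with $L(G)=\{k,k+2l\}$. Then every two odd cycles in $G$ have at least two vertices in common. -/

import Mathlib

/-- The set `L(G)` of all lengths of odd cycles of the graph `G`. -/
def SimpleGraph.oddCycleLengths {V : Type*} (G : SimpleGraph V) : Set ℕ :=
  {n | Odd n ∧ ∃ (u : V) (p : G.Walk u u), p.IsCycle ∧ p.length = n}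

/-- `G` is `k`-critical: `G` is `k`-chromatic, but no proper subgraph of `G` is. -/
def SimpleGraph.IsCriticalGraph {V : Type*} (G : SimpleGraph V) (k : ℕ) : Prop :=
  G.chromaticNumber = k ∧
    ∀ H : G.Subgraph, H ≠ ⊤ → H.coe.chromaticNumber ≠ k

/-!
Two facts about a 4-critical graph `G` are used: it is not 3-colourable, while every proper set of
vertices is. They give the following lemma, `IsVertexCritical.exists_isConnOn_compl_eq_range`: if
`T` is a nonempty connected set of vertices whose complement contains an odd cycle, then there is a
connected set `K ⊇ T` whose complement is exactly the vertex set of an odd cycle `c`, and every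
vertex of `c` has a neighbour in `K`.

Suppose that two odd cycles `C` and `D` have at most one vertex in common. With `T` the cycle `D`
without one vertex, which is the common vertex if there is one, the lemma gives `K` and `c` such
that `D` either lies in `K` or meets `c` in that single vertex. Span `K` by a forest that has its
roots on `D`. Every vertex of `c` is then joined to `D` by a path of the forest, and combining one
or two pairs of these paths with arcs of `c` and of `D` produces many cycles. As odd cycles have one
of only two lengths `k` and `k + 2 * l`, the lengths of the paths and the positions of their ends on
`D` satisfy a large system of constraints, which determines them almost completely.

* If `D` lies in `K`, the forest can be chosen such that the paths do not all end at one vertex.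
  The constraints (`IsDisjointConfig`) then say that `c` and `D` are pentagons, that `L(G) = {5, 9}`,
  and that every vertex of `c` has exactly one neighbour in `K`, which lies on `D` and is placed as
  in the Petersen graph (`IsDisjointConfig.eq_petersen`). Applying the lemma to the connected set
  `c` and repeating the argument with the roles exchanged shows that `G` is a subgraph of the
  Petersen graph and hence 3-colourable, a contradiction. So `K` always induces a bipartite graph
  (`IsVertexCritical.exists_isProperOn_bool`).
* If `D` and `c` share a vertex, the constraints (`IsSharedConfig`) say that both cycles are
  pentagons and that `L(G) = {5, 7}`, and they restrict the parities of the path lengths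
  (`IsSharedConfig.eq_five_and_parity`). In terms of the 2-colouring of `K`, the neighbours in `K` of
  the vertices `1` and `4` of `c` all have the same colour, and the neighbours of the vertex `2`, or
  those of the vertex `3`, all have the other one. The 2-colouring then extends to a 3-colouring of
  `G`, a contradiction (`IsVertexCritical.false_of_common_vertex`).
-/

namespace SimpleGraph

variable {V : Type*} {G : SimpleGraph V}

/-! ### Paths inside a set and cyclic enumerations -/

/-- There is a path from `x` to `y` of length `n` all of whose vertices lie in `S`. The length is
an integer, so that lengths of arcs can be written as differences of positions. -/
def HasPathIn (G : SimpleGraph V) (S : Set V) (x y : V) (n : ℤ) : Prop :=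
  ∃ p : G.Walk x y, p.IsPath ∧ (p.length : ℤ) = n ∧ ∀ v ∈ p.support, v ∈ S

/-- The integer `z` is even, or it is the length of an odd cycle of `G`. -/
def EvenOrCycleLength (G : SimpleGraph V) (z : ℤ) : Prop :=
  Odd z → ∃ N ∈ G.oddCycleLengths, (N : ℤ) = z

/-- `c` enumerates the vertices of a cycle of length `n` periodically, indexed by all integers, so
that rotations and reflections of the cycle are reindexings of `c`. -/
structure IsCyclicEnum (G : SimpleGraph V) (n : ℤ) (c : ℤ → V) : Prop where
  three_le : 3 ≤ n
  adj : ∀ t, G.Adj (c t) (c (t + 1))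
  eq_iff : ∀ s t, c s = c t ↔ n ∣ s - t

lemma HasPathIn.refl {S : Set V} {x : V} (hx : x ∈ S) : G.HasPathIn S x x 0 :=
  ⟨.nil, .nil, by simp, by simpa using hx⟩

lemma HasPathIn.symm {S : Set V} {x y : V} {n : ℤ} (h : G.HasPathIn S x y n) :
    G.HasPathIn S y x n := by
  obtain ⟨p, hp, hn, hS⟩ := h
  exact ⟨p.reverse, hp.reverse, by simpa using hn, by simpa using hS⟩

lemma HasPathIn.mono {S T : Set V} {x y : V} {n : ℤ} (h : G.HasPathIn S x y n) (hST : S ⊆ T) :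
    G.HasPathIn T x y n := by
  obtain ⟨p, hp, hn, hS⟩ := h
  exact ⟨p, hp, hn, fun v hv => hST (hS v hv)⟩

lemma HasPathIn.left_mem {S : Set V} {x y : V} {n : ℤ} (h : G.HasPathIn S x y n) : x ∈ S := by
  obtain ⟨p, -, -, hS⟩ := h
  exact hS _ p.start_mem_support

lemma HasPathIn.right_mem {S : Set V} {x y : V} {n : ℤ} (h : G.HasPathIn S x y n) : y ∈ S :=
  h.symm.left_mem

lemma HasPathIn.of_adj {S : Set V} {x y : V} (h : G.Adj x y) (hx : x ∈ S) (hy : y ∈ S) :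
    G.HasPathIn S x y 1 := by
  refine ⟨h.toWalk, ?_, by simp, ?_⟩
  · simp [Walk.cons_isPath_iff, h.ne]
  · simp [hx, hy]

lemma HasPathIn.one_le {S : Set V} {x y : V} {n : ℤ} (h : G.HasPathIn S x y n) (hxy : x ≠ y) :
    1 ≤ n := by
  obtain ⟨p, -, rfl, -⟩ := h
  have : p.length ≠ 0 := fun h0 => hxy (Walk.eq_of_length_eq_zero h0)
  omega

lemma HasPathIn.append {S T : Set V} {x y z : V} {n m : ℤ} (h : G.HasPathIn S x y n)
    (h' : G.HasPathIn T y z m) (hST : ∀ v ∈ S, v ∈ T → v = y) :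
    G.HasPathIn (S ∪ T) x z (n + m) := by
  obtain ⟨p, hp, rfl, hS⟩ := h
  obtain ⟨q, hq, rfl, hT⟩ := h'
  refine ⟨p.append q, ?_, by simp, ?_⟩
  · rw [Walk.isPath_def, Walk.support_append, List.nodup_append']
    refine ⟨hp.support_nodup, hq.support_nodup.tail, ?_⟩
    intro v hv hv'
    have h1 := hST v (hS v hv) (hT v (List.mem_of_mem_tail hv'))
    subst h1
    have := hq.support_nodup
    rw [← Walk.cons_tail_support] at this
    exact (List.nodup_cons.1 this).1 hv'
  · intro v hv
    rw [Walk.mem_support_append_iff] at hv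
    exact hv.imp (hS v) (hT v)

/-- Two paths with the same ends and nothing else in common form a cycle, unless both are the same
edge; in that case the total length is even. -/
lemma HasPathIn.evenOrCycleLength {S T : Set V} {x y : V} {n m : ℤ} (h : G.HasPathIn S x y n)
    (h' : G.HasPathIn T y x m) (hxy : x ≠ y) (hST : ∀ v ∈ S, v ∈ T → v = x ∨ v = y) :
    G.EvenOrCycleLength (n + m) := by
  have h1 := h.one_le hxy
  have h2 := h'.one_le hxy.symm
  obtain ⟨p, hp, rfl, hS⟩ := h
  obtain ⟨q, hq, rfl, hT⟩ := h'
  intro hodd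
  refine ⟨(p.append q).length, ⟨?_, x, p.append q, ?_, rfl⟩, by simp⟩
  · rw [Walk.length_append]; exact_mod_cast hodd
  refine hp.isCycle_append hq ?_ ?_
  · intro v hv hv'
    have hpn := hp.support_nodup
    have hqn := hq.support_nodup
    rw [← Walk.cons_tail_support] at hpn hqn
    rcases hST v (hS v (List.mem_of_mem_tail hv)) (hT v (List.mem_of_mem_tail hv')) with rfl | rfl
    · exact (List.nodup_cons.1 hpn).1 hv
    · exact (List.nodup_cons.1 hqn).1 hv'
  · by_contra hcon
    have h3 : p.length = 1 ∧ q.length = 1 := by omega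
    rw [h3.1, h3.2] at hodd
    exact absurd hodd (by decide)

/-- Four paths, arranged cyclically and pairwise disjoint except at the ends that they share, form a
cycle. -/
lemma evenOrCycleLength_of_four {A S B T : Set V} {x y z t : V} {a s b r : ℤ}
    (hA : G.HasPathIn A x y a) (hS : G.HasPathIn S y z s) (hB : G.HasPathIn B z t b)
    (hT : G.HasPathIn T t x r) (hAS : ∀ v ∈ A, v ∈ S → v = y) (hSB : ∀ v ∈ S, v ∈ B → v = z)
    (hBT : ∀ v ∈ B, v ∈ T → v = t) (hTA : ∀ v ∈ T, v ∈ A → v = x) (hAB : Disjoint A B)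
    (hTS : Disjoint S T) : G.EvenOrCycleLength (a + s + b + r) := by
  rw [Set.disjoint_left] at hAB hTS
  have h1 := hA.append hS hAS
  have h2 := hB.append hT hBT
  have hxz : x ≠ z := by
    rintro rfl
    exact hAB hA.left_mem hB.left_mem
  have := h1.evenOrCycleLength h2 hxz (by
    rintro v (hv | hv) (hv' | hv')
    · exact (hAB hv hv').elim
    · exact .inl (hTA v hv' hv)
    · exact .inr (hSB v hv hv')
    · exact (hTS hv hv').elim)
  rwa [show a + s + b + r = a + s + (b + r) by ring]

/-- A sequence of consecutively adjacent, distinct vertices is a path. -/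
lemma hasPathIn_of_seq {c : ℤ → V} {i j : ℤ} (hij : i ≤ j)
    (hadj : ∀ t, i ≤ t → t < j → G.Adj (c t) (c (t + 1))) (hinj : Set.InjOn c (Set.Icc i j)) :
    G.HasPathIn (c '' Set.Icc i j) (c i) (c j) (j - i) := by
  induction j, hij using Int.leInduction with
  | base => simpa using HasPathIn.refl (G := G) (S := c '' Set.Icc i i) ⟨i, by simp, rfl⟩
  | succ j hij ih =>
    have h1 := ih (fun t h1 h2 => hadj t h1 (by omega))
      (hinj.mono (Set.Icc_subset_Icc_right (by omega)))
    have h2 : G.HasPathIn {c j, c (j + 1)} (c j) (c (j + 1)) 1 :=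
      .of_adj (hadj j hij (by omega)) (by simp) (by simp)
    have h3 := h1.append h2 (by
      rintro v ⟨s, hs, rfl⟩ (hv | hv)
      · exact hv
      · have := hinj ⟨hs.1, by have := hs.2; omega⟩ ⟨by omega, le_rfl⟩ hv
        have := hs.2
        omega)
    rw [show j + 1 - i = j - i + 1 by ring]
    refine h3.mono ?_
    rintro v (⟨s, hs, rfl⟩ | hv)
    · exact ⟨s, ⟨hs.1, by have := hs.2; omega⟩, rfl⟩
    · rcases hv with rfl | hv
      · exact ⟨j, ⟨hij, by omega⟩, rfl⟩
      · rw [Set.mem_singleton_iff] at hv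
        exact ⟨j + 1, ⟨by omega, le_rfl⟩, hv.symm⟩

namespace IsCyclicEnum

variable {n : ℤ} {c : ℤ → V}

lemma shift (hc : G.IsCyclicEnum n c) (s : ℤ) : G.IsCyclicEnum n (fun t => c (t + s)) where
  three_le := hc.three_le
  adj t := by simpa [add_right_comm] using hc.adj (t + s)
  eq_iff a b := by rw [hc.eq_iff]; ring_nf

lemma period (hc : G.IsCyclicEnum n c) (t : ℤ) : c (t + n) = c t := by
  rw [hc.eq_iff]; simp

lemma eq_of_abs_lt (hc : G.IsCyclicEnum n c) {s t : ℤ} (h : c s = c t) (h1 : s - t < n)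
    (h2 : t - s < n) : s = t := by
  rw [hc.eq_iff] at h
  have := Int.eq_zero_of_abs_lt_dvd h (abs_lt.2 ⟨by omega, h1⟩)
  omega

lemma injOn (hc : G.IsCyclicEnum n c) {i j : ℤ} (h : j - i < n) : Set.InjOn c (Set.Icc i j) := by
  rintro s ⟨hs, hs'⟩ t ⟨ht, ht'⟩ hst
  exact hc.eq_of_abs_lt hst (by omega) (by omega)

lemma arc (hc : G.IsCyclicEnum n c) {i j : ℤ} (hij : i ≤ j) (h : j - i < n) :
    G.HasPathIn (c '' Set.Icc i j) (c i) (c j) (j - i) :=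
  hasPathIn_of_seq hij (fun t _ _ => hc.adj t) (hc.injOn h)

/-- Every vertex of the cycle occurs in each window of length `n`. -/
lemma exists_window (hc : G.IsCyclicEnum n c) (i t : ℤ) : ∃ s, i ≤ s ∧ s < i + n ∧ c s = c t := by
  have hn := hc.three_le
  refine ⟨i + (t - i) % n, ?_, ?_, ?_⟩
  · have := Int.emod_nonneg (t - i) (show n ≠ 0 by omega); omega
  · have := Int.emod_lt_of_pos (t - i) (show 0 < n by omega); omega
  · rw [hc.eq_iff]
    have := Int.emod_add_mul_ediv (t - i) n
    exact ⟨-((t - i) / n), by linarith⟩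

lemma evenOrCycleLength (hc : G.IsCyclicEnum n c) : G.EvenOrCycleLength n := by
  have hn := hc.three_le
  have h1 := hc.arc (i := 0) (j := 1) (by omega) (by omega)
  have h2 := hc.arc (i := 1) (j := n) (by omega) (by omega)
  have h0 : c n = c 0 := by simpa using hc.period 0
  rw [h0] at h2
  have := h1.evenOrCycleLength h2 (hc.adj 0).ne (by
    rintro v ⟨s, hs, rfl⟩ -
    obtain ⟨hs, hs'⟩ := hs
    obtain rfl | rfl : s = 0 ∨ s = 1 := by omega
    · exact .inl rfl
    · exact .inr rfl)
  simpa using this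

/-- A path `S` between two positions of a cycle closes up with the arc between them. -/
lemma one_handle (hc : G.IsCyclicEnum n c) {S : Set V} {i j r : ℤ} (hij : i < j) (hji : j - i < n)
    (hS : G.HasPathIn S (c i) (c j) r)
    (hSc : ∀ t, i < t → t < j → c t ∉ S) : G.EvenOrCycleLength (r + (j - i)) := by
  refine hS.evenOrCycleLength (hc.arc hij.le hji).symm ?_ ?_
  · intro h
    have := hc.eq_of_abs_lt h (by omega) (by omega)
    omega
  · rintro v hv ⟨t, ⟨ht, ht'⟩, rfl⟩
    by_contra hcon
    push Not at hcon
    refine hSc t ?_ ?_ hv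
    · exact lt_of_le_of_ne ht (by rintro rfl; exact hcon.1 rfl)
    · exact lt_of_le_of_ne ht' (by rintro rfl; exact hcon.2 rfl)

/-- If two disjoint handles `S`, `T` replace the arcs `[i, j]` and `[p, q]` of a cycle of length `n`,
the result is again a cycle. -/
lemma two_handles (hc : G.IsCyclicEnum n c) {S T : Set V} {i j p q r s : ℤ} (hij : i < j)
    (hjp : j < p) (hpq : p < q) (hqi : q < i + n)
    (hS : G.HasPathIn S (c i) (c j) r) (hT : G.HasPathIn T (c p) (c q) s)
    (hSc : ∀ v ∈ S, v ∈ Set.range c → v = c i ∨ v = c j)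
    (hTc : ∀ v ∈ T, v ∈ Set.range c → v = c p ∨ v = c q) (hST : Disjoint S T) :
    G.EvenOrCycleLength (r + s + n - (j - i) - (q - p)) := by
  have hA := hc.arc (i := j) (j := p) hjp.le (by omega)
  have hB := hc.arc (i := q) (j := i + n) (by omega) (by omega)
  rw [hc.period] at hB
  have key : ∀ {a b : ℤ}, c a = c b → a - b < n → b - a < n → a = b := hc.eq_of_abs_lt
  have := evenOrCycleLength_of_four hA hT hB hS ?_ ?_ ?_ ?_ ?_ hST.symm
  · convert this using 1; ring
  · rintro v ⟨t, ⟨ht, ht'⟩, rfl⟩ hv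
    rcases hTc _ hv ⟨t, rfl⟩ with h | h
    · exact h
    · have := key h (by omega) (by omega); omega
  · rintro v hv ⟨t, ⟨ht, ht'⟩, rfl⟩
    rcases hTc _ hv ⟨t, rfl⟩ with h | h
    · have := key (h.trans (hc.period p).symm) (by omega) (by omega); omega
    · exact h
  · rintro v ⟨t, ⟨ht, ht'⟩, rfl⟩ hv
    rcases hSc _ hv ⟨t, rfl⟩ with h | h
    · exact h
    · have := key (h.trans (hc.period j).symm) (by omega) (by omega); omega
  · rintro v hv ⟨t, ⟨ht, ht'⟩, rfl⟩
    rcases hSc _ hv ⟨t, rfl⟩ with h | h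
    · have := key h (by omega) (by omega); omega
    · exact h
  · rw [Set.disjoint_left]
    rintro v ⟨t, ⟨ht, ht'⟩, rfl⟩ ⟨u, ⟨hu, hu'⟩, h⟩
    have := key h (by omega) (by omega); omega

end IsCyclicEnum

/-- A cycle, given as a closed walk, has a cyclic enumeration. -/
lemma Walk.IsCycle.exists_isCyclicEnum {u : V} {C : G.Walk u u} (hC : C.IsCycle) :
    ∃ c : ℤ → V, G.IsCyclicEnum C.length c ∧ Set.range c = {x | x ∈ C.support} := by
  have hn := hC.three_le_length
  have hnz : (C.length : ℤ) ≠ 0 := by omega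
  have hnp : (0 : ℤ) < C.length := by omega
  have hlt : ∀ t : ℤ, (t % C.length).toNat < C.length := fun t => by
    have := Int.emod_nonneg t hnz
    have := Int.emod_lt_of_pos t hnp
    omega
  refine ⟨fun t => C.getVert (t % C.length).toNat, ⟨by omega, fun t => ?_, fun s t => ?_⟩, ?_⟩
  · have h1 := Int.emod_nonneg t hnz
    have h2 := Int.emod_lt_of_pos t hnp
    have h3 := C.adj_getVert_succ (hlt t)
    have h4 : (t + 1) % C.length = (t % C.length + 1) % C.length := by simp
    by_cases h : t % C.length + 1 = C.length
    · have h5 : (t % C.length).toNat + 1 = C.length := by omega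
      rw [h5, C.getVert_length] at h3
      simpa [h4, h] using h3
    · have h5 : ((t + 1) % C.length).toNat = (t % C.length).toNat + 1 := by
        rw [h4, Int.emod_eq_of_lt (by omega) (by omega)]; omega
      simp only [h5]
      exact h3
  · have h1 := Int.emod_nonneg s hnz
    have h2 := Int.emod_nonneg t hnz
    have h3 : s % C.length = t % C.length ↔ (C.length : ℤ) ∣ s - t := by
      rw [Int.emod_eq_emod_iff_emod_sub_eq_zero, Int.dvd_iff_emod_eq_zero]
    rw [← h3]
    constructor
    · intro h
      have := hC.getVert_injOn' (by have := hlt s; simp only [Set.mem_ofPred_eq]; omega)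
        (by have := hlt t; simp only [Set.mem_ofPred_eq]; omega) h
      omega
    · intro h
      simp only [h]
  · ext v
    simp only [Set.mem_range, Set.mem_ofPred_eq, Walk.mem_support_iff_exists_getVert]
    constructor
    · rintro ⟨t, rfl⟩
      exact ⟨_, rfl, (hlt t).le⟩
    · rintro ⟨m, rfl, hm⟩
      rcases hm.lt_or_eq with hm | rfl
      · exact ⟨m, by rw [Int.emod_eq_of_lt (by omega) (by omega)]; simp⟩
      · exact ⟨0, by simp⟩

end SimpleGraph

namespace SimpleGraph

variable {V : Type*} {G : SimpleGraph V}

/-! ### Proper colourings of vertex sets and odd cycles -/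

/-- The map `φ` is a proper colouring of the subgraph induced by `X`; its values outside `X` are
irrelevant. -/
def IsProperOn (G : SimpleGraph V) (X : Set V) {α : Type*} (φ : V → α) : Prop :=
  ∀ u ∈ X, ∀ v ∈ X, G.Adj u v → φ u ≠ φ v

lemma IsProperOn.mono {X Y : Set V} {α : Type*} {φ : V → α} (h : G.IsProperOn Y φ) (hXY : X ⊆ Y) :
    G.IsProperOn X φ := fun u hu v hv => h u (hXY hu) v (hXY hv)

/-- A vertex set whose induced subgraph is not bipartite contains an odd cycle. -/
lemma exists_odd_isCyclicEnum {R : Set V} (hR : ¬ ∃ κ : V → Bool, G.IsProperOn R κ) :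
    ∃ (n : ℤ) (c : ℤ → V), Odd n ∧ G.IsCyclicEnum n c ∧ ∀ t, c t ∈ R := by
  classical
  have h2 : ¬ (G.induce R).Colorable 2 := by
    rintro ⟨C⟩
    refine hR ⟨fun v => if h : v ∈ R then decide (C ⟨v, h⟩ = 0) else false, ?_⟩
    intro u hu v hv huv
    have : C ⟨u, hu⟩ ≠ C ⟨v, hv⟩ := C.valid (by simpa using huv)
    simp only [hu, hv, dif_pos]
    intro h
    rw [decide_eq_decide] at h
    omega
  rw [two_colorable_iff_forall_loop_even] at h2
  push Not at h2
  have hex : ∃ n : ℕ, Odd n ∧ ∃ (u : R) (w : (G.induce R).Walk u u), w.length = n := by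
    obtain ⟨u, w, hw⟩ := h2
    exact ⟨_, Nat.not_even_iff_odd.1 hw, u, w, rfl⟩
  -- A shortest odd closed walk is a cycle: a repetition would split off a shorter one.
  obtain ⟨hodd, u, w, hw⟩ := Nat.find_spec hex
  have hmin : ∀ m : ℕ, Odd m → ∀ (x : R) (p : (G.induce R).Walk x x), p.length = m →
      w.length ≤ m := fun m hm x p hp => hw ▸ Nat.find_min' hex ⟨hm, x, p, hp⟩
  rw [← hw] at hodd
  set N := w.length with hN
  have hinj : ∀ i j : ℕ, i < j → j < N → w.getVert i ≠ w.getVert j := by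
    intro i j hij hj h
    have e1 : (w.drop i).getVert (j - i) = w.getVert i := by
      rw [Walk.drop_getVert, h]; congr 1; omega
    let p : (G.induce R).Walk (w.getVert i) (w.getVert i) := ((w.drop i).take (j - i)).copy rfl e1
    let q : (G.induce R).Walk u u := (w.take i).append ((w.drop j).copy h.symm rfl)
    have hp : p.length = j - i := by
      simp only [p, Walk.length_copy, Walk.take_length, Walk.drop_length]; omega
    have hq : q.length = N - (j - i) := by
      simp only [q, Walk.length_append, Walk.length_copy, Walk.take_length, Walk.drop_length]
      omega
    rcases Nat.even_or_odd (j - i) with he | ho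
    · have : Odd (N - (j - i)) := Nat.Odd.sub_even (by omega) hodd he
      have := hmin _ this _ q hq
      omega
    · have := hmin _ ho _ p hp
      omega
  have hpos : 0 < N := hodd.pos
  have hadj : ∀ i < N, G.Adj (w.getVert i).1 (w.getVert (i + 1)).1 := fun i hi => by
    simpa using w.adj_getVert_succ hi
  have hlast : w.getVert N = w.getVert 0 := by simp [hN]
  have h1 : N ≠ 1 := by
    intro h1
    have := hadj 0 hpos
    rw [zero_add, ← h1, hlast] at this
    exact this.ne rfl
  have hnz : (N : ℤ) ≠ 0 := by omega
  have hnp : (0 : ℤ) < N := by omega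
  have hlt : ∀ t : ℤ, (t % N).toNat < N := fun t => by
    have := Int.emod_nonneg t hnz
    have := Int.emod_lt_of_pos t hnp
    omega
  refine ⟨N, fun t => (w.getVert (t % N).toNat).1, by exact_mod_cast hodd, ⟨?_, fun t => ?_,
    fun s t => ?_⟩, fun t => (w.getVert _).2⟩
  · obtain ⟨a, ha⟩ := hodd; omega
  · have h3 := Int.emod_nonneg t hnz
    have h4 := Int.emod_lt_of_pos t hnp
    have h5 := hadj _ (hlt t)
    have h6 : (t + 1) % N = (t % N + 1) % N := by simp
    by_cases h : t % N + 1 = N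
    · have h7 : (t % N).toNat + 1 = N := by omega
      rw [h7, hlast] at h5
      simpa [h6, h] using h5
    · have h7 : ((t + 1) % N).toNat = (t % N).toNat + 1 := by
        rw [h6, Int.emod_eq_of_lt (by omega) (by omega)]; omega
      simp only [h7]
      exact h5
  · have h3 : s % N = t % N ↔ (N : ℤ) ∣ s - t := by
      rw [Int.emod_eq_emod_iff_emod_sub_eq_zero, Int.dvd_iff_emod_eq_zero]
    rw [← h3]
    constructor
    · intro h
      have hs := Int.emod_nonneg s hnz
      have ht := Int.emod_nonneg t hnz
      have h' := Subtype.ext h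
      rcases lt_trichotomy (s % N).toNat (t % N).toNat with hlt' | he | hgt
      · exact (hinj _ _ hlt' (hlt t) h').elim
      · omega
      · exact (hinj _ _ hgt (hlt s) h'.symm).elim
    · intro h
      simp only [h]

/-- Along a path of consecutive positions of `c`, a two-colouring alternates. -/
lemma IsProperOn.eq_iff_even {X : Set V} {κ : V → Bool} (hκ : G.IsProperOn X κ) {c : ℤ → V}
    (hadj : ∀ t, G.Adj (c t) (c (t + 1))) {i j : ℤ} (hij : i ≤ j)
    (hX : ∀ t, i ≤ t → t ≤ j → c t ∈ X) : κ (c i) = κ (c j) ↔ Even (j - i) := by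
  induction j, hij using Int.leInduction with
  | base => simp
  | succ j hij ih =>
    have h1 := ih (fun t h1 h2 => hX t h1 (by omega))
    have h2 := hκ _ (hX j hij (by omega)) _ (hX (j + 1) (by omega) le_rfl) (hadj j)
    rw [show j + 1 - i = j - i + 1 by ring, Int.even_add_one, ← h1]
    revert h2
    cases κ (c i) <;> cases κ (c j) <;> cases κ (c (j + 1)) <;> simp

lemma IsCyclicEnum.not_isProperOn {n : ℤ} {c : ℤ → V} (hc : G.IsCyclicEnum n c) (hn : Odd n)
    {X : Set V} (hX : ∀ t, c t ∈ X) (κ : V → Bool) : ¬ G.IsProperOn X κ := by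
  intro hκ
  have h3 := hc.three_le
  have h := hκ.eq_iff_even hc.adj (i := 0) (j := n) (by omega) (fun t _ _ => hX t)
  have h0 : c n = c 0 := by simpa using hc.period 0
  rw [h0, sub_zero] at h
  exact Int.not_even_iff_odd.2 hn (h.1 rfl)

/-! ### Connected sets and critical graphs -/

/-- The vertex set `K` induces a connected subgraph, phrased through cuts: every nonempty proper
subset of `K` is joined to the rest of `K` by an edge. The empty set is allowed. -/
def IsConnOn (G : SimpleGraph V) (K : Set V) : Prop :=
  ∀ X ⊆ K, X.Nonempty → X ≠ K → ∃ x ∈ X, ∃ y ∈ K, y ∉ X ∧ G.Adj x y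

/-- `G` is finite and not 3-colourable, but deleting any nonempty set of vertices makes it so. -/
structure IsVertexCritical (G : SimpleGraph V) : Prop where
  finite : Finite V
  not_proper : ∀ φ : V → Fin 3, ¬ G.IsProperOn Set.univ φ
  proper : ∀ X : Set V, X ≠ Set.univ → ∃ φ : V → Fin 3, G.IsProperOn X φ

lemma IsCriticalGraph.isVertexCritical (h : G.IsCriticalGraph 4) : G.IsVertexCritical := by
  classical
  obtain ⟨h4, hsub⟩ := h
  have hc4 : G.Colorable 4 := chromaticNumber_le_iff_colorable.1 h4.le
  have hc3 : ¬ G.Colorable 3 := fun h => by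
    have h5 := chromaticNumber_le_iff_colorable.2 h
    rw [h4] at h5
    exact absurd h5 (by decide)
  have hsub3 : ∀ H : G.Subgraph, H ≠ ⊤ → H.coe.Colorable 3 := by
    intro H hH
    have h5 : H.coe.Colorable 4 := hc4.of_hom H.hom
    have h6 := lt_of_le_of_ne (chromaticNumber_le_iff_colorable.2 h5) (hsub H hH)
    rw [← chromaticNumber_le_iff_colorable]
    have : ((4 : ℕ) : ℕ∞) = ((3 : ℕ) : ℕ∞) + 1 := by norm_num
    rw [this] at h6
    exact Order.le_of_lt_add_one h6
  refine ⟨?_, ?_, ?_⟩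
  · -- An infinite critical graph would have only 3-colourable finite subgraphs.
    by_contra hinf
    rw [not_finite_iff_infinite] at hinf
    refine hc3 (nonempty_hom_of_forall_finite_subgraph_hom (F := completeGraph (Fin 3)) ?_)
    intro H hH
    refine (hsub3 H ?_).some
    rintro rfl
    exact Set.infinite_univ hH
  · intro φ hφ
    exact hc3 ⟨Coloring.mk φ (fun {u v} huv => hφ u trivial v trivial huv)⟩
  · intro X hX
    have h7 : (⊤ : G.Subgraph).induce X ≠ ⊤ := by
      intro h8
      apply hX
      have := congrArg Subgraph.verts h8
      simpa using this
    obtain ⟨C⟩ := hsub3 _ h7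
    refine ⟨fun v => if hv : v ∈ X then C ⟨v, hv⟩ else 0, ?_⟩
    intro u hu v hv huv
    simp only [hu, hv, dif_pos]
    exact C.valid (by simp [Subgraph.coe_adj, hu, hv, huv])

/-- Two colourings of sets that meet in at most one vertex can be combined after permuting the
colours of one of them. -/
lemma exists_isProperOn_of_glue {A B : Set V} {z : V} {φ ψ : V → Fin 3} (hA : G.IsProperOn A φ)
    (hB : G.IsProperOn B ψ) (hAB : ∀ v, v ∈ A ∨ v ∈ B) (hz : ∀ v ∈ A, v ∈ B → v = z)
    (hadj : ∀ u ∈ A, u ∉ B → ∀ v ∈ B, v ∉ A → ¬ G.Adj u v) :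
    ∃ χ : V → Fin 3, G.IsProperOn Set.univ χ := by
  classical
  let χ : V → Fin 3 := fun v => if v ∈ A then φ v else Equiv.swap (ψ z) (φ z) (ψ v)
  have hχA : ∀ v ∈ A, χ v = φ v := fun v hv => by simp [χ, hv]
  have hχB : ∀ v ∈ B, χ v = Equiv.swap (ψ z) (φ z) (ψ v) := fun v hv => by
    by_cases hvA : v ∈ A
    · obtain rfl := hz v hvA hv
      simp [χ, hvA]
    · simp [χ, hvA]
  refine ⟨χ, fun u _ v _ huv => ?_⟩
  have hBB : ∀ u ∈ B, ∀ v ∈ B, G.Adj u v → χ u ≠ χ v := by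
    intro u hu v hv huv h
    rw [hχB u hu, hχB v hv] at h
    exact hB u hu v hv huv ((Equiv.injective _) h)
  by_cases hu : u ∈ A
  · by_cases hv : v ∈ A
    · rw [hχA u hu, hχA v hv]; exact hA u hu v hv huv
    · have hvB := (hAB v).resolve_left hv
      by_cases huB : u ∈ B
      · exact hBB u huB v hvB huv
      · exact (hadj u hu huB v hvB hv huv).elim
  · have huB := (hAB u).resolve_left hu
    by_cases hvB : v ∈ B
    · exact hBB u huB v hvB huv
    · exact (hadj v ((hAB v).resolve_right hvB) hvB u huB hu huv.symm).elim

namespace IsVertexCritical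

/-- A critical graph has no cut vertex. -/
lemma exists_adj_avoiding (hG : G.IsVertexCritical) {X : Set V} {z x₀ y₀ : V} (hx₀ : x₀ ∈ X)
    (hy₀ : y₀ ∉ X) (hyz : y₀ ≠ z) : ∃ x ∈ X, ∃ y, y ∉ X ∧ y ≠ z ∧ G.Adj x y := by
  by_contra hcon
  push Not at hcon
  obtain ⟨φ, hφ⟩ := hG.proper (X ∪ {z}) (by
    intro h
    have : y₀ ∈ X ∪ {z} := h ▸ trivial
    rcases this with h | h
    · exact hy₀ h
    · exact hyz h)
  obtain ⟨ψ, hψ⟩ := hG.proper Xᶜ (by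
    intro h
    have : x₀ ∈ Xᶜ := h ▸ trivial
    exact this hx₀)
  obtain ⟨χ, hχ⟩ := exists_isProperOn_of_glue (z := z) hφ hψ
    (fun v => by by_cases hv : v ∈ X <;> simp [hv])
    (fun v hv hv' => by
      rcases hv with hv | hv
      · exact (hv' hv).elim
      · exact hv)
    (fun u hu hu' v hv hv' => by
      have h1 : u ∈ X := by simpa using hu'
      exact hcon u h1 v hv (fun h => hv' (.inr h)))
  exact hG.not_proper χ hχ

end IsVertexCritical

end SimpleGraph

namespace SimpleGraph

variable {V : Type*} {G : SimpleGraph V}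

/-! ### An odd cycle with connected complement -/

lemma IsConnOn.insert_of_adj {K : Set V} (hK : G.IsConnOn K) {x y : V} (hy : y ∈ K) (hxy : G.Adj x y) :
    G.IsConnOn (insert x K) := by
  classical
  intro X hX hXne hXK
  by_cases hx : x ∈ X
  · by_cases hyX : y ∈ X
    · -- The trace of `X` on `K` is a nonempty proper subset of `K`.
      obtain ⟨u, hu, v, hv, hvX, huv⟩ := hK (X ∩ K) Set.inter_subset_right ⟨y, hyX, hy⟩ (by
        intro h
        apply hXK
        refine hX.antisymm (Set.insert_subset hx ?_)
        rw [← h]; exact Set.inter_subset_left)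
      exact ⟨u, hu.1, v, .inr hv, fun h => hvX ⟨h, hv⟩, huv⟩
    · exact ⟨x, hx, y, .inr hy, hyX, hxy⟩
  · have hXsub : X ⊆ K := fun v hv => (hX hv).resolve_left (by rintro rfl; exact hx hv)
    by_cases h : X = K
    · exact ⟨y, h ▸ hy, x, .inl rfl, hx, hxy.symm⟩
    · obtain ⟨u, hu, v, hv, hvX, huv⟩ := hK X hXsub hXne h
      exact ⟨u, hu, v, .inr hv, hvX, huv⟩

/-- A connected set has at most one two-colouring, up to exchanging the colours. -/
lemma IsConnOn.eq_or_eq_not {J : Set V} (hJ : G.IsConnOn J) {κ κ' : V → Bool}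
    (h : G.IsProperOn J κ) (h' : G.IsProperOn J κ') :
    (∀ v ∈ J, κ v = κ' v) ∨ (∀ v ∈ J, κ v = !κ' v) := by
  by_contra hcon
  push Not at hcon
  obtain ⟨⟨a, ha, ha'⟩, b, hb, hb'⟩ := hcon
  obtain ⟨u, ⟨hu, hu'⟩, v, hv, hvX, huv⟩ := hJ {v ∈ J | κ v = κ' v} (fun v hv => hv.1)
    ⟨b, hb, by revert hb'; cases κ b <;> cases κ' b <;> simp⟩ (by
      intro h
      have : a ∈ {v ∈ J | κ v = κ' v} := by rw [h]; exact ha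
      exact ha' this.2)
  have h1 := h u hu v hv huv
  have h2 := h' u hu v hv huv
  refine hvX ⟨hv, ?_⟩
  revert h1 h2 hu'
  cases κ u <;> cases κ' u <;> cases κ v <;> cases κ' v <;> simp

/-- A nonempty set contains a nonempty connected set that sends no edge to the rest of the set. -/
lemma exists_isConnOn_component [Finite V] {W : Set V} (hW : W.Nonempty) :
    ∃ J ⊆ W, J.Nonempty ∧ G.IsConnOn J ∧ ∀ x ∈ J, ∀ y ∈ W, G.Adj x y → y ∈ J := by
  obtain ⟨J, ⟨hJW, hJne, hJ⟩, hmin⟩ :=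
    (Set.toFinite {J : Set V | J ⊆ W ∧ J.Nonempty ∧
      ∀ x ∈ J, ∀ y ∈ W, G.Adj x y → y ∈ J}).exists_minimal
      ⟨W, subset_rfl, hW, fun _ _ y hy _ => hy⟩
  refine ⟨J, hJW, hJne, ?_, hJ⟩
  intro X hXJ hXne hX
  by_contra hcon
  push Not at hcon
  refine hX (hXJ.antisymm (hmin ⟨hXJ.trans hJW, hXne, ?_⟩ hXJ))
  intro x hx y hy hxy
  by_contra hyX
  exact hcon x hx y (hJ x (hXJ hx) y hy hxy) hyX hxy

lemma exists_pair_avoiding : ∀ (s t : Bool) (p q : Fin 3), ∃ α β : Fin 3, α ≠ β ∧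
    (bif s then β else α) ≠ p ∧ (bif t then β else α) ≠ q := by decide

/-- If three vertices `x`, `y`, `z` of an odd cycle carry signs such that each arc between two of
them that avoids the third has the parity prescribed by the signs, the cycle would be even. -/
lemma IsCyclicEnum.false_of_three {n : ℤ} {c : ℤ → V} (hc : G.IsCyclicEnum n c) (hn : Odd n)
    {R : Set V} (hcR : ∀ t, c t ∈ R) {κ : V → V → Bool} {σ : V → Bool} {M : Set V}
    (hκ : ∀ z ∈ M, G.IsProperOn (R \ {z}) (κ z)) (hσ : ∀ z ∈ M, ∀ x ∈ M, x ≠ z → κ z x = σ x)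
    {x y z : V} (hx : x ∈ M) (hy : y ∈ M) (hz : z ∈ M) (hxy : x ≠ y) (hyz : y ≠ z) (hxz : x ≠ z)
    (hxc : x ∈ Set.range c) (hyc : y ∈ Set.range c) (hzc : z ∈ Set.range c) : False := by
  obtain ⟨i, rfl⟩ := hxc
  obtain ⟨j', rfl⟩ := hyc
  obtain ⟨p', rfl⟩ := hzc
  obtain ⟨j, hj1, hj2, hj⟩ := hc.exists_window i j'
  obtain ⟨p, hp1, hp2, hp⟩ := hc.exists_window i p'
  rw [← hj] at hy hxy hyz
  rw [← hp] at hz hxz hyz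
  have hij : i ≠ j := fun h => hxy (by rw [h])
  have hip : i ≠ p := fun h => hxz (by rw [h])
  have hjp : j ≠ p := fun h => hyz (by rw [h])
  have key : ∀ {a b : ℤ}, c a = c b → a - b < n → b - a < n → a = b := hc.eq_of_abs_lt
  have main : ∀ j p : ℤ, c j ∈ M → c p ∈ M → i < j → j < p → p < i + n → False := by
    intro j p hy hz hij hjp hpn
    have nij : c i ≠ c j := fun h => by have := key h (by omega) (by omega); omega
    have nip : c i ≠ c p := fun h => by have := key h (by omega) (by omega); omega
    have njp : c j ≠ c p := fun h => by have := key h (by omega) (by omega); omega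
    have h1 := (hκ _ hz).eq_iff_even hc.adj (i := i) (j := j) hij.le
      (fun t h1 h2 => ⟨hcR t, fun h => by have := key h (by omega) (by omega); omega⟩)
    have h2 := (hκ _ hx).eq_iff_even hc.adj (i := j) (j := p) hjp.le
      (fun t h1 h2 => ⟨hcR t, fun h => by have := key h (by omega) (by omega); omega⟩)
    have h3 := (hκ _ hy).eq_iff_even hc.adj (i := p) (j := i + n) (by omega)
      (fun t h1 h2 => ⟨hcR t, fun h => by have := key h (by omega) (by omega); omega⟩)
    rw [hc.period, hσ _ hy _ hz njp.symm, hσ _ hy _ hx nij] at h3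
    rw [hσ _ hz _ hx nip, hσ _ hz _ hy njp] at h1
    rw [hσ _ hx _ hy nij.symm, hσ _ hx _ hz nip.symm] at h2
    rw [Int.even_iff] at h1 h2 h3
    rw [Int.odd_iff] at hn
    revert h1 h2 h3
    cases σ (c i) <;> cases σ (c j) <;> cases σ (c p) <;> simp <;> omega
  rcases lt_or_gt_of_ne hjp with h | h
  · exact main j p hy hz (by omega) h hp2
  · exact main p j hz hy (by omega) h hj2

/-- In a critical graph, a connected set `T` whose complement is not bipartite extends to a
connected set `K` whose complement is exactly the vertex set of an odd cycle, each vertex of which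
has a neighbour in `K`. -/
theorem IsVertexCritical.exists_isConnOn_compl_eq_range (hG : G.IsVertexCritical) {T : Set V}
    (hT : G.IsConnOn T) (hTne : T.Nonempty) (hnb : ¬ ∃ κ : V → Bool, G.IsProperOn Tᶜ κ) :
    ∃ (K : Set V) (n : ℤ) (c : ℤ → V), T ⊆ K ∧ G.IsConnOn K ∧ Odd n ∧ G.IsCyclicEnum n c ∧
      Kᶜ = Set.range c ∧ ∀ t, ∃ y ∈ K, G.Adj (c t) y := by
  classical
  have := hG.finite
  obtain ⟨K, ⟨hTK, hK, hKnb⟩, hmax⟩ :=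
    (Set.toFinite {K : Set V | T ⊆ K ∧ G.IsConnOn K ∧
      ¬ ∃ κ : V → Bool, G.IsProperOn Kᶜ κ}).exists_maximal ⟨T, subset_rfl, hT, hnb⟩
  obtain ⟨n, c, hn, hc, hcK⟩ := exists_odd_isCyclicEnum hKnb
  obtain ⟨k₀, hk₀⟩ := hTne.mono hTK
  set N : Set V := {x | x ∉ K ∧ ∃ y ∈ K, G.Adj x y} with hNdef
  -- By maximality, every odd cycle outside `K` passes through all of `N`.
  have hN2 : ∀ x ∈ N, ∃ κ : V → Bool, G.IsProperOn (Kᶜ \ {x}) κ := by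
    rintro x ⟨hx, y, hy, hxy⟩
    by_contra hcon
    have hcompl : (insert x K)ᶜ = Kᶜ \ {x} := by
      ext v
      simp only [Set.mem_compl_iff, Set.mem_insert_iff, Set.mem_sdiff, Set.mem_singleton_iff]
      tauto
    have hmem : T ⊆ insert x K ∧ G.IsConnOn (insert x K) ∧
        ¬ ∃ κ : V → Bool, G.IsProperOn (insert x K)ᶜ κ :=
      ⟨hTK.trans (Set.subset_insert _ _), hK.insert_of_adj hy hxy, hcompl ▸ hcon⟩
    have h1 : insert x K ⊆ K := hmax hmem (Set.subset_insert _ _)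
    exact hx (h1 (Set.mem_insert _ _))
  have hNc : ∀ x ∈ N, x ∈ Set.range c := by
    intro x hx
    by_contra hxc
    obtain ⟨κ, hκ⟩ := hN2 x hx
    exact hc.not_isProperOn hn (X := Kᶜ \ {x}) (fun t => ⟨hcK t, fun h => hxc ⟨t, h⟩⟩) κ hκ
  suffices hsub : Kᶜ ⊆ N by
    refine ⟨K, n, c, hTK, hK, hn, hc, ?_, fun t => (hsub (hcK t)).2⟩
    refine Set.Subset.antisymm (fun v hv => hNc v (hsub hv)) ?_
    rintro _ ⟨t, rfl⟩
    exact hcK t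
  by_contra hcon
  rw [Set.not_subset] at hcon
  obtain ⟨v₀, hv₀K, hv₀N⟩ := hcon
  obtain ⟨J, hJW, hJne, hJ, hJcl⟩ :=
    exists_isConnOn_component (G := G) (W := Kᶜ \ N) ⟨v₀, hv₀K, hv₀N⟩
  have hJnbr : ∀ x ∈ J, ∀ y, G.Adj x y → y ∈ J ∨ y ∈ N := by
    intro x hx y hxy
    by_cases hyN : y ∈ N
    · exact .inr hyN
    · refine .inl (hJcl x hx y ⟨fun hyK => (hJW hx).2 ⟨(hJW hx).1, y, hyK, hxy⟩, hyN⟩ hxy)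
  have hNother : ∀ z, z ≠ v₀ → ∃ y ∈ N, y ≠ z := by
    intro z hz
    obtain ⟨x, hx, y, hy, hyz, hxy⟩ := hG.exists_adj_avoiding hk₀ hv₀K hz.symm
    exact ⟨y, ⟨hy, x, hx, hxy.symm⟩, hyz⟩
  have hNv : ∀ x ∈ N, x ≠ v₀ := by rintro x hx rfl; exact hv₀N hx
  obtain ⟨y₁, hy₁, -⟩ := hNother k₀ (by rintro rfl; exact hv₀K hk₀)
  have hJsub : ∀ y ∈ N, J ⊆ Kᶜ \ {y} := fun y hy v hv =>
    ⟨(hJW hv).1, by rintro rfl; exact (hJW hv).2 hy⟩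
  obtain ⟨κ₀, hκ₀⟩ := hN2 y₁ hy₁
  replace hκ₀ := hκ₀.mono (hJsub y₁ hy₁)
  have hκ : ∀ y ∈ N, ∃ κ : V → Bool, G.IsProperOn (Kᶜ \ {y}) κ ∧ ∀ v ∈ J, κ v = κ₀ v := by
    intro y hy
    obtain ⟨κ, hκ⟩ := hN2 y hy
    rcases hJ.eq_or_eq_not (hκ.mono (hJsub y hy)) hκ₀ with h | h
    · exact ⟨κ, hκ, h⟩
    · refine ⟨fun v => !κ v, fun u hu v hv huv h' => hκ u hu v hv huv ?_, fun v hv => ?_⟩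
      · simpa using h'
      · simp [h v hv]
  choose! κ hκ hκJ using hκ
  let M : Set V := {x | x ∈ N ∧ ∃ j ∈ J, G.Adj x j}
  -- All neighbours of `x ∈ M` in `J` have the same colour, opposite to the sign of `x`.
  have hval : ∀ x ∈ N, ∀ y ∈ N, x ≠ y → ∀ j ∈ J, G.Adj x j → κ y x = !κ₀ j := by
    intro x hx y hy hxy j hj hxj
    have h1 := hκ y hy x ⟨hx.1, hxy⟩ j (hJsub y hy hj) hxj
    rw [hκJ y hy j hj] at h1
    revert h1
    cases κ y x <;> cases κ₀ j <;> simp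
  have hsign : ∀ x ∈ M, ∃ s : Bool, (∀ y ∈ N, x ≠ y → κ y x = s) ∧
      ∀ j ∈ J, G.Adj x j → κ₀ j = !s := by
    rintro x ⟨hx, j, hj, hxj⟩
    obtain ⟨y, hy, hyx⟩ := hNother x (hNv x hx)
    refine ⟨!κ₀ j, fun y hy hxy => hval x hx y hy hxy j hj hxj, fun j' hj' hxj' => ?_⟩
    rw [← hval x hx y hy hyx.symm j hj hxj, hval x hx y hy hyx.symm j' hj' hxj', Bool.not_not]
  choose! σ hσ hσJ using hsign
  obtain ⟨a, b, hab⟩ : ∃ a b, ∀ x ∈ M, x = a ∨ x = b := by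
    by_contra hcon
    push Not at hcon
    obtain ⟨x, hx, -⟩ := hcon v₀ v₀
    obtain ⟨y, hy, hyx, -⟩ := hcon x x
    obtain ⟨z, hz, hzx, hzy⟩ := hcon x y
    exact hc.false_of_three hn hcK (M := M) (fun z hz => hκ z hz.1)
      (fun z hz x hx hxz => hσ x hx z hz.1 hxz) hx hy hz hyx.symm hzy.symm hzx.symm
      (hNc x hx.1) (hNc y hy.1) (hNc z hz.1)
  obtain ⟨φ, hφ⟩ := hG.proper Jᶜ (by
    obtain ⟨j, hj⟩ := hJne
    intro h
    have : j ∈ Jᶜ := h ▸ trivial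
    exact this hj)
  obtain ⟨α, β, hαβ, ha, hb⟩ := exists_pair_avoiding (σ a) (σ b) (φ a) (φ b)
  have hout : ∀ x ∈ J, ∀ y, y ∉ J → G.Adj x y → (bif κ₀ x then α else β) ≠ φ y := by
    intro x hx y hy hxy
    have hyM : y ∈ M := ⟨(hJnbr x hx y hxy).resolve_left hy, x, hx, hxy.symm⟩
    rw [hσJ y hyM x hx hxy.symm]
    rcases hab y hyM with rfl | rfl
    · revert ha; cases σ y <;> simp
    · revert hb; cases σ y <;> simp
  refine hG.not_proper (fun v => if v ∈ J then (bif κ₀ v then α else β) else φ v) ?_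
  intro u _ v _ huv
  by_cases hu : u ∈ J <;> by_cases hv : v ∈ J <;> simp only [hu, hv, if_true, if_false]
  · have := hκ₀ u hu v hv huv
    revert this
    cases κ₀ u <;> cases κ₀ v <;> simp [hαβ, hαβ.symm]
  · exact hout u hu v hv huv
  · exact (hout v hv u hu huv.symm).symm
  · exact hφ u hu v hv huv

end SimpleGraph

namespace SimpleGraph

variable {V : Type*} {G : SimpleGraph V}

/-! ### Rooted forests -/

/-- A spanning forest of the vertex set `K` in which each tree contains exactly one vertex of the
root set `B`: `par` is the parent map, and `ht v` is the number of steps from `v` to its root. The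
value of `par` at a root is irrelevant. -/
structure IsForest (G : SimpleGraph V) (K B : Set V) (par : V → V) (ht : V → ℕ) : Prop where
  subset : B ⊆ K
  ht_root : ∀ v ∈ B, ht v = 0
  step : ∀ v ∈ K, v ∉ B → G.Adj v (par v) ∧ par v ∈ K ∧ ht v = ht (par v) + 1

/-- The ancestor of `v` at height `t`, which is meaningful for `t ≤ ht v`. -/
def forestAnc (par : V → V) (ht : V → ℕ) (v : V) (t : ℕ) : V := par^[ht v - t] v

lemma forestAnc_self (par : V → V) (ht : V → ℕ) (v : V) : forestAnc par ht v (ht v) = v := by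
  simp [forestAnc]

lemma IsConnOn.exists_isForest [Finite V] {K B : Set V} (hK : G.IsConnOn K) (hBK : B ⊆ K)
    (hB : B.Nonempty) : ∃ par ht, G.IsForest K B par ht := by
  classical
  obtain ⟨F, ⟨hFK, par, ht, hF⟩, hmax⟩ :=
    (Set.toFinite {F : Set V | F ⊆ K ∧ ∃ par ht, G.IsForest F B par ht}).exists_maximal
      ⟨B, hBK, id, 0, subset_rfl, fun _ _ => rfl, fun v hv hv' => (hv' hv).elim⟩
  by_cases h : F = K
  · exact ⟨par, ht, h ▸ hF⟩
  obtain ⟨x, hx, y, hy, hyF, hxy⟩ := hK F hFK (hB.mono hF.subset) h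
  have hyB : y ∉ B := fun h => hyF (hF.subset h)
  have hne : ∀ v ∈ F, v ≠ y := by rintro v hv rfl; exact hyF hv
  have hmem : insert y F ⊆ K ∧ ∃ par ht, G.IsForest (insert y F) B par ht := by
    refine ⟨Set.insert_subset hy hFK, Function.update par y x, Function.update ht y (ht x + 1),
      hF.subset.trans (Set.subset_insert _ _), fun v hv => ?_, fun v hv hvB => ?_⟩
    · rw [Function.update_of_ne (hne v (hF.subset hv))]; exact hF.ht_root v hv
    · rcases hv with rfl | hv
      · refine ⟨by simpa using hxy.symm, by simp [hx], ?_⟩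
        simp [Function.update_of_ne (hne x hx)]
      · obtain ⟨h1, h2, h3⟩ := hF.step v hv hvB
        rw [Function.update_of_ne (hne v hv), Function.update_of_ne (hne v hv),
          Function.update_of_ne (hne _ h2)]
        exact ⟨h1, .inr h2, h3⟩
  exact (hyF (hmax hmem (Set.subset_insert _ _) (Set.mem_insert _ _))).elim

namespace IsForest

variable {K B : Set V} {par : V → V} {ht : V → ℕ}

lemma mem_root (hF : G.IsForest K B par ht) {v : V} (hv : v ∈ K) (h : ht v = 0) : v ∈ B := by
  by_contra hvB
  have := (hF.step v hv hvB).2.2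
  omega

lemma anc_step (hF : G.IsForest K B par ht) {v : V} (hv : v ∈ K) {t : ℕ} (h : t < ht v) :
    forestAnc par ht v t = forestAnc par ht (par v) t ∧ G.Adj v (par v) ∧ par v ∈ K ∧
      ht v = ht (par v) + 1 := by
  have hvB : v ∉ B := fun hvB => by have := hF.ht_root v hvB; omega
  have h1 := hF.step v hv hvB
  refine ⟨?_, h1⟩
  rw [forestAnc, forestAnc, show ht v - t = (ht (par v) - t) + 1 by omega,
    Function.iterate_succ_apply]

/-- Induction along a forest, from the roots upwards. -/
lemma induction (hF : G.IsForest K B par ht) {P : V → Prop} (h0 : ∀ v ∈ B, P v)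
    (h1 : ∀ v ∈ K, v ∉ B → P (par v) → P v) : ∀ v ∈ K, P v := by
  have : ∀ n : ℕ, ∀ v ∈ K, ht v = n → P v := by
    intro n
    induction n with
    | zero => exact fun v hv h => h0 v (hF.mem_root hv h)
    | succ n ih =>
      intro v hv h
      have hvB : v ∉ B := fun hvB => by have := hF.ht_root v hvB; omega
      obtain ⟨-, h2, h3⟩ := hF.step v hv hvB
      exact h1 v hv hvB (ih _ h2 (by omega))
  exact fun v hv => this _ v hv rfl

lemma anc_mem (hF : G.IsForest K B par ht) {v : V} (hv : v ∈ K) {t : ℕ} (h : t ≤ ht v) :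
    forestAnc par ht v t ∈ K ∧ ht (forestAnc par ht v t) = t := by
  revert t
  refine hF.induction (P := fun v => ∀ {t : ℕ}, t ≤ ht v → forestAnc par ht v t ∈ K ∧
    ht (forestAnc par ht v t) = t) ?_ ?_ v hv
  · intro v hv t h
    rw [hF.ht_root v hv] at h
    obtain rfl : t = ht v := by rw [hF.ht_root v hv]; omega
    rw [forestAnc_self]
    exact ⟨hF.subset hv, rfl⟩
  · intro v hv hvB ih t h
    rcases h.lt_or_eq with h | rfl
    · obtain ⟨h1, -, -, h2⟩ := hF.anc_step hv h
      rw [h1]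
      exact ih (by omega)
    · rw [forestAnc_self]
      exact ⟨hv, rfl⟩

lemma anc_anc (hF : G.IsForest K B par ht) {v : V} (hv : v ∈ K) {s t : ℕ} (hts : t ≤ s)
    (h : s ≤ ht v) : forestAnc par ht (forestAnc par ht v s) t = forestAnc par ht v t := by
  have h1 := (hF.anc_mem hv h).2
  rw [forestAnc, h1, forestAnc, forestAnc, ← Function.iterate_add_apply]
  congr 1
  omega

lemma anc_congr (hF : G.IsForest K B par ht) {u v : V} (hu : u ∈ K) (hv : v ∈ K) {s t : ℕ}
    (hts : t ≤ s) (hsu : s ≤ ht u) (hsv : s ≤ ht v)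
    (h : forestAnc par ht u s = forestAnc par ht v s) :
    forestAnc par ht u t = forestAnc par ht v t := by
  rw [← hF.anc_anc hu hts hsu, h, hF.anc_anc hv hts hsv]

lemma root_mem (hF : G.IsForest K B par ht) {v : V} (hv : v ∈ K) : forestAnc par ht v 0 ∈ B := by
  obtain ⟨h1, h2⟩ := hF.anc_mem hv (Nat.zero_le _)
  exact hF.mem_root h1 h2

lemma root_of_mem (hF : G.IsForest K B par ht) {v : V} (hv : v ∈ B) : forestAnc par ht v 0 = v := by
  have := forestAnc_self par ht v
  rwa [hF.ht_root v hv] at this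

/-- The path in the forest from `v` down to its ancestor at height `t`. -/
lemma path_to_anc (hF : G.IsForest K B par ht) {v : V} (hv : v ∈ K) {t : ℕ} (h : t ≤ ht v) :
    G.HasPathIn {x | ∃ s, t ≤ s ∧ s ≤ ht v ∧ x = forestAnc par ht v s} v (forestAnc par ht v t)
      (ht v - t) := by
  have h1 : ∀ s : ℕ, s < ht v → G.Adj (forestAnc par ht v s) (forestAnc par ht v (s + 1)) := by
    intro s hs
    obtain ⟨h1, h2⟩ := hF.anc_mem hv (show s + 1 ≤ ht v by omega)
    obtain ⟨h3, h4, h5, h6⟩ := hF.anc_step h1 (show s < ht _ by omega)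
    rw [hF.anc_anc hv (by omega) hs] at h3
    have h7 := forestAnc_self par ht (par (forestAnc par ht v (s + 1)))
    rw [show ht (par (forestAnc par ht v (s + 1))) = s by omega] at h7
    rw [h3, h7]
    exact h4.symm
  have := hasPathIn_of_seq (G := G) (c := fun s : ℤ => forestAnc par ht v s.toNat) (i := t)
    (j := ht v) (by omega) (fun s hs hs' => by
      rw [show (s + 1).toNat = s.toNat + 1 by omega]
      exact h1 _ (by omega)) (by
      rintro a ⟨ha, ha'⟩ b ⟨hb, hb'⟩ hab
      have e1 := (hF.anc_mem hv (show a.toNat ≤ ht v by omega)).2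
      have e2 := (hF.anc_mem hv (show b.toNat ≤ ht v by omega)).2
      simp only at hab
      rw [hab] at e1
      omega)
  simp only [Int.toNat_natCast, forestAnc_self] at this
  refine this.symm.mono ?_
  rintro x ⟨s, ⟨hs, hs'⟩, rfl⟩
  exact ⟨s.toNat, by omega, by omega, rfl⟩

/-- The set of vertices of `K` whose root lies in `I`. -/
def rootsIn (par : V → V) (ht : V → ℕ) (K I : Set V) : Set V := {x ∈ K | forestAnc par ht x 0 ∈ I}

lemma path_to_root (hF : G.IsForest K B par ht) {v : V} (hv : v ∈ K) :
    G.HasPathIn (rootsIn par ht K {forestAnc par ht v 0}) v (forestAnc par ht v 0) (ht v) := by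
  have := hF.path_to_anc hv (Nat.zero_le _)
  rw [Nat.cast_zero, sub_zero] at this
  refine this.mono ?_
  rintro x ⟨s, -, hs, rfl⟩
  exact ⟨(hF.anc_mem hv hs).1, hF.anc_anc hv (Nat.zero_le _) hs⟩

/-- Two vertices of different trees are joined by a path through any path between their roots inside
the root set. -/
lemma path_between (hF : G.IsForest K B par ht) {u v : V} (hu : u ∈ K) (hv : v ∈ K) {I : Set V}
    {y : ℤ} (hIB : I ⊆ B) (hI : G.HasPathIn I (forestAnc par ht u 0) (forestAnc par ht v 0) y)
    (hne : forestAnc par ht u 0 ≠ forestAnc par ht v 0) :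
    G.HasPathIn (rootsIn par ht K I) u v (ht u + y + ht v) := by
  have h1 := hF.path_to_root hu
  have h2 := (hF.path_to_root hv).symm
  have h3 := (h1.append hI ?_).append h2 ?_
  · refine h3.mono ?_
    rintro x ((⟨hx, hx'⟩ | hx) | ⟨hx, hx'⟩)
    · rw [Set.mem_singleton_iff] at hx'
      exact ⟨hx, hx' ▸ hI.left_mem⟩
    · exact ⟨hF.subset (hIB hx), by rwa [hF.root_of_mem (hIB hx)]⟩
    · rw [Set.mem_singleton_iff] at hx'
      exact ⟨hx, hx' ▸ hI.right_mem⟩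
  · rintro x ⟨-, hx⟩ hx'
    rwa [hF.root_of_mem (hIB hx')] at hx
  · rintro x (⟨-, hx⟩ | hx) ⟨-, hx'⟩
    · rw [Set.mem_singleton_iff] at hx hx'
      exact (hne (hx.symm.trans hx')).elim
    · rwa [hF.root_of_mem (hIB hx)] at hx'

/-- The height of the last common ancestor of two vertices. -/
noncomputable def meetHt (par : V → V) (ht : V → ℕ) (u v : V) : ℕ := by
  classical
  exact Nat.findGreatest (fun t => forestAnc par ht u t = forestAnc par ht v t) (min (ht u) (ht v))

lemma meetHt_le (par : V → V) (ht : V → ℕ) (u v : V) : meetHt par ht u v ≤ min (ht u) (ht v) := by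
  classical
  exact Nat.findGreatest_le _

lemma anc_meetHt {u v : V} (h : forestAnc par ht u 0 = forestAnc par ht v 0) :
    forestAnc par ht u (meetHt par ht u v) = forestAnc par ht v (meetHt par ht u v) := by
  classical
  exact Nat.findGreatest_spec (P := fun t => forestAnc par ht u t = forestAnc par ht v t)
    (Nat.zero_le _) h

lemma le_meetHt {u v : V} {t : ℕ} (htu : t ≤ ht u) (htv : t ≤ ht v)
    (h : forestAnc par ht u t = forestAnc par ht v t) : t ≤ meetHt par ht u v := by
  classical
  exact Nat.le_findGreatest (by omega) h

lemma meetHt_ultrametric (hF : G.IsForest K B par ht) {u v w : V} (hu : u ∈ K) (hv : v ∈ K)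
    (hw : w ∈ K) (huv : forestAnc par ht u 0 = forestAnc par ht v 0)
    (hvw : forestAnc par ht v 0 = forestAnc par ht w 0) :
    min (meetHt par ht u v) (meetHt par ht v w) ≤ meetHt par ht u w := by
  have h1 := meetHt_le par ht u v
  have h2 := meetHt_le par ht v w
  refine le_meetHt (by omega) (by omega) ?_
  rw [hF.anc_congr hu hv (min_le_left _ _) (by omega) (by omega) (anc_meetHt huv),
    hF.anc_congr hv hw (min_le_right _ _) (by omega) (by omega) (anc_meetHt hvw)]

/-- The path in the forest between two vertices of the same tree. -/
lemma path_within (hF : G.IsForest K B par ht) {u v : V} (hu : u ∈ K) (hv : v ∈ K)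
    (h : forestAnc par ht u 0 = forestAnc par ht v 0) :
    G.HasPathIn (rootsIn par ht K {forestAnc par ht u 0}) u v
      (ht u + ht v - 2 * meetHt par ht u v) := by
  have hle := meetHt_le par ht u v
  have hm := anc_meetHt h
  have h1 := hF.path_to_anc hu (t := meetHt par ht u v) (by omega)
  have h2 := (hF.path_to_anc hv (t := meetHt par ht u v) (by omega)).symm
  rw [← hm] at h2
  have h3 := h1.append h2 (by
    rintro x ⟨s, hs, hs', rfl⟩ ⟨r, hr, hr', hx⟩
    have e1 := (hF.anc_mem hu hs').2
    rw [hx, (hF.anc_mem hv hr').2] at e1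
    subst e1
    have := le_meetHt hs' hr' hx
    rw [show r = meetHt par ht u v by omega])
  rw [show (ht u + ht v - 2 * meetHt par ht u v : ℤ) =
    (ht u - meetHt par ht u v) + (ht v - meetHt par ht u v) by ring]
  refine h3.mono ?_
  rintro x (⟨s, -, hs, rfl⟩ | ⟨s, -, hs, rfl⟩)
  · exact ⟨(hF.anc_mem hu hs).1, hF.anc_anc hu (Nat.zero_le _) hs⟩
  · exact ⟨(hF.anc_mem hv hs).1, (hF.anc_anc hv (Nat.zero_le _) hs).trans h.symm⟩

end IsForest

end SimpleGraph

namespace SimpleGraph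

variable {V : Type*} {G : SimpleGraph V}

/-! ### Forests separating the attachments of the complement -/

namespace IsForest

variable {K B : Set V} {par : V → V} {ht : V → ℕ}

/-- The set of descendants of `u` in a forest spanning `K`, including `u` itself. -/
def descendants (par : V → V) (ht : V → ℕ) (K : Set V) (u : V) : Set V :=
  {v ∈ K | ht u ≤ ht v ∧ forestAnc par ht v (ht u) = u}

lemma self_mem_descendants {u : V} (hu : u ∈ K) : u ∈ descendants par ht K u :=
  ⟨hu, le_rfl, forestAnc_self _ _ _⟩

lemma descendants_trans (hF : G.IsForest K B par ht) {u v w : V}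
    (huv : v ∈ descendants par ht K u) (hvw : w ∈ descendants par ht K v) :
    w ∈ descendants par ht K u := by
  obtain ⟨-, h1, h2⟩ := huv
  obtain ⟨h3, h4, h5⟩ := hvw
  exact ⟨h3, h1.trans h4, by rw [← hF.anc_anc h3 h1 h4, h5, h2]⟩

lemma ht_lt_of_mem_descendants {u v : V} (hv : v ∈ descendants par ht K u) (hne : v ≠ u) :
    ht u < ht v := by
  obtain ⟨-, h1, h2⟩ := hv
  refine lt_of_le_of_ne h1 fun h => hne ?_
  rw [h, forestAnc_self] at h2
  exact h2

/-- The subtree above a vertex `u` can be cut off and hung onto a neighbour `y` of `u` outside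
it. -/
lemma exists_reparent (hF : G.IsForest K B par ht) {u y : V} (hu : u ∈ K) (huB : u ∉ B)
    (hy : y ∈ K) (hyu : y ∉ descendants par ht K u) (huy : G.Adj u y) :
    ∃ par' ht', G.IsForest K B par' ht' ∧
      (∀ v ∈ K, v ∉ descendants par ht K u → ht' v = ht v ∧
        ∀ t ≤ ht v, forestAnc par' ht' v t = forestAnc par ht v t) ∧
      ∀ v ∈ descendants par ht K u, ht y < ht' v ∧
        (∀ t ≤ ht y, forestAnc par' ht' v t = forestAnc par ht y t) ∧
        ∀ t, ht y < t → t ≤ ht' v → forestAnc par' ht' v t ∈ descendants par ht K u := by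
  classical
  have hB : ∀ v ∈ B, v ∉ descendants par ht K u := by
    rintro v hv ⟨-, h1, h2⟩
    rw [hF.ht_root v hv, Nat.le_zero] at h1
    exact huB (hF.mem_root hu h1)
  have hpar : ∀ v ∈ K, v ∉ B → v ≠ u →
      (v ∈ descendants par ht K u ↔ par v ∈ descendants par ht K u) := by
    intro v hv hvB hvu
    obtain ⟨h1, h2, h3⟩ := hF.step v hv hvB
    constructor
    · intro h
      have hlt := ht_lt_of_mem_descendants h hvu
      exact ⟨h2, by omega, by rw [← (hF.anc_step hv hlt).1]; exact h.2.2⟩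
    · rintro ⟨-, h4, h5⟩
      exact ⟨hv, by omega, by rw [(hF.anc_step hv (by omega)).1]; exact h5⟩
  let par' := Function.update par u y
  let ht' : V → ℕ := fun v => if v ∈ descendants par ht K u then ht v - ht u + (ht y + 1) else ht v
  have hd : ∀ v ∈ descendants par ht K u, ht' v = ht v - ht u + (ht y + 1) := fun v hv => if_pos hv
  have hn : ∀ v, v ∉ descendants par ht K u → ht' v = ht v := fun v hv => if_neg hv
  have huu := self_mem_descendants (par := par) (ht := ht) hu
  have hF' : G.IsForest K B par' ht' := by
    refine ⟨hF.subset, fun v hv => (hn v (hB v hv)).trans (hF.ht_root v hv), fun v hv hvB => ?_⟩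
    by_cases hvu : v = u
    · subst hvu
      simp only [par', Function.update_self]
      exact ⟨huy, hy, by rw [hd v huu, hn y hyu]; omega⟩
    · obtain ⟨h1, h2, h3⟩ := hF.step v hv hvB
      simp only [par', Function.update_of_ne hvu]
      refine ⟨h1, h2, ?_⟩
      by_cases hv' : v ∈ descendants par ht K u
      · have h4 := (hpar v hv hvB hvu).1 hv'
        have := h4.2.1
        rw [hd v hv', hd _ h4]
        omega
      · rw [hn v hv', hn _ (fun h => hv' ((hpar v hv hvB hvu).2 h)), h3]
  have hout : ∀ v ∈ K, v ∉ descendants par ht K u →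
      ∀ t ≤ ht v, forestAnc par' ht' v t = forestAnc par ht v t := by
    refine hF.induction (fun v hv hvd t h => ?_) (fun v hv hvB ih hvd t h => ?_)
    · rw [hF.ht_root v hv, Nat.le_zero] at h
      subst h
      rw [hF'.root_of_mem hv, hF.root_of_mem hv]
    · have hvu : v ≠ u := by rintro rfl; exact hvd huu
      rcases h.lt_or_eq with h | h
      · rw [(hF'.anc_step hv (by rwa [hn v hvd])).1, (hF.anc_step hv h).1]
        have := (hF.step v hv hvB).2.2
        simp only [par', Function.update_of_ne hvu]
        exact ih (fun h => hvd ((hpar v hv hvB hvu).2 h)) t (by omega)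
      · rw [h, forestAnc_self, ← hn v hvd, forestAnc_self]
  have hin : ∀ v ∈ K, v ∈ descendants par ht K u → 
      (∀ t ≤ ht y, forestAnc par' ht' v t = forestAnc par ht y t) ∧
        ∀ t, ht y < t → t ≤ ht' v → forestAnc par' ht' v t ∈ descendants par ht K u := by
    refine hF.induction (fun v hv hvd => (hB v hv hvd).elim) (fun v hv hvB ih hvd => ?_)
    have hlt : ht y < ht' v := by rw [hd v hvd]; omega
    by_cases hvu : v = u
    · subst hvu
      refine ⟨fun t h => ?_, fun t h h' => ?_⟩
      · rw [(hF'.anc_step hv (by omega)).1]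
        simp only [par', Function.update_self]
        exact hout y hy hyu t h
      · obtain rfl : t = ht' v := by rw [hd v hvd] at h' ⊢; omega
        rwa [forestAnc_self]
    · have hp := (hpar v hv hvB hvu).1 hvd
      have e : par' v = par v := Function.update_of_ne hvu _ _
      have hs : ∀ t < ht' v, forestAnc par' ht' v t = forestAnc par' ht' (par v) t := fun t h => by
        rw [(hF'.anc_step hv h).1, e]
      refine ⟨fun t h => ?_, fun t h h' => ?_⟩
      · rw [hs t (by omega)]
        exact (ih hp).1 t h
      · rcases h'.lt_or_eq with h' | rfl
        · rw [hs t h']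
          have := (hF'.step v hv hvB).2.2
          rw [e] at this
          exact (ih hp).2 t h (by omega)
        · rwa [forestAnc_self]
  exact ⟨par', ht', hF', fun v hv h => ⟨hn v h, hout v hv h⟩,
    fun v hv => ⟨by rw [hd v hv]; omega, hin v hv.1 hv⟩⟩

/-- If a set has all its roots equal, then it has a common ancestor of maximal height. -/
lemma exists_maximal_common_ancestor [Finite V] (hF : G.IsForest K B par ht) {N : Set V}
    (hNK : N ⊆ K) (hN : N.Nonempty)
    (h : ∀ u ∈ N, ∀ v ∈ N, forestAnc par ht u 0 = forestAnc par ht v 0) :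
    ∃ z ∈ K, N ⊆ descendants par ht K z ∧
      ∀ z' ∈ K, N ⊆ descendants par ht K z' → ht z' ≤ ht z := by
  obtain ⟨v₀, hv₀⟩ := hN
  have hr := hF.root_mem (hNK hv₀)
  obtain ⟨z, ⟨hz, hz'⟩, hmax⟩ := Set.exists_max_image {z | z ∈ K ∧ N ⊆ descendants par ht K z} ht
    (Set.toFinite _) ⟨forestAnc par ht v₀ 0, hF.subset hr, fun v hv => ⟨hNK hv, by
      rw [hF.ht_root _ hr]; exact Nat.zero_le _, by rw [hF.ht_root _ hr]; exact h v hv v₀ hv₀⟩⟩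
  exact ⟨z, hz, hz', fun z' h1 h2 => hmax z' ⟨h1, h2⟩⟩

end IsForest

open IsForest in
/-- In a vertex-critical graph, the forest on `K` can be chosen in such a way that the vertices of
`K` with a neighbour outside `K` do not all lie in the same tree. Otherwise take a forest in which
the last common ancestor `z` of these vertices is as low as possible and, subject to this, has as
few descendants as possible. Since no edge set leaving a vertex set passes through the single
vertex `z`, some proper descendant of `z` has a neighbour that is no descendant of `z`; hanging it
onto this neighbour improves the forest. -/
theorem IsVertexCritical.exists_isForest_root_ne (hG : G.IsVertexCritical) {K B : Set V}
    (hK : G.IsConnOn K) (hKc : Kᶜ.Nonempty) (hBK : B ⊆ K) (hB : B.Nontrivial) :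
    ∃ par ht, G.IsForest K B par ht ∧ ∃ u ∈ K, ∃ v ∈ K, (∃ x ∉ K, G.Adj x u) ∧
      (∃ x ∉ K, G.Adj x v) ∧ forestAnc par ht u 0 ≠ forestAnc par ht v 0 := by
  classical
  have := hG.finite
  by_contra! hcon
  set N : Set V := {v ∈ K | ∃ x ∉ K, G.Adj x v} with hNdef
  have hNK : N ⊆ K := fun v hv => hv.1
  have hroot : ∀ par ht, G.IsForest K B par ht → ∀ u ∈ N, ∀ v ∈ N,
      forestAnc par ht u 0 = forestAnc par ht v 0 := by
    rintro par ht hF u ⟨hu, x, hx, hxu⟩ v ⟨hv, x', hx', hxv⟩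
    exact hcon par ht hF u hu v hv ⟨x, hx, hxu⟩ ⟨x', hx', hxv⟩
  obtain ⟨x₀, hx₀⟩ := hKc
  have hN : N.Nonempty := by
    obtain ⟨b, hb, b', hb', hbb⟩ := hB
    obtain ⟨x, hx, y, hy, -, hxy⟩ := hG.exists_adj_avoiding (X := Kᶜ) (z := b) hx₀
      (y₀ := b') (fun h => h (hBK hb')) hbb.symm
    exact ⟨y, not_not.1 hy, x, hx, hxy⟩
  have key : ∀ t s : ℕ, ∀ par ht, G.IsForest K B par ht → ∀ z ∈ K, N ⊆ descendants par ht K z →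
      (∀ z' ∈ K, N ⊆ descendants par ht K z' → ht z' ≤ ht z) → ht z = t →
      (descendants par ht K z).ncard = s → False := by
    intro t
    induction t using Nat.strong_induction_on with
    | _ t iht =>
    intro s
    induction s using Nat.strong_induction_on with
    | _ s ihs =>
    intro par ht hF z hz hNz hmax hzt hs
    obtain ⟨y₀, hy₀, hy₀z⟩ : ∃ y₀, y₀ ∉ Kᶜ ∪ descendants par ht K z \ {z} ∧ y₀ ≠ z := by
      by_cases hzB : z ∈ B
      · obtain ⟨b, hb, hbz⟩ := hB.exists_ne z
        refine ⟨b, ?_, hbz⟩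
        rintro (h | ⟨⟨-, -, h⟩, -⟩)
        · exact h (hBK hb)
        · rw [hF.ht_root z hzB, hF.root_of_mem hb] at h
          exact hbz h
      · have hr := hF.root_mem hz
        refine ⟨forestAnc par ht z 0, ?_, fun h => hzB (h ▸ hr)⟩
        rintro (h | ⟨⟨-, h, -⟩, -⟩)
        · exact h (hBK hr)
        · rw [hF.ht_root _ hr, Nat.le_zero] at h
          exact hzB (hF.mem_root hz h)
    obtain ⟨u, hu, y, hy, hyz, huy⟩ := hG.exists_adj_avoiding (.inl hx₀) hy₀ hy₀z
    have hyK : y ∈ K := by by_contra h; exact hy (.inl h)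
    have hyd : y ∉ descendants par ht K z := fun h => hy (.inr ⟨h, hyz⟩)
    have hud : u ∈ descendants par ht K z \ {z} := by
      refine hu.resolve_left fun h => hyd (hNz ⟨hyK, u, h, huy⟩)
    have hzu := ht_lt_of_mem_descendants hud.1 hud.2
    have huK := hud.1.1
    have huB : u ∉ B := fun h => by have := hF.ht_root u h; omega
    obtain ⟨par', ht', hF', hout, hin⟩ := hF.exists_reparent huK huB hyK
      (fun h => hyd (hF.descendants_trans hud.1 h)) huy
    have hzd : z ∉ descendants par ht K u := fun h => by have := h.2.1; omega
    have hz' := (hout z hz hzd).1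
    by_cases hall : N ⊆ descendants par ht K u
    · have := hmax u huK hall
      omega
    obtain ⟨v₂, hv₂, hv₂u⟩ := Set.not_subset.1 hall
    have hv₂' := hout v₂ (hNK hv₂) hv₂u
    by_cases hnone : ∃ v ∈ N, v ∈ descendants par ht K u
    · obtain ⟨v₁, hv₁, hv₁u⟩ := hnone
      have hv₁' := hin v₁ hv₁u
      obtain ⟨z', hz'K, hNz', hmax'⟩ := hF'.exists_maximal_common_ancestor hNK hN (hroot _ _ hF')
      refine iht (ht' z') ?_ _ par' ht' hF' z' hz'K hNz' hmax' rfl rfl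
      by_contra! hle
      obtain ⟨-, h1, h2⟩ := hNz' hv₁
      obtain ⟨-, h3, h4⟩ := hNz' hv₂
      rw [hv₂'.2 _ (by omega)] at h4
      rcases le_or_gt (ht' z') (ht y) with h | h
      · rw [hv₁'.2.1 _ h] at h2
        refine hyd ⟨hyK, by omega, ?_⟩
        rw [hF.anc_congr hyK (hNK hv₂) (show ht z ≤ ht' z' by omega) h (by omega)
          (h2.trans h4.symm)]
        exact (hNz hv₂).2.2
      · have h5 := hv₁'.2.2 _ h h1
        rw [h2] at h5
        refine hv₂u (hF.descendants_trans h5 ⟨hNK hv₂, ?_, ?_⟩)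
        all_goals
          have := (hF.anc_mem (hNK hv₂) (show ht' z' ≤ ht v₂ by omega)).2
          rw [h4] at this
          rw [this]
        · omega
        · exact h4
    · push Not at hnone
      have heq : ∀ v ∈ N, ht' v = ht v ∧ ∀ t ≤ ht v,
          forestAnc par' ht' v t = forestAnc par ht v t := fun v hv => hout v (hNK hv) (hnone v hv)
      refine ihs _ ?_ par' ht' hF' z hz ?_ ?_ (by omega) rfl
      · rw [← hs]
        refine Set.ncard_lt_ncard ⟨?_, fun h => ?_⟩ (Set.toFinite _)
        · rintro v ⟨hv, h1, h2⟩
          rw [hz'] at h1 h2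
          by_cases hvu : v ∈ descendants par ht K u
          · exact hF.descendants_trans hud.1 hvu
          · obtain ⟨h3, h4⟩ := hout v hv hvu
            exact ⟨hv, by omega, by rwa [h4 _ (by omega)] at h2⟩
        · obtain ⟨-, h1, h2⟩ := h hud.1
          have h3 := hin u (self_mem_descendants huK)
          rw [hz'] at h1 h2
          rcases le_or_gt (ht z) (ht y) with h | h
          · rw [h3.2.1 _ h] at h2
            exact hyd ⟨hyK, h, h2⟩
          · have := h3.2.2 _ h h1
            rw [h2] at this
            exact hzd this
      · intro v hv
        obtain ⟨h1, h2⟩ := heq v hv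
        obtain ⟨h3, h4, h5⟩ := hNz hv
        exact ⟨h3, by omega, by rw [hz', h2 _ h4, h5]⟩
      · intro z' hz'K hNz'
        rw [hz']
        have h0 : ht z' = ht' z' := by
          obtain ⟨-, h4, h5⟩ := hNz' hv₂
          rw [hv₂'.2 _ (by omega)] at h5
          have := (hF.anc_mem (hNK hv₂) (show ht' z' ≤ ht v₂ by omega)).2
          rwa [h5] at this
        rw [← h0]
        refine hmax z' hz'K fun v hv => ?_
        obtain ⟨h1, h2⟩ := heq v hv
        obtain ⟨h3, h4, h5⟩ := hNz' hv
        rw [← h0, h1] at h4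
        rw [← h0, h2 _ h4] at h5
        exact ⟨h3, h4, h5⟩
  obtain ⟨par, ht, hF⟩ := hK.exists_isForest hBK hB.nonempty
  obtain ⟨z, h1, h2, h3⟩ := hF.exists_maximal_common_ancestor hNK hN (hroot _ _ hF)
  exact key _ _ par ht hF z h1 h2 h3 rfl rfl

end SimpleGraph

/-! ### Arithmetic of the attachments of a cycle to a disjoint cycle -/

/-- The integer `z` is even or one of the two admissible lengths `k` and `k + 2 * l`. -/
def IsAdm (k l z : ℤ) : Prop := z % 2 = 1 → z = k ∨ z = k + 2 * l

/-- The relation between the distances `x` and `y` of the end vertices of two disjoint paths along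
two cycles of length `k`, and the total length `p` of the two paths, that is forced by the
admissibility of the four cycles formed by the two paths and an arc of each of the cycles. -/
def CrossRel (k l x y p : ℤ) : Prop :=
  (p = 2 * l ∧ (y = x ∨ y = k - x)) ∨
    (p = l ∧ (y = x + l ∨ y = x - l ∨ y = k - x - l ∨ y = k - x + l))

/-- The relation between the distance `x` of two vertices of a cycle of length `k`, and the lengths
`h` and `h'` of two paths that start there and meet, that is forced by the admissibility of the two
cycles so formed. Here `p` is the length of the path that the two paths contain. -/
def MeetRel (k l x h h' : ℤ) : Prop :=
  ∃ p, (p = x ∨ p = k - x ∨ p = x + 2 * l ∨ p = k - x + 2 * l) ∧ (h + h' - p) % 2 = 0 ∧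
    p ≤ h + h' ∧ h - h' + 2 ≤ p ∧ h' - h + 2 ≤ p

/-- Among the four sums of an arc length of either cycle and `p`, exactly two complementary ones are
odd. -/
lemma crossRel_of_isAdm {k l n m x y p : ℤ} (hk : k % 2 = 1) (hl : 1 ≤ l)
    (hn : n = k ∨ n = k + 2 * l) (hm : m = k ∨ m = k + 2 * l) (hp : 1 ≤ p)
    (h1 : IsAdm k l (p + x + y)) (h2 : IsAdm k l (p + (n - x) + y))
    (h3 : IsAdm k l (p + x + (m - y))) (h4 : IsAdm k l (p + (n - x) + (m - y))) :
    (n = k ∧ m = k ∧ CrossRel k l x y p) ∨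
      (n = k ∧ m = k + 2 * l ∧ p = l ∧ (y = x + l ∨ m - y = x + l)) ∨
      (n = k + 2 * l ∧ m = k ∧ p = l ∧ (x = y + l ∨ n - x = y + l)) := by
  unfold CrossRel
  by_cases h : (p + x + y) % 2 = 1
  · have h1 := h1 h
    have h4 := h4 (by omega)
    clear h2 h3
    rcases hn with rfl | rfl <;> rcases hm with rfl | rfl <;> rcases h1 with h1 | h1 <;>
      rcases h4 with h4 | h4 <;> omega
  · have h2 := h2 (by omega)
    have h3 := h3 (by omega)
    clear h1 h4
    rcases hn with rfl | rfl <;> rcases hm with rfl | rfl <;> rcases h2 with h2 | h2 <;>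
      rcases h3 with h3 | h3 <;> omega

lemma meetRel_of_isAdm {k l x h h' t : ℤ} (hk : k % 2 = 1) (ht0 : 0 ≤ t) (ht : t < h) (ht' : t < h')
    (h1 : IsAdm k l (h + h' - 2 * t + x)) (h2 : IsAdm k l (h + h' - 2 * t + (k - x))) :
    MeetRel k l x h h' := by
  refine ⟨h + h' - 2 * t, ?_, by omega⟩
  by_cases hx : (h + h' - 2 * t + x) % 2 = 1
  · have := h1 hx
    omega
  · have := h2 (by omega)
    omega

lemma CrossRel.of_abs {k l x s p : ℤ} (hl : 1 ≤ l) (hx : 0 < x) (hxk : x < k)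
    (h : CrossRel k l x |s| p) :
    (p = 2 * l ∧ (s = x ∨ s = -x ∨ s = k - x ∨ s = x - k)) ∨
      (p = l ∧ (s = x + l ∨ s = -x - l ∨ (s = x - l ∧ 0 ≤ x - l) ∨ (s = l - x ∧ 0 ≤ x - l) ∨
        (s = k - x - l ∧ 0 ≤ k - x - l) ∨ (s = l + x - k ∧ 0 ≤ k - x - l) ∨ s = k - x + l ∨
        s = x - l - k)) := by
  unfold CrossRel at h
  rcases abs_cases s with ⟨e, e'⟩ | ⟨e, e'⟩ <;> rw [e] at h <;> rcases h with ⟨a, h⟩ | ⟨a, h⟩ <;>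
    [left; right; left; right] <;> refine ⟨a, ?_⟩ <;> clear a e <;> omega

/-- The possibilities at three consecutive vertices of a cycle whose attachments lie in trees
rooted at vertices of the other cycle at consecutive nonzero distances `s₀` and `s₁`. -/
lemma three_consecutive {k l h₀ h₁ h₂ s₀ s₁ : ℤ} (hk : 5 ≤ k) (hko : k % 2 = 1) (hl : 1 ≤ l)
    (h0p : 1 ≤ h₀) (h1p : 1 ≤ h₁) (h2p : 1 ≤ h₂) (s0p : 0 < s₀) (s0k : 2 * s₀ < k) (s10 : s₁ ≠ 0)
    (s1k : 2 * s₁ < k) (s1k' : -k < 2 * s₁)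
    (p01 : CrossRel k l 1 |s₀| (h₀ + h₁)) (p12 : CrossRel k l 1 |s₁| (h₁ + h₂))
    (p02 : s₀ + s₁ ≠ 0 → CrossRel k l 2 |s₀ + s₁| (h₀ + h₂))
    (p02' : s₀ + s₁ = 0 → MeetRel k l 2 h₀ h₂) :
    (s₁ = -s₀ ∧ h₂ = h₀) ∨ (s₀ = 1 ∧ s₁ = 1 ∧ h₀ = l ∧ h₁ = l ∧ h₂ = l) ∨
      (2 * k = 3 * l + 4 ∧ s₀ = k - 1 - l ∧ s₁ = s₀ ∧ 2 * h₀ = l ∧ 2 * h₁ = l ∧ 2 * h₂ = l) ∨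
      (l = 2 ∧ s₀ = 1 ∧ s₁ = -3 ∧ h₀ = 3 ∧ h₁ = 1 ∧ h₂ = 1) ∨
      (l = 2 ∧ s₀ = 3 ∧ s₁ = -1 ∧ h₀ = 1 ∧ h₁ = 1 ∧ h₂ = 3) ∨
      (k = 5 ∧ l = 2 ∧ s₀ = 1 ∧ s₁ = 2 ∧ h₀ = 3 ∧ h₁ = 1 ∧ h₂ = 1) ∨
      (k = 5 ∧ l = 2 ∧ s₀ = 2 ∧ s₁ = 1 ∧ h₀ = 1 ∧ h₁ = 1 ∧ h₂ = 3) := by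
  have a1 : (s₀ = 1 ∧ h₀ + h₁ = 2 * l) ∨ (s₀ = l + 1 ∧ h₀ + h₁ = l) ∨
      (s₀ = k - 1 - l ∧ h₀ + h₁ = l) := by
    rw [abs_of_pos s0p] at p01
    unfold CrossRel at p01
    omega
  have a2 : (s₁ = 1 ∧ h₁ + h₂ = 2 * l) ∨ (s₁ = l + 1 ∧ h₁ + h₂ = l) ∨
      (s₁ = k - 1 - l ∧ h₁ + h₂ = l ∧ 0 < s₁) ∨ (s₁ = -1 ∧ h₁ + h₂ = 2 * l) ∨
      (s₁ = -(l + 1) ∧ h₁ + h₂ = l) ∨ (s₁ = -(k - 1 - l) ∧ h₁ + h₂ = l ∧ s₁ < 0) := by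
    have := p12.of_abs hl (by omega) (by omega)
    clear * - this s1k s1k' hl s10
    rcases this with ⟨a, b | b | b | b⟩ | ⟨a, b | b | b | b | b | b | b | b⟩ <;> omega
  clear p01 p12
  by_cases h : s₀ + s₁ = 0
  · left
    refine ⟨by omega, ?_⟩
    obtain ⟨p, hp, hp'⟩ := p02' h
    clear p02 p02'
    rcases a1 with a1 | a1 | a1 <;> rcases a2 with a2 | a2 | a2 | a2 | a2 | a2 <;>
      rcases hp with hp | hp | hp | hp <;> omega
  · replace p02 := (p02 h).of_abs hl (by omega) (by omega)
    clear p02'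
    right
    rcases a1 with a1 | a1 | a1 <;> rcases a2 with a2 | a2 | a2 | a2 | a2 | a2 <;>
      (rcases p02 with ⟨c, b | b | b | b⟩ | ⟨c, b | b | b | b | b | b | b | b⟩ <;>
        try (exfalso; omega))
    · exact .inl (by omega)
    · exact .inr (.inr (.inr (.inr (.inl (by omega)))))
    · exact .inr (.inr (.inl (by omega)))
    · exact .inr (.inr (.inr (.inl (by omega))))
    · exact .inr (.inr (.inr (.inr (.inr (by omega)))))
    · exact .inr (.inl (by omega))

lemma exists_symmetric_residue {k : ℤ} (hk : k % 2 = 1) (hk' : 0 < k) (x : ℤ) :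
    ∃ s, k ∣ s - x ∧ 2 * s < k ∧ -k < 2 * s := by
  have h1 := Int.emod_nonneg (x + k / 2) hk'.ne'
  have h2 := Int.emod_lt_of_pos (x + k / 2) hk'
  refine ⟨(x + k / 2) % k - k / 2, ?_, by omega, by omega⟩
  rw [show (x + k / 2) % k - k / 2 - x = -((x + k / 2) - (x + k / 2) % k) by ring, dvd_neg]
  exact Int.dvd_self_sub_emod

/-- The arithmetic data of two disjoint cycles of lengths `n` and `m`, where the `i`-th vertex of
the first is joined by a path of length `h i` to the vertex `β i` of the second, such that two of
these paths are disjoint if they end at different vertices, and otherwise either are disjoint or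
merge and stay together from some point on. The three last fields express that the cycles using one
or two pairs of these paths have admissible lengths. -/
structure IsDisjointConfig (k l n m : ℤ) (β h : ℤ → ℤ) : Prop where
  odd : k % 2 = 1
  five_le : 5 ≤ k
  one_le : 1 ≤ l
  left_eq : n = k ∨ n = k + 2 * l
  right_eq : m = k ∨ m = k + 2 * l
  pos : ∀ i, 1 ≤ h i
  cross : ∀ i j y, i < j → j < i + n → m ∣ y - (β j - β i) → 0 < y → y < m →
    IsAdm k l (h i + h j + (j - i) + y) ∧ IsAdm k l (h i + h j + (n - (j - i)) + y) ∧
      IsAdm k l (h i + h j + (j - i) + (m - y)) ∧ IsAdm k l (h i + h j + (n - (j - i)) + (m - y))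
  meet : ∀ i j, i < j → j < i + n → m ∣ β j - β i → ∃ t, 0 ≤ t ∧ t < h i ∧ t < h j ∧
    IsAdm k l (h i + h j - 2 * t + (j - i)) ∧ IsAdm k l (h i + h j - 2 * t + (n - (j - i)))
  two : ∀ i j p q u v w x, i < j → j < p → p < q → q < i + n → m ∣ u - β i → m ∣ v - β j →
    m ∣ w - β p → m ∣ x - β q → u ≠ v → w ≠ x → max u v < min w x → max w x < min u v + m →
    IsAdm k l ((h i + h j + |v - u|) + (h p + h q + |x - w|) + n - (j - i) - (q - p))

namespace IsDisjointConfig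

variable {k l n m : ℤ} {β h : ℤ → ℤ}

lemma shift (H : IsDisjointConfig k l n m β h) (a : ℤ) :
    IsDisjointConfig k l n m (fun i => β (i + a)) (fun i => h (i + a)) where
  odd := H.odd
  five_le := H.five_le
  one_le := H.one_le
  left_eq := H.left_eq
  right_eq := H.right_eq
  pos i := H.pos _
  cross i j y h1 h2 h3 h4 h5 := by
    simpa using H.cross (i + a) (j + a) y (by omega) (by omega) h3 h4 h5
  meet i j h1 h2 h3 := by simpa using H.meet (i + a) (j + a) (by omega) (by omega) h3
  two i j p q u v w x h1 h2 h3 h4 := by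
    simpa using H.two (i + a) (j + a) (p + a) (q + a) u v w x (by omega) (by omega) (by omega)
      (by omega)

lemma neg (H : IsDisjointConfig k l n m β h) : IsDisjointConfig k l n m (fun i => -β i) h where
  odd := H.odd
  five_le := H.five_le
  one_le := H.one_le
  left_eq := H.left_eq
  right_eq := H.right_eq
  pos := H.pos
  cross i j y h1 h2 h3 h4 h5 := by
    have := H.cross i j (m - y) h1 h2 (by
      rw [show m - y - (β j - β i) = m - (y - (-β j - -β i)) by ring]
      exact dvd_sub_self_left.2 h3) (by omega) (by omega)
    rw [sub_sub_cancel] at this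
    exact ⟨this.2.2.1, this.2.2.2, this.1, this.2.1⟩
  meet i j h1 h2 h3 := H.meet i j h1 h2 (by
    rw [← dvd_neg]; simpa [neg_add_eq_sub] using h3)
  two i j p q u v w x h1 h2 h3 h4 hu hv hw hx huv hwx h5 h6 := by
    have e : ∀ {a b : ℤ}, m ∣ a - -b → m ∣ -a - b := fun {a b} hab => by
      rw [← dvd_neg]; rwa [show -(-a - b) = a - -b by ring]
    have e' : ∀ {a b : ℤ}, m ∣ a - -b → m ∣ (m - a) - b := fun {a b} hab => by
      rw [show m - a - b = m - (a - -b) by ring]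
      exact dvd_sub_self_left.2 hab
    have := H.two i j p q (-u) (-v) (m - w) (m - x) h1 h2 h3 h4 (e hu) (e hv) (e' hw) (e' hx)
      (by omega) (by omega) (by omega) (by omega)
    rwa [show -v - -u = -(v - u) by ring, show m - x - (m - w) = -(x - w) by ring, abs_neg,
      abs_neg] at this

lemma crossRel (H : IsDisjointConfig k l k k β h) {i j s : ℤ} (hij : i < j) (hj : j < i + k)
    (hs : k ∣ s - (β j - β i)) (hs0 : s ≠ 0) (hsk : s < k) (hsk' : -k < s) :
    CrossRel k l (j - i) |s| (h i + h j) := by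
  have h1 := H.pos i
  have h2 := H.pos j
  have h3 := H.one_le
  rcases hs0.lt_or_gt with hs0 | hs0
  · obtain ⟨q1, q2, q3, q4⟩ := H.cross i j (k + s) hij hj (by
      rw [show k + s - (β j - β i) = k + (s - (β j - β i)) by ring]
      exact dvd_add_self_left.2 hs) (by omega) (by omega)
    rw [show k - (k + s) = -s by ring] at q3 q4
    rw [abs_of_neg hs0]
    obtain h | h | h := crossRel_of_isAdm (y := -s) H.odd H.one_le H.left_eq H.right_eq (by omega)
      q3 q4 (by rwa [sub_neg_eq_add]) (by rwa [sub_neg_eq_add])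
    · exact h.2.2
    all_goals omega
  · obtain ⟨q1, q2, q3, q4⟩ := H.cross i j s hij hj hs (by omega) (by omega)
    rw [abs_of_pos hs0]
    obtain h | h | h :=
      crossRel_of_isAdm H.odd H.one_le H.left_eq H.right_eq (by omega) q1 q2 q3 q4
    · exact h.2.2
    all_goals omega

lemma meetRel (H : IsDisjointConfig k l k k β h) {i j : ℤ} (hij : i < j) (hj : j < i + k)
    (hs : k ∣ β j - β i) : MeetRel k l (j - i) (h i) (h j) := by
  obtain ⟨t, ht0, ht, ht', q1, q2⟩ := H.meet i j hij hj hs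
  exact meetRel_of_isAdm H.odd ht0 ht ht' q1 q2

end IsDisjointConfig

namespace IsDisjointConfig

variable {k l n m : ℤ} {β h : ℤ → ℤ}

/-- If the vertex `0` is attached to one tree and the vertices `1` and `2` to another, then the
lengths are as follows. -/
lemma of_dvd_one_two (H : IsDisjointConfig k l k k β h) {s : ℤ} (hs : k ∣ s - (β 1 - β 0))
    (h12 : k ∣ β 2 - β 1) (s0 : 0 < s) (sk : 2 * s < k) :
    l = k - 3 ∧ ((s = 1 ∧ h 0 + h 1 = 2 * l ∧ h 0 + h 2 = l) ∨
      (s = 2 ∧ h 0 + h 1 = l ∧ h 0 + h 2 = 2 * l)) := by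
  have hk := H.five_le
  have hko := H.odd
  have hl := H.one_le
  have p0 := H.pos 0
  have p1 := H.pos 1
  have p2 := H.pos 2
  have p01 := H.crossRel (i := 0) (j := 1) (by omega) (by omega) hs (by omega) (by omega) (by omega)
  have p02 := H.crossRel (i := 0) (j := 2) (s := s) (by omega) (by omega) (by
    have := dvd_sub hs h12
    rwa [show s - (β 1 - β 0) - (β 2 - β 1) = s - (β 2 - β 0) by ring] at this)
    (by omega) (by omega) (by omega)
  obtain ⟨p, hp, hp'⟩ := H.meetRel (i := 1) (j := 2) (by omega) (by omega) h12
  rw [abs_of_pos s0] at p01 p02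
  unfold CrossRel at p01 p02
  rcases p01 with ⟨a, b | b⟩ | ⟨a, b | b | b | b⟩ <;>
    rcases p02 with ⟨c, d | d⟩ | ⟨c, d | d | d | d⟩ <;> try (exfalso; omega)
  all_goals rcases hp with hp | hp | hp | hp <;> omega

lemma false_of_dvd_one_two_of_pos (H : IsDisjointConfig k l k k β h) {s : ℤ}
    (hs : k ∣ s - (β 1 - β 0)) (h12 : k ∣ β 2 - β 1) (s0 : 0 < s) (sk : 2 * s < k) : False := by
  have hk := H.five_le
  have hko := H.odd
  have hl := H.one_le
  obtain ⟨rfl, hc⟩ := H.of_dvd_one_two hs h12 s0 sk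
  have p0 := H.pos 0
  have p1 := H.pos 1
  have p2 := H.pos 2
  have p3 := H.pos 3
  have hs2 : k ∣ s - (β 2 - β 0) := by
    have := dvd_sub hs h12
    rwa [show s - (β 1 - β 0) - (β 2 - β 1) = s - (β 2 - β 0) by ring] at this
  by_cases h23 : k ∣ β 3 - β 2
  · have p03 := H.crossRel (i := 0) (j := 3) (s := s) (by omega) (by omega) (by
      have := dvd_sub hs2 h23
      rwa [show s - (β 2 - β 0) - (β 3 - β 2) = s - (β 3 - β 0) by ring] at this)
      (by omega) (by omega) (by omega)
    obtain ⟨p, hp, hp'⟩ := H.meetRel (i := 1) (j := 3) (by omega) (by omega) (by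
      have := dvd_add h12 h23
      rwa [show β 2 - β 1 + (β 3 - β 2) = β 3 - β 1 by ring] at this)
    rw [abs_of_pos s0] at p03
    unfold CrossRel at p03
    rcases hc with hc | hc <;> rcases p03 with ⟨a, b | b⟩ | ⟨a, b | b | b | b⟩ <;>
      rcases hp with hp | hp | hp | hp <;> omega
  obtain ⟨s', hs', s'k, s'k'⟩ := exists_symmetric_residue hko (by omega) (β 3 - β 2)
  have s'0 : s' ≠ 0 := by
    rintro rfl
    rw [zero_sub, dvd_neg] at hs'
    exact h23 hs'
  have p23 := (H.crossRel (i := 2) (j := 3) (by omega) (by omega) hs' s'0 (by omega)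
    (by omega)).of_abs hl (by omega) (by omega)
  have p13 := (H.crossRel (i := 1) (j := 3) (s := s') (by omega) (by omega) (by
    have := dvd_sub hs' h12
    rwa [show s' - (β 3 - β 2) - (β 2 - β 1) = s' - (β 3 - β 1) by ring] at this) s'0 (by omega)
    (by omega)).of_abs hl (by omega) (by omega)
  have hc' : ((s' = 1 ∨ s' = -1) ∧ h 2 + h 3 = 2 * (k - 3) ∧ h 1 + h 3 = k - 3) ∨
      ((s' = 2 ∨ s' = -2) ∧ h 2 + h 3 = k - 3 ∧ h 1 + h 3 = 2 * (k - 3)) := by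
    clear hc
    rcases p23 with ⟨a, b | b | b | b⟩ | ⟨a, b | b | b | b | b | b | b | b⟩ <;>
      rcases p13 with ⟨c, d | d | d | d⟩ | ⟨c, d | d | d | d | d | d | d | d⟩ <;>
      first | (exfalso; omega) | (left; omega) | (right; omega)
  clear p23 p13
  have hs3 : k ∣ s + s' - (β 3 - β 0) := by
    have := dvd_add hs2 hs'
    rwa [show s - (β 2 - β 0) + (s' - (β 3 - β 2)) = s + s' - (β 3 - β 0) by ring] at this
  have hc3 : k = 5 ∧ ((s = 1 ∧ s' = -2 ∧ h 0 = 1 ∧ h 1 = 3 ∧ h 2 = 1 ∧ h 3 = 1) ∨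
      (s = 2 ∧ s' = -1 ∧ h 0 = 1 ∧ h 1 = 1 ∧ h 2 = 3 ∧ h 3 = 1)) := by
    have hne : s + s' ≠ 0 := by omega
    have p03 := (H.crossRel (i := 0) (j := 3) (by omega) (by omega) hs3 hne (by omega)
      (by omega)).of_abs hl (by omega) (by omega)
    rcases hc with hc | hc <;> rcases hc' with ⟨hc' | hc', hc''⟩ | ⟨hc' | hc', hc''⟩ <;>
      rcases p03 with ⟨c, d | d | d | d⟩ | ⟨c, d | d | d | d | d | d | d | d⟩ <;>
      omega
  clear hc hc'
  obtain ⟨rfl, hc⟩ := hc3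
  obtain ⟨y, hy, yk, yk'⟩ := exists_symmetric_residue hko (by omega) (β 4 - β 0)
  have p4 := H.pos 4
  have key : ∀ (i b : ℤ), 0 ≤ i → i < 4 → 5 ∣ b - (β i - β 0) → y - b ≠ 0 → y - b < 5 →
      -5 < y - b → CrossRel 5 (5 - 3) (4 - i) |y - b| (h i + h 4) := fun i b h1 h2 h3 h4 h5 h6 =>
    H.crossRel h2 (by omega) (by
      have := dvd_sub hy h3
      rwa [show y - (β 4 - β 0) - (b - (β i - β 0)) = y - b - (β 4 - β i) by ring] at this) h4 h5 h6
  have k0 := key 0 0 (by omega) (by omega) (by simp)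
  have k1 := key 1 s (by omega) (by omega) hs
  have k2 := key 2 s (by omega) (by omega) hs2
  have k3 := key 3 _ (by omega) (by omega) hs3
  have k3' : y = s + s' → MeetRel 5 (5 - 3) (4 - 3) (h 3) (h 4) := fun h => by
    refine H.meetRel (by omega) (by omega) ?_
    have := dvd_sub hy hs3
    rw [h] at this
    rw [← dvd_neg]
    rwa [show s + s' - (β 4 - β 0) - (s + s' - (β 3 - β 0)) = -(β 4 - β 3) by ring] at this
  have k2' : y = s → MeetRel 5 (5 - 3) (4 - 2) (h 2) (h 4) := fun h => by
    refine H.meetRel (by omega) (by omega) ?_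
    have := dvd_sub hy hs2
    rw [h] at this
    rw [← dvd_neg]
    rwa [show s - (β 4 - β 0) - (s - (β 2 - β 0)) = -(β 4 - β 2) by ring] at this
  unfold CrossRel at k0 k1 k2 k3
  unfold MeetRel at k3' k2'
  clear hs hs2 hs3 hy key hs' h12 h23 hko sk s'k s'k' s0 s'0
  obtain rfl | rfl | rfl | rfl | rfl : y = -2 ∨ y = -1 ∨ y = 0 ∨ y = 1 ∨ y = 2 := by omega
  all_goals
    rcases hc with ⟨rfl, rfl, e0, e1, e2, e3⟩ | ⟨rfl, rfl, e0, e1, e2, e3⟩ <;>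
    rw [e0] at k0 <;> rw [e1] at k1 <;> rw [e2] at k2 k2' <;> rw [e3] at k3 k3' <;>
    norm_num at k0 k1 k2 k3 k2' k3' <;> omega

lemma not_dvd_two_one (H : IsDisjointConfig k l k k β h) (h01 : ¬ k ∣ β 1 - β 0) :
    ¬ k ∣ β 2 - β 1 := by
  intro h12
  obtain ⟨s, hs, sk, sk'⟩ := exists_symmetric_residue H.odd (by have := H.five_le; omega) (β 1 - β 0)
  rcases lt_trichotomy s 0 with s0 | rfl | s0
  · refine H.neg.false_of_dvd_one_two_of_pos (s := -s) ?_ ?_ (by omega) (by omega)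
    · rw [← dvd_neg]
      rwa [show -(-s - (-β 1 - -β 0)) = s - (β 1 - β 0) by ring]
    · rw [← dvd_neg]
      rwa [show -(-β 2 - -β 1) = β 2 - β 1 by ring]
  · rw [zero_sub, dvd_neg] at hs
    exact h01 hs
  · exact H.false_of_dvd_one_two_of_pos hs h12 s0 sk

lemma three_consecutive (H : IsDisjointConfig k l k k β h) {s₀ s₁ : ℤ}
    (hs₀ : k ∣ s₀ - (β 1 - β 0)) (hs₁ : k ∣ s₁ - (β 2 - β 1)) (s0p : 0 < s₀) (s0k : 2 * s₀ < k)
    (s10 : s₁ ≠ 0) (s1k : 2 * s₁ < k) (s1k' : -k < 2 * s₁) :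
    (s₁ = -s₀ ∧ h 2 = h 0) ∨ (s₀ = 1 ∧ s₁ = 1 ∧ h 0 = l ∧ h 1 = l ∧ h 2 = l) ∨
      (2 * k = 3 * l + 4 ∧ s₀ = k - 1 - l ∧ s₁ = s₀ ∧ 2 * h 0 = l ∧ 2 * h 1 = l ∧ 2 * h 2 = l) ∨
      (l = 2 ∧ s₀ = 1 ∧ s₁ = -3 ∧ h 0 = 3 ∧ h 1 = 1 ∧ h 2 = 1) ∨
      (l = 2 ∧ s₀ = 3 ∧ s₁ = -1 ∧ h 0 = 1 ∧ h 1 = 1 ∧ h 2 = 3) ∨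
      (k = 5 ∧ l = 2 ∧ s₀ = 1 ∧ s₁ = 2 ∧ h 0 = 3 ∧ h 1 = 1 ∧ h 2 = 1) ∨
      (k = 5 ∧ l = 2 ∧ s₀ = 2 ∧ s₁ = 1 ∧ h 0 = 1 ∧ h 1 = 1 ∧ h 2 = 3) := by
  have hk := H.five_le
  have hs : k ∣ s₀ + s₁ - (β 2 - β 0) := by
    have := dvd_add hs₀ hs₁
    rwa [show s₀ - (β 1 - β 0) + (s₁ - (β 2 - β 1)) = s₀ + s₁ - (β 2 - β 0) by ring] at this
  refine _root_.three_consecutive hk H.odd H.one_le (H.pos 0) (H.pos 1) (H.pos 2) s0p s0k s10 s1k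
    s1k' (H.crossRel (i := 0) (j := 1) (by omega) (by omega) hs₀ (by omega) (by omega) (by omega))
    (H.crossRel (i := 1) (j := 2) (by omega) (by omega) hs₁ s10 (by omega) (by omega))
    (fun h => H.crossRel (i := 0) (j := 2) (by omega) (by omega) hs h (by omega) (by omega))
    (fun h => H.meetRel (i := 0) (j := 2) (by omega) (by omega) ?_)
  rwa [h, zero_sub, dvd_neg] at hs

end IsDisjointConfig
namespace IsDisjointConfig

variable {k l n m : ℤ} {β h : ℤ → ℤ}

lemma four_consecutive_of_pos (H : IsDisjointConfig k l k k β h) {s₀ s₁ s₂ : ℤ}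
    (hs₀ : k ∣ s₀ - (β 1 - β 0)) (hs₁ : k ∣ s₁ - (β 2 - β 1)) (hs₂ : k ∣ s₂ - (β 3 - β 2))
    (s0p : 0 < s₀) (s0k : 2 * s₀ < k) (s10 : s₁ ≠ 0) (s1k : 2 * s₁ < k) (s1k' : -k < 2 * s₁)
    (s20 : s₂ ≠ 0) (s2k : 2 * s₂ < k) (s2k' : -k < 2 * s₂) :
    k = 5 ∧ l = 2 ∧ s₀ = 2 ∧ s₁ = 2 ∧ h 0 = 1 ∧ h 1 = 1 := by
  have hk := H.five_le
  have hko := H.odd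
  have hl := H.one_le
  have p0 := H.pos 0
  have p1 := H.pos 1
  have p2 := H.pos 2
  have p3 := H.pos 3
  have t0 := H.three_consecutive hs₀ hs₁ s0p s0k s10 s1k s1k'
  have t1 : (0 < s₁ → _) ∧ (s₁ < 0 → _) :=
    ⟨fun h => (H.shift 1).three_consecutive (s₀ := s₁) (s₁ := s₂) hs₁ hs₂ h s1k s20 s2k s2k',
      fun h => (H.shift 1).neg.three_consecutive (s₀ := -s₁) (s₁ := -s₂)
        (by
          rw [← dvd_neg]
          show k ∣ -(-s₁ - (-β 2 - -β 1))
          rwa [show -(-s₁ - (-β 2 - -β 1)) = s₁ - (β 2 - β 1) by ring])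
        (by
          rw [← dvd_neg]
          show k ∣ -(-s₂ - (-β 3 - -β 2))
          rwa [show -(-s₂ - (-β 3 - -β 2)) = s₂ - (β 3 - β 2) by ring])
        (by omega) (by omega) (by omega) (by omega) (by omega)⟩
  norm_num at t1
  obtain ⟨t1, t1'⟩ := t1
  have p01 := (H.crossRel (i := 0) (j := 1) (by omega) (by omega) hs₀ s0p.ne' (by omega)
    (by omega)).of_abs hl (by omega) (by omega)
  replace p01 : (s₀ = 1 ∧ h 0 + h 1 = 2 * l) ∨ (s₀ = l + 1 ∧ h 0 + h 1 = l) ∨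
      (s₀ = k - 1 - l ∧ h 0 + h 1 = l) := by
    clear t0 t1 t1'
    rcases p01 with ⟨a, b | b | b | b⟩ | ⟨a, b | b | b | b | b | b | b | b⟩ <;> omega
  obtain ⟨y, hy, yk, yk'⟩ := exists_symmetric_residue hko (by omega) (β 3 - β 0)
  have hyσ : k ∣ y - (s₀ + s₁ + s₂) := by
    have := dvd_sub hy (dvd_add (dvd_add hs₀ hs₁) hs₂)
    rwa [show y - (β 3 - β 0) - (s₀ - (β 1 - β 0) + (s₁ - (β 2 - β 1)) + (s₂ - (β 3 - β 2))) =
      y - (s₀ + s₁ + s₂) by ring] at this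
  have hy3 : y = s₀ + s₁ + s₂ ∨ y = s₀ + s₁ + s₂ - k ∨ y = s₀ + s₁ + s₂ + k := by
    obtain ⟨q, hq⟩ := hyσ
    have h1 : q < 2 := by nlinarith
    have h2 : -2 < q := by nlinarith
    obtain rfl | rfl | rfl : q = 0 ∨ q = 1 ∨ q = -1 := by omega
    all_goals omega
  have p03 : y ≠ 0 → _ := fun h => (H.crossRel (i := 0) (j := 3) (by omega) (by omega) hy h
    (by omega) (by omega)).of_abs hl (by omega) (by omega)
  have p03' : y = 0 → MeetRel k l (3 - 0) (h 0) (h 3) := fun h =>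
    H.meetRel (by omega) (by omega) (by rwa [h, zero_sub, dvd_neg] at hy)
  clear hyσ
  -- Three steps by one in the same direction leave room for a cycle through two pairs of paths.
  have hne : ¬ (s₀ = 1 ∧ s₁ = 1 ∧ s₂ = 1 ∧ h 0 = l ∧ h 1 = l ∧ h 2 = l ∧ h 3 = l) := by
    rintro ⟨rfl, rfl, rfl, e0, e1, e2, e3⟩
    have := H.two 0 1 2 3 (β 0) (β 0 + 1) (β 0 + 2) (β 0 + 3) (by omega) (by omega) (by omega)
      (by omega) (by simp) (by
        rwa [show β 0 + 1 - β 1 = 1 - (β 1 - β 0) by ring])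
      (by
        rw [show β 0 + 2 - β 2 = 1 - (β 1 - β 0) + (1 - (β 2 - β 1)) by ring]
        exact dvd_add hs₀ hs₁)
      (by
        rw [show β 0 + 3 - β 3 = 1 - (β 1 - β 0) + (1 - (β 2 - β 1)) + (1 - (β 3 - β 2)) by ring]
        exact dvd_add (dvd_add hs₀ hs₁) hs₂) (by omega) (by omega) (by omega)
      (by omega)
    rw [e0, e1, e2, e3, show β 0 + 1 - β 0 = 1 by ring,
      show β 0 + 3 - (β 0 + 2) = 1 by ring, abs_one] at this
    unfold IsAdm at this
    omega
  clear hy hs₀ hs₁ hs₂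
  rcases s10.lt_or_gt with s1 | s1
  · replace t1' := t1' s1
    clear t1
    rcases t0 with t0 | t0 | t0 | t0 | t0 | t0 | t0 <;> try (exfalso; clear * - t0 s1 s0p; omega)
    all_goals
      rcases t1' with t1' | t1' | t1' | t1' | t1' | t1' | t1' <;>
        try (exfalso; clear * - t0 t1' s1 s0p; omega)
    all_goals
      rcases hy3 with hy3 | hy3 | hy3 <;> try (exfalso; clear p03 p03' p01 hne; omega)
      all_goals
        by_cases hy0 : y = 0
        · obtain ⟨p, hp, hp'⟩ := p03' hy0
          clear p03 p03' hne
          rcases p01 with p01 | p01 | p01 <;> rcases hp with hp | hp | hp | hp <;> omega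
        · replace p03 := p03 hy0
          clear p03'
          rcases p01 with p01 | p01 | p01 <;>
            rcases p03 with ⟨c, b | b | b | b⟩ | ⟨c, b | b | b | b | b | b | b | b⟩ <;> omega
  · replace t1 := t1 s1
    clear t1'
    rcases t0 with t0 | t0 | t0 | t0 | t0 | t0 | t0 <;> try (exfalso; clear * - t0 s1 s0p; omega)
    all_goals
      rcases t1 with t1' | t1' | t1' | t1' | t1' | t1' | t1' <;>
        try (exfalso; clear * - t0 t1' s1 s0p; omega)
    all_goals
      rcases hy3 with hy3 | hy3 | hy3 <;> try (exfalso; clear p03 p03' p01 hne; omega)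
      all_goals
        by_cases hy0 : y = 0
        · obtain ⟨p, hp, hp'⟩ := p03' hy0
          clear p03 p03' hne
          rcases p01 with p01 | p01 | p01 <;> rcases hp with hp | hp | hp | hp <;> omega
        · replace p03 := p03 hy0
          clear p03'
          rcases p01 with p01 | p01 | p01 <;>
            rcases p03 with ⟨c, b | b | b | b⟩ | ⟨c, b | b | b | b | b | b | b | b⟩ <;> omega

lemma eq_of_not_dvd (H : IsDisjointConfig k l n m β h) (h01 : ¬ m ∣ β 1 - β 0) : n = k ∧ m = k := by
  have hk := H.five_le
  have hko := H.odd
  have hl := H.one_le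
  have p0 := H.pos 0
  have p1 := H.pos 1
  have p2 := H.pos 2
  have p3 := H.pos 3
  have hn : 5 ≤ n := by rcases H.left_eq with h | h <;> omega
  have hm0 : 0 < m := by rcases H.right_eq with h | h <;> omega
  have hm1 : m % 2 = 1 := by rcases H.right_eq with h | h <;> omega
  -- The relations forced by the four cycles through two paths with different ends.
  have key : ∀ i j s : ℤ, i < j → j < i + n → m ∣ s - (β j - β i) → s ≠ 0 → s < m → -m < s →
      (n = k ∧ m = k) ∨ (n = k ∧ m = k + 2 * l ∧ h i + h j = l ∧
        (s = j - i + l ∨ s = -(j - i + l) ∨ m - s = j - i + l ∨ m + s = j - i + l)) ∨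
      (n = k + 2 * l ∧ m = k ∧ (j - i = |s| + l ∨ n - (j - i) = |s| + l)) := by
    intro i j s hij hj hs hs0 hsm hsm'
    have p0 := H.pos i
    have p1 := H.pos j
    rcases hs0.lt_or_gt with hs0 | hs0
    · obtain ⟨q1, q2, q3, q4⟩ := H.cross i j (m + s) hij hj (by
        rw [show m + s - (β j - β i) = m + (s - (β j - β i)) by ring]
        exact dvd_add_self_left.2 hs) (by omega) (by omega)
      rw [show m - (m + s) = -s by ring] at q3 q4
      rw [abs_of_neg hs0]
      have := crossRel_of_isAdm (y := -s) hko hl H.left_eq H.right_eq (by omega)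
        q3 q4 (by rwa [sub_neg_eq_add]) (by rwa [sub_neg_eq_add])
      rcases this with h | h | h <;> omega
    · obtain ⟨q1, q2, q3, q4⟩ := H.cross i j s hij hj hs (by omega) (by omega)
      rw [abs_of_pos hs0]
      have := crossRel_of_isAdm hko hl H.left_eq H.right_eq (by omega) q1 q2 q3 q4
      rcases this with h | h | h <;> omega
  have hsum : ∀ {i j p s t : ℤ}, m ∣ s - (β j - β i) → m ∣ t - (β p - β j) →
      m ∣ s + t - (β p - β i) := fun {i j p s t} h1 h2 => by
    have := dvd_add h1 h2
    rwa [show s - (β j - β i) + (t - (β p - β j)) = s + t - (β p - β i) by ring] at this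
  obtain ⟨s, hs, sm, sm'⟩ := exists_symmetric_residue hm1 hm0 (β 1 - β 0)
  obtain ⟨t, ht, tm, tm'⟩ := exists_symmetric_residue hm1 hm0 (β 2 - β 1)
  obtain ⟨r, hr, rm, rm'⟩ := exists_symmetric_residue hm1 hm0 (β 3 - β 2)
  have s0 : s ≠ 0 := by
    rintro rfl
    rw [zero_sub, dvd_neg] at hs
    exact h01 hs
  -- If the lengths of the cycles are different, consecutive distances are opposite.
  have opp : ∀ i u v : ℤ, m ∣ u - (β (i + 1) - β i) → m ∣ v - (β (i + 2) - β (i + 1)) → u ≠ 0 →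
      2 * u < m → -m < 2 * u → 2 * v < m → -m < 2 * v → (n = k ∧ m = k) ∨
        (n = k ∧ m = k + 2 * l ∧ v = -u ∧ (u = 1 + l ∨ u = -(1 + l))) := by
    intro i u v hu hv hu0 um um' vm vm'
    rcases key i (i + 1) u (by omega) (by omega) hu hu0 (by omega) (by omega) with h | h | h
    · exact .inl h
    · right
      obtain ⟨rfl, rfl, e, h⟩ := h
      have q1 := H.pos i
      have hu' : u = 1 + l ∨ u = -(1 + l) := by omega
      have k2 := fun h => key i (i + 2) (u + v) (by omega) (by omega) (hsum hu hv) h (by omega)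
        (by omega)
      have k3 := fun h => key (i + 1) (i + 2) v (by omega) (by omega) hv h (by omega) (by omega)
      refine ⟨rfl, rfl, ?_, hu'⟩
      by_contra hne
      obtain k2 | k2 | k2 := k2 (by omega)
      · omega
      · by_cases v0 : v = 0
        · omega
        · obtain k3 | k3 | k3 := k3 v0 <;> omega
      · omega
    · have := abs_pos.2 hu0
      rcases abs_cases u with ⟨e, e'⟩ | ⟨e, e'⟩ <;> omega
  obtain h | ⟨rfl, rfl, rfl, hs'⟩ := opp 0 s t hs ht s0 sm sm' tm tm'
  · exact h
  obtain h | ⟨-, -, rfl, -⟩ := opp 1 (-s) r ht hr (by omega) tm tm' rm rm'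
  · exact h
  have := key 0 3 s (by omega) (by omega) (by
    have := hsum (hsum hs ht) hr
    rwa [add_neg_cancel, zero_add, neg_neg] at this) s0 (by omega) (by omega)
  rcases this with h | h | h <;> omega

end IsDisjointConfig
namespace IsDisjointConfig

variable {k l n m : ℤ} {β h : ℤ → ℤ}

lemma four_consecutive (H : IsDisjointConfig k l k k β h) (h01 : ¬ k ∣ β 1 - β 0) :
    k = 5 ∧ l = 2 ∧ h 0 = 1 ∧ h 1 = 1 ∧
      ∃ e, (e = 2 ∨ e = -2) ∧ k ∣ e - (β 1 - β 0) ∧ k ∣ e - (β 2 - β 1) := by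
  have h12 := H.not_dvd_two_one h01
  have h23 : ¬ k ∣ β 3 - β 2 := (H.shift 1).not_dvd_two_one h12
  have hk := H.five_le
  obtain ⟨s₀, hs₀, b₀, b₀'⟩ := exists_symmetric_residue H.odd (by omega) (β 1 - β 0)
  obtain ⟨s₁, hs₁, b₁, b₁'⟩ := exists_symmetric_residue H.odd (by omega) (β 2 - β 1)
  obtain ⟨s₂, hs₂, b₂, b₂'⟩ := exists_symmetric_residue H.odd (by omega) (β 3 - β 2)
  have hne : ∀ {s x : ℤ}, k ∣ s - x → ¬ k ∣ x → s ≠ 0 := by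
    rintro s x h1 h2 rfl
    rw [zero_sub, dvd_neg] at h1
    exact h2 h1
  have n₀ := hne hs₀ h01
  have n₁ := hne hs₁ h12
  have n₂ := hne hs₂ h23
  rcases n₀.lt_or_gt with n₀ | n₀
  · have e : ∀ {s x y : ℤ}, k ∣ s - (x - y) → k ∣ -s - (-x - -y) := fun {s x y} h => by
      rw [← dvd_neg]
      rwa [show -(-s - (-x - -y)) = s - (x - y) by ring]
    obtain ⟨hk5, hl2, r₀, r₁, e₀, e₁⟩ := H.neg.four_consecutive_of_pos (e hs₀) (e hs₁) (e hs₂)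
      (by omega) (by omega) (by omega) (by omega) (by omega) (by omega) (by omega) (by omega)
    obtain rfl : s₀ = -2 := by omega
    obtain rfl : s₁ = -2 := by omega
    exact ⟨hk5, hl2, e₀, e₁, -2, .inr rfl, hs₀, hs₁⟩
  · obtain ⟨hk5, hl2, rfl, rfl, e₀, e₁⟩ := H.four_consecutive_of_pos hs₀ hs₁ hs₂ n₀ b₀ n₁ b₁ b₁' n₂
      b₂ b₂'
    exact ⟨hk5, hl2, e₀, e₁, 2, .inl rfl, hs₀, hs₁⟩

/-- If the paths do not all end at the same vertex, then the two cycles are pentagons and the paths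
are edges that make up, together with the cycles, a Petersen graph. -/
theorem eq_petersen (H : IsDisjointConfig k l n m β h) (h01 : ¬ m ∣ β 1 - β 0) :
    n = 5 ∧ m = 5 ∧ k = 5 ∧ l = 2 ∧ ∃ e, (e = 2 ∨ e = -2) ∧
      ∀ i : ℕ, h i = 1 ∧ (5 : ℤ) ∣ β i - (β 0 + e * i) := by
  obtain ⟨rfl, rfl⟩ := H.eq_of_not_dvd h01
  obtain ⟨rfl, rfl, -, -, e, he, he₀, -⟩ := H.four_consecutive h01
  refine ⟨rfl, rfl, rfl, rfl, e, he, ?_⟩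
  have key : ∀ i : ℕ, (5 : ℤ) ∣ e - (β (i + 1) - β i) ∧ (5 : ℤ) ∣ β i - (β 0 + e * i) := by
    intro i
    induction i with
    | zero => simpa using he₀
    | succ i ih =>
      obtain ⟨ih, ih'⟩ := ih
      have hi : ¬ (5 : ℤ) ∣ β (1 + i) - β (0 + i) := by
        rw [add_comm 1, zero_add]
        intro h
        omega
      obtain ⟨-, -, -, -, e', he', h1, h2⟩ := (H.shift i).four_consecutive hi
      rw [add_comm 1, zero_add] at h1
      rw [add_comm 1, show (2 + i : ℤ) = i + 1 + 1 by ring] at h2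
      obtain rfl : e = e' := by omega
      push_cast
      refine ⟨h2, ?_⟩
      rw [mul_add]
      omega
  intro i
  refine ⟨?_, (key i).2⟩
  have hi : ¬ (5 : ℤ) ∣ β (1 + i) - β (0 + i) := by
    have := (key i).1
    rw [add_comm 1, zero_add]
    intro h
    omega
  have := ((H.shift i).four_consecutive hi).2.2.1
  rwa [zero_add] at this

end IsDisjointConfig

namespace SimpleGraph

variable {V : Type*} {G : SimpleGraph V}

/-! ### Two disjoint odd cycles -/

lemma EvenOrCycleLength.isAdm {k l : ℕ} (hL : G.oddCycleLengths = {k, k + 2 * l}) {z : ℤ}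
    (h : G.EvenOrCycleLength z) : IsAdm k l z := by
  intro hz
  obtain ⟨N, hN, rfl⟩ := h (Int.odd_iff.2 hz)
  rw [hL] at hN
  rcases hN with rfl | rfl
  · exact .inl rfl
  · right; push_cast; rfl

lemma HasPathIn.extend {S K : Set V} {x y u v : V} {r : ℤ} (h : G.HasPathIn S u v r) (hS : S ⊆ K)
    (hx : x ∉ K) (hy : y ∉ K) (hxy : x ≠ y) (hxu : G.Adj x u) (hyv : G.Adj y v) :
    G.HasPathIn (S ∪ {x, y}) x y (r + 2) := by
  have h1 := HasPathIn.of_adj hxu (S := {x, u}) (by simp) (by simp)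
  have h2 := HasPathIn.of_adj hyv.symm (S := {v, y}) (by simp) (by simp)
  have h3 := (h1.append h ?_).append h2 ?_
  · rw [show r + 2 = 1 + r + 1 by ring]
    refine h3.mono ?_
    rintro z (((rfl | rfl) | hz) | (rfl | rfl))
    · simp
    · exact .inl h.left_mem
    · exact .inl hz
    · exact .inl h.right_mem
    · simp
  · rintro z (rfl | rfl) hz
    · exact (hx (hS hz)).elim
    · rfl
  · rintro z hz (rfl | rfl)
    · rfl
    · rcases hz with (rfl | rfl) | hz
      · exact (hxy rfl).elim
      · exact (hy (hS h.left_mem)).elim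
      · exact (hy (hS hz)).elim

namespace IsCyclicEnum

variable {n m : ℤ} {c d : ℤ → V}

/-- A path through the complement of a cycle makes a cycle with either arc of the cycle. -/
lemma one_handle_both (hc : G.IsCyclicEnum n c) {S : Set V} {i j r : ℤ} (hij : i < j)
    (hji : j < i + n) (hS : G.HasPathIn (S ∪ {c i, c j}) (c i) (c j) r)
    (hSc : ∀ t, c t ∉ S) :
    G.EvenOrCycleLength (r + (j - i)) ∧ G.EvenOrCycleLength (r + (n - (j - i))) := by
  constructor
  · refine hc.one_handle hij (by omega) hS fun t ht ht' h => ?_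
    rcases h with h | h | h
    · exact hSc t h
    · have := hc.eq_of_abs_lt h (by omega) (by omega)
      omega
    · have := hc.eq_of_abs_lt h (by omega) (by omega)
      omega
  · have hS' := hS.symm
    rw [← hc.period i] at hS'
    rw [show n - (j - i) = i + n - j by ring]
    refine hc.one_handle hji (by omega) hS' fun t ht ht' h => ?_
    rcases h with h | h | h
    · exact hSc t h
    · have := hc.eq_of_abs_lt h (by omega) (by omega)
      omega
    · have := hc.eq_of_abs_lt h (by omega) (by omega)
      omega

lemma arc_uIcc (hd : G.IsCyclicEnum m d) {u v : ℤ} (h : max u v < min u v + m) :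
    G.HasPathIn (d '' Set.Icc (min u v) (max u v)) (d u) (d v) |v - u| := by
  rcases le_total u v with huv | huv
  · rw [min_eq_left huv, max_eq_right huv] at *
    rw [abs_of_nonneg (by omega)]
    exact hd.arc huv (by omega)
  · rw [min_eq_right huv, max_eq_left huv] at *
    rw [abs_of_nonpos (by omega), neg_sub]
    exact (hd.arc huv (by omega)).symm

end IsCyclicEnum

open IsForest

lemma disjoint_rootsIn {par : V → V} {ht : V → ℕ} {K I J : Set V} (h : Disjoint I J) :
    Disjoint (rootsIn par ht K I) (rootsIn par ht K J) :=
  Set.disjoint_left.2 fun _ hx hx' => Set.disjoint_left.1 h hx.2 hx'.2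

/-- The forest paths from the vertices of a cycle to a disjoint cycle satisfy the arithmetic
constraints of a disjoint configuration. -/
theorem IsForest.isDisjointConfig {k l : ℕ} (hk : 5 ≤ k) (hl : 1 ≤ l)
    (hL : G.oddCycleLengths = {k, k + 2 * l}) {n m : ℤ} {c d : ℤ → V} {K : Set V} {par : V → V}
    {ht : V → ℕ} (hc : G.IsCyclicEnum n c) (hd : G.IsCyclicEnum m d) (hn : Odd n) (hm : Odd m)
    (hK : Kᶜ = Set.range c) (hF : G.IsForest K (Set.range d) par ht) {f : ℤ → V}
    (hf : ∀ i, f i ∈ K) (hadj : ∀ i, G.Adj (c i) (f i)) {β : ℤ → ℤ}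
    (hβ : ∀ i, forestAnc par ht (f i) 0 = d (β i)) :
    IsDisjointConfig k l n m β (fun i => ht (f i) + 1) := by
  have hcK : ∀ t, c t ∉ K := fun t => by
    have : c t ∈ Kᶜ := hK ▸ ⟨t, rfl⟩
    exact this
  have hrK : ∀ I, rootsIn par ht K I ⊆ K := fun I v hv => hv.1
  have hne : ∀ {i j : ℤ}, i < j → j < i + n → c i ≠ c j := fun h1 h2 h => by
    have := hc.eq_of_abs_lt h (by omega) (by omega)
    omega
  have hadm : ∀ {z : ℤ}, G.EvenOrCycleLength z → IsAdm k l z := fun h => h.isAdm hL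
  -- The path between two vertices of `c` that uses an arc of `d`.
  have path : ∀ {i j u v : ℤ}, i < j → j < i + n → m ∣ u - β i → m ∣ v - β j → u ≠ v →
      max u v < min u v + m →
      G.HasPathIn (rootsIn par ht K (d '' Set.Icc (min u v) (max u v)) ∪ {c i, c j}) (c i) (c j)
        (ht (f i) + 1 + (ht (f j) + 1) + |v - u|) := by
    intro i j u v hij hji hu hv huv huvm
    have eu : forestAnc par ht (f i) 0 = d u := by rw [hβ, eq_comm, hd.eq_iff]; exact hu
    have ev : forestAnc par ht (f j) 0 = d v := by rw [hβ, eq_comm, hd.eq_iff]; exact hv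
    have := hF.path_between (hf i) (hf j) (Set.image_subset_range _ _)
      (by rw [eu, ev]; exact hd.arc_uIcc huvm) (by
        rw [eu, ev]
        intro h
        exact huv (hd.eq_of_abs_lt h (by omega) (by omega)))
    have := this.extend (hrK _) (hcK i) (hcK j) (hne hij hji) (hadj i) (hadj j)
    rwa [show (ht (f i) + 1 + (ht (f j) + 1) + |v - u| : ℤ) =
      ht (f i) + |v - u| + ht (f j) + 2 by ring]
  have hodd : k % 2 = 1 := by
    have : k ∈ G.oddCycleLengths := by rw [hL]; simp
    exact Nat.odd_iff.1 this.1
  refine ⟨by omega, by omega, by omega, hadm hc.evenOrCycleLength (Int.odd_iff.1 hn),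
    hadm hd.evenOrCycleLength (Int.odd_iff.1 hm), fun i => by omega, ?_, ?_, ?_⟩
  · intro i j y hij hji hy hy0 hym
    have h1 := path (u := β i) (v := β i + y) hij hji (by simp)
      (by rwa [show β i + y - β j = y - (β j - β i) by ring]) (by omega) (by omega)
    have h2 := path (u := β i + m) (v := β i + y) hij hji (by simp)
      (by rwa [show β i + y - β j = y - (β j - β i) by ring]) (by omega) (by omega)
    rw [add_sub_cancel_left, abs_of_pos hy0] at h1
    rw [show β i + y - (β i + m) = -(m - y) by ring, abs_neg, abs_of_pos (by omega)] at h2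
    have h1 := hc.one_handle_both hij hji h1 (fun t ht => hcK t ht.1)
    have h2 := hc.one_handle_both hij hji h2 (fun t ht => hcK t ht.1)
    refine ⟨hadm ?_, hadm ?_, hadm ?_, hadm ?_⟩
    · convert h1.1 using 1; ring
    · convert h1.2 using 1; ring
    · convert h2.1 using 1; ring
    · convert h2.2 using 1; ring
  · intro i j hij hji h
    have he : forestAnc par ht (f i) 0 = forestAnc par ht (f j) 0 := by
      rw [hβ, hβ, eq_comm, hd.eq_iff]; exact h
    have hle := meetHt_le par ht (f i) (f j)
    have h1 := (hF.path_within (hf i) (hf j) he).extend (hrK _) (hcK i) (hcK j) (hne hij hji)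
      (hadj i) (hadj j)
    have h1 := hc.one_handle_both hij hji h1 (fun t ht => hcK t ht.1)
    refine ⟨meetHt par ht (f i) (f j), by omega, by omega, by omega, hadm ?_, hadm ?_⟩
    · convert h1.1 using 1; ring
    · convert h1.2 using 1; ring
  · intro i j p q u v w x hij hjp hpq hqi hu hv hw hx huv hwx h1 h2
    refine hadm (hc.two_handles hij hjp hpq hqi
      (path hij (by omega) hu hv huv (by omega)) (path hpq (by omega) hw hx hwx (by omega))
      ?_ ?_ ?_)
    · rintro _ (hv | hv) ⟨t, rfl⟩
      · exact (hcK t hv.1).elim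
      · exact hv
    · rintro _ (hv | hv) ⟨t, rfl⟩
      · exact (hcK t hv.1).elim
      · exact hv
    · rw [Set.disjoint_union_left, Set.disjoint_union_right, Set.disjoint_union_right]
      refine ⟨⟨disjoint_rootsIn ?_, ?_⟩, ?_, ?_⟩
      · rw [Set.disjoint_left]
        rintro _ ⟨a, ⟨ha, ha'⟩, rfl⟩ ⟨b, ⟨hb, hb'⟩, hab⟩
        have := hd.eq_of_abs_lt hab (by omega) (by omega)
        omega
      · rw [Set.disjoint_left]
        rintro z hz (rfl | rfl)
        · exact hcK _ hz.1
        · exact hcK _ hz.1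
      · rw [Set.disjoint_left]
        rintro z (rfl | rfl) hz
        · exact hcK _ hz.1
        · exact hcK _ hz.1
      · rw [Set.disjoint_left]
        rintro z (rfl | rfl) (h | h)
        · exact hne (by omega) (by omega) h
        · exact hne (by omega) (by omega) h
        · exact hne (by omega) (by omega) h
        · exact hne (by omega) (by omega) h

end SimpleGraph

namespace SimpleGraph

variable {V : Type*} {G : SimpleGraph V}

open IsForest

namespace IsCyclicEnum

variable {n m : ℤ} {c d : ℤ → V}

lemma range_nontrivial (hc : G.IsCyclicEnum n c) : (Set.range c).Nontrivial :=
  ⟨c 0, ⟨0, rfl⟩, c (0 + 1), ⟨_, rfl⟩, (hc.adj 0).ne⟩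

lemma exists_large_index (hc : G.IsCyclicEnum n c) (i t : ℤ) : ∃ s, i < s ∧ c s = c t := by
  obtain ⟨s, h1, -, h2⟩ := hc.exists_window (i + 1) t
  exact ⟨s, by omega, h2⟩

lemma isConnOn_range (hc : G.IsCyclicEnum n c) : G.IsConnOn (Set.range c) := by
  intro X hX ⟨x, hx⟩ hne
  obtain ⟨i, rfl⟩ := hX hx
  by_contra! hcon
  have h : ∀ j, i ≤ j → c j ∈ X := by
    intro j hij
    induction j, hij using Int.leInduction with
    | base => exact hx
    | succ j hij ih =>
      by_contra h
      exact hcon _ ih _ ⟨j + 1, rfl⟩ h (hc.adj j)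
  refine hne (hX.antisymm ?_)
  rintro _ ⟨j, rfl⟩
  obtain ⟨s, h1, h2⟩ := hc.exists_large_index i j
  exact h2 ▸ h s h1.le

/-- A pentagon in a graph without triangles has no chords. -/
lemma eq_add_one_of_adj (hc : G.IsCyclicEnum 5 c) (h3 : ¬ G.EvenOrCycleLength 3) {i j : ℤ}
    (h : G.Adj (c i) (c j)) : (j : ZMod 5) = i + 1 ∨ (i : ZMod 5) = j + 1 := by
  obtain ⟨s, h1, h2, h4⟩ := hc.exists_window i j
  have hs : (s : ZMod 5) = j := by
    rw [ZMod.intCast_eq_intCast_iff_dvd_sub]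
    exact (hc.eq_iff _ _).1 h4.symm
  rw [← h4] at h
  rw [← hs]
  have hp := HasPathIn.of_adj h (S := {c i, c s}) (by simp) (by simp)
  have hp' := HasPathIn.of_adj h.symm (S := {c i, c s}) (by simp) (by simp)
  have hmem : ∀ t, i < t → t < i + 5 → t ≠ s → c t ∉ ({c i, c s} : Set V) := by
    rintro t ht ht' hts (h | h)
    · have := hc.eq_of_abs_lt h (by omega) (by omega)
      omega
    · exact hts (hc.eq_of_abs_lt h (by omega) (by omega))
  obtain rfl | rfl | rfl | rfl | rfl :
    s = i ∨ s = i + 1 ∨ s = i + 2 ∨ s = i + 3 ∨ s = i + 4 := by omega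
  · exact (G.irrefl h).elim
  · left; push_cast; rfl
  · refine (h3 ?_).elim
    have := hc.one_handle (by omega) (by omega) hp fun t ht ht' => hmem t ht (by omega) (by omega)
    convert this using 1
    ring
  · refine (h3 ?_).elim
    rw [← hc.period i] at hp'
    have := hc.one_handle (by omega) (by omega) hp' fun t ht ht' => by
      rw [hc.period]
      exact hmem t (by omega) ht' (by omega)
    convert this using 1
    ring
  · right
    push_cast
    rw [add_assoc]
    have : (4 + 1 : ZMod 5) = 0 := by decide
    rw [this, add_zero]

/-- If a connected set `K` whose complement is an odd cycle `c` contains an odd cycle `d`, then both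
are pentagons and the only edges leaving the first are five edges to the second, positioned as in
the Petersen graph. -/
theorem eq_of_adj_of_disjoint (hG : G.IsVertexCritical) {k l : ℕ} (hk : 5 ≤ k) (hl : 1 ≤ l)
    (hL : G.oddCycleLengths = {k, k + 2 * l}) {K : Set V} (hc : G.IsCyclicEnum n c)
    (hd : G.IsCyclicEnum m d) (hn : Odd n) (hm : Odd m) (hKconn : G.IsConnOn K)
    (hK : Kᶜ = Set.range c) (hcK : ∀ t, ∃ y ∈ K, G.Adj (c t) y) (hdK : ∀ t, d t ∈ K) :
    n = 5 ∧ m = 5 ∧ k = 5 ∧ l = 2 ∧ ∃ β e : ℤ, (e = 2 ∨ e = -2) ∧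
      ∀ i, ∀ y ∈ K, G.Adj (c i) y → y = d (β + e * i) := by
  classical
  have hmemK : ∀ x, x ∉ K ↔ x ∈ Set.range c := fun x => by rw [← hK]; rfl
  obtain ⟨par, ht, hF, u, hu, v, hv, ⟨x, hx, hxu⟩, ⟨x', hx', hxv⟩, huv⟩ :=
    hG.exists_isForest_root_ne (B := Set.range d) hKconn (hK ▸ ⟨c 0, 0, rfl⟩)
      (by rintro _ ⟨t, rfl⟩; exact hdK t) hd.range_nontrivial
  obtain ⟨a, rfl⟩ := (hmemK x).1 hx
  obtain ⟨b', rfl⟩ := (hmemK x').1 hx'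
  obtain ⟨b, hab, hb⟩ := hc.exists_large_index a b'
  rw [← hb] at hxv
  -- The indices `a < b` of the two distinguished vertices do not have to lie in one period.
  have main : ∀ f : ℤ → V, (∀ i, f i ∈ K) → (∀ i, G.Adj (c i) (f i)) → f a = u → f b = v →
      n = 5 ∧ m = 5 ∧ k = 5 ∧ l = 2 ∧ ∃ β e : ℤ, (e = 2 ∨ e = -2) ∧
        ∀ i, b ≤ i → f i = d (β + e * i) := by
    intro f hfK hf hfa hfb
    have hr : ∀ i, ∃ t, d t = forestAnc par ht (f i) 0 := fun i => hF.root_mem (hfK i)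
    choose β hβ using hr
    have H := hF.isDisjointConfig hk hl hL hc hd hn hm hK hfK hf (fun i => (hβ i).symm)
    obtain ⟨i₀, hi₀, hi₀'⟩ : ∃ i, i < b ∧
        forestAnc par ht (f i) 0 ≠ forestAnc par ht (f (i + 1)) 0 := by
      by_contra! hcon
      have : ∀ j, a ≤ j → j ≤ b → forestAnc par ht (f a) 0 = forestAnc par ht (f j) 0 := by
        intro j haj
        induction j, haj using Int.leInduction with
        | base => exact fun _ => rfl
        | succ j hij ih => exact fun h => (ih (by omega)).trans (hcon j (by omega))
      exact huv (by rw [← hfa, ← hfb]; exact this b hab.le le_rfl)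
    have hne : ¬ m ∣ β (1 + i₀) - β (0 + i₀) := by
      rw [← hd.eq_iff, hβ, hβ, zero_add, add_comm]
      exact hi₀'.symm
    obtain ⟨rfl, rfl, h1, h2, e, he, h⟩ := (H.shift i₀).eq_petersen hne
    refine ⟨rfl, rfl, by omega, by omega, β i₀ - e * i₀, e, he, fun i hi => ?_⟩
    obtain ⟨h3, h4⟩ := h (i - i₀).toNat
    rw [show (((i - i₀).toNat : ℤ)) = i - i₀ by omega, sub_add_cancel, zero_add] at h4
    rw [show (((i - i₀).toNat : ℤ)) = i - i₀ by omega, sub_add_cancel] at h3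
    have h5 : forestAnc par ht (f i) 0 = f i := hF.root_of_mem (hF.mem_root (hfK i) (by omega))
    rw [← h5, ← hβ, hd.eq_iff]
    convert h4 using 1
    ring
  choose g hgK hg using hcK
  let f₀ := Function.update (Function.update g a u) b v
  have hupd : ∀ (f : ℤ → V) (i : ℤ) (y : V), (∀ i, f i ∈ K ∧ G.Adj (c i) (f i)) → y ∈ K →
      G.Adj (c i) y → ∀ j, Function.update f i y j ∈ K ∧ G.Adj (c j) (Function.update f i y j) := by
    intro f i y hf hy hiy j
    rcases eq_or_ne j i with rfl | hj
    · simpa using ⟨hy, hiy⟩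
    · rw [Function.update_of_ne hj]
      exact hf j
  have hf₀ := hupd _ b v (hupd g a u (fun i => ⟨hgK i, hg i⟩) hu hxu) hv hxv
  obtain ⟨rfl, rfl, h1, h2, β, e, he, h⟩ := main f₀ (fun i => (hf₀ i).1) (fun i => (hf₀ i).2)
    (by simp [f₀, Function.update_of_ne hab.ne]) (by simp [f₀])
  refine ⟨rfl, rfl, h1, h2, β, e, he, fun i y hy hiy => ?_⟩
  obtain ⟨s, hbs, hs⟩ := hc.exists_large_index b i
  have hs' := (hc.eq_iff _ _).1 hs
  have hf₁ := hupd f₀ s y hf₀ hy (hs ▸ hiy)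
  obtain ⟨-, -, -, -, β', e', he', h'⟩ := main (Function.update f₀ s y) (fun i => (hf₁ i).1)
    (fun i => (hf₁ i).2) (by
      rw [Function.update_of_ne (by omega)]
      simp [f₀, Function.update_of_ne hab.ne]) (by
      rw [Function.update_of_ne (by omega)]
      simp [f₀])
  have e1 := h' s hbs.le
  have e2 := h' (s + 5) (by omega)
  have e3 := h (s + 5) (by omega)
  rw [Function.update_self] at e1
  rw [Function.update_of_ne (by omega)] at e2
  rw [e1, show d (β' + e' * s) = d (β' + e' * (s + 5)) from
    (hd.eq_iff _ _).2 ⟨-e', by ring⟩, ← e2, e3, hd.eq_iff]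
  obtain ⟨q, hq⟩ := hs'
  exact ⟨e * (q + 1), by rw [show s = i + 5 * q by omega]; ring⟩

end IsCyclicEnum

lemma exists_petersen_colouring : ∃ A B : ZMod 5 → Fin 3, (∀ i, A i ≠ A (i + 1)) ∧
    (∀ i, A i ≠ B i) ∧ ∀ i, B i ≠ B (i + 2) :=
  show ∃ A B : Fin 5 → Fin 3, (∀ i, A i ≠ A (i + 1)) ∧ (∀ i, A i ≠ B i) ∧
      ∀ i, B i ≠ B (i + 2) from
    ⟨![0, 1, 0, 1, 2], ![1, 2, 2, 0, 0], by decide, by decide, by decide⟩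

/-- A connected set whose complement is an odd cycle contains no odd cycle. -/
theorem IsVertexCritical.exists_isProperOn_bool (hG : G.IsVertexCritical) {k l : ℕ} (hk : 5 ≤ k)
    (hl : 1 ≤ l) (hL : G.oddCycleLengths = {k, k + 2 * l}) {K : Set V} {n : ℤ} {c : ℤ → V}
    (hc : G.IsCyclicEnum n c) (hn : Odd n) (hKconn : G.IsConnOn K) (hK : Kᶜ = Set.range c)
    (hcK : ∀ t, ∃ y ∈ K, G.Adj (c t) y) : ∃ κ : V → Bool, G.IsProperOn K κ := by
  classical
  by_contra hcon
  obtain ⟨K', m, d, hcK', hK'conn, hm, hd, hK', hdK'⟩ :=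
    hG.exists_isConnOn_compl_eq_range hc.isConnOn_range hc.range_nontrivial.nonempty
      (by rwa [← hK, compl_compl])
  have hdK : ∀ t, d t ∈ K := fun t => by
    by_contra h
    have h1 : d t ∈ Kᶜ := h
    have h2 : d t ∈ K'ᶜ := hK' ▸ ⟨t, rfl⟩
    rw [hK] at h1
    exact h2 (hcK' h1)
  obtain ⟨rfl, rfl, rfl, rfl, β, e, he, hadj⟩ :=
    IsCyclicEnum.eq_of_adj_of_disjoint hG hk hl hL hc hd hn hm hKconn hK hcK hdK
  obtain ⟨-, -, -, -, β', e', -, hadj'⟩ :=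
    IsCyclicEnum.eq_of_adj_of_disjoint hG hk hl hL hd hc hm hn hK'conn hK' hdK'
      (fun t => hcK' ⟨t, rfl⟩)
  have h3 : ¬ G.EvenOrCycleLength 3 := fun h => by
    rcases h.isAdm hL (by norm_num) with h | h <;> norm_num at h
  have huniv : ∀ v, v ∈ Set.range c ∨ v ∈ Set.range d := by
    by_contra! hcon
    obtain ⟨v, hvc, hvd⟩ := hcon
    obtain ⟨x, hx, y, hy, -, hxy⟩ := hG.exists_adj_avoiding (X := Set.range c ∪ Set.range d)
      (z := c 0) (x₀ := c 0) (.inl ⟨0, rfl⟩) (y₀ := v) (fun h => h.elim hvc hvd) (by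
        rintro rfl
        exact hvc ⟨0, rfl⟩)
    rw [Set.mem_union, not_or] at hy
    rcases hx with ⟨i, rfl⟩ | ⟨i, rfl⟩
    · refine hy.2 ?_
      have hyK : y ∈ K := by by_contra h; exact hy.1 (hK ▸ h)
      rw [hadj i y hyK hxy]
      exact ⟨_, rfl⟩
    · refine hy.1 ?_
      have hyK : y ∈ K' := by by_contra h; exact hy.2 (hK' ▸ h)
      rw [hadj' i y hyK hxy]
      exact ⟨_, rfl⟩
  have hdisj : ∀ i j, c i ≠ d j := fun i j h => by
    have : c i ∈ Kᶜ := hK ▸ ⟨i, rfl⟩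
    exact this (h ▸ hdK j)
  have hcast : ∀ {i j : ℤ}, c i = c j → (i : ZMod 5) = j := fun {i j} h => by
    rw [eq_comm, ZMod.intCast_eq_intCast_iff_dvd_sub]
    exact (hc.eq_iff _ _).1 h
  have hcast' : ∀ {i j : ℤ}, d i = d j → (i : ZMod 5) = j := fun {i j} h => by
    rw [eq_comm, ZMod.intCast_eq_intCast_iff_dvd_sub]
    exact (hd.eq_iff _ _).1 h
  obtain ⟨A, B, hA, hAB, hB⟩ := exists_petersen_colouring
  -- The vertex of `d` with index `β + e * i` is the neighbour of the vertex of `c` with index `i`.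
  have hBe : ∀ x : ZMod 5, B x ≠ B (x + e) := by
    rcases he with rfl | rfl
    · exact_mod_cast hB
    · intro x h
      refine hB (x - 2) ?_
      rw [sub_add_cancel, h]
      push_cast
      rw [sub_eq_add_neg]
  have he' : ∀ x : ZMod 5, ((e : ℤ) : ZMod 5) * (((e : ℤ) : ZMod 5) * -x) = x := by
    rcases he with rfl | rfl
    · decide
    · decide
  let φ : V → Fin 3 := fun v => if h : v ∈ Set.range c then A (h.choose : ℤ) else
    if h : v ∈ Set.range d then B ((e : ℤ) * ((β : ZMod 5) - (h.choose : ℤ))) else 0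
  have hφc : ∀ i : ℤ, φ (c i) = A i := fun i => by
    have h : c i ∈ Set.range c := ⟨i, rfl⟩
    simp only [φ, dif_pos h]
    rw [hcast h.choose_spec]
  have hφd : ∀ i : ℤ, φ (d i) = B ((e : ℤ) * ((β : ZMod 5) - i)) := fun i => by
    have h : d i ∈ Set.range d := ⟨i, rfl⟩
    have h' : d i ∉ Set.range c := by rintro ⟨j, hj⟩; exact hdisj _ _ hj
    simp only [φ, dif_pos h, dif_neg h']
    rw [hcast' h.choose_spec]
  have hφcd : ∀ i j, G.Adj (c i) (d j) → φ (c i) ≠ φ (d j) := by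
    intro i j hij
    have := hcast' (hadj i _ (hdK j) hij)
    rw [hφc, hφd, this]
    push_cast
    rw [show (β : ZMod 5) - (β + e * i) = e * -i by ring, he']
    exact hAB _
  refine hG.not_proper φ fun u _ v _ huv => ?_
  rcases huniv u with ⟨i, rfl⟩ | ⟨i, rfl⟩ <;> rcases huniv v with ⟨j, rfl⟩ | ⟨j, rfl⟩
  · rw [hφc, hφc]
    rcases hc.eq_add_one_of_adj h3 huv with h | h
    · rw [h]; exact hA _
    · rw [h]; exact (hA _).symm
  · exact hφcd i j huv
  · exact (hφcd j i huv.symm).symm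
  · rw [hφd, hφd]
    rcases hd.eq_add_one_of_adj h3 huv with h | h
    · rw [h]
      convert (hBe _).symm using 2
      ring
    · rw [h]
      convert hBe _ using 2
      ring

end SimpleGraph

/-! ### Arithmetic of the attachments of a cycle to a cycle sharing a vertex with it -/

/-- The arithmetic data of two cycles of lengths `n` and `m` that meet in the common vertex with
index `0`, where the `i`-th vertex of the first, for `0 < i < n`, is joined by a path of length
`h i` to the vertex `β i` of the second. Two of these paths are disjoint if they end at different
vertices, and otherwise share a final section of length `t i j`. The remaining fields
express that the cycles using up to four of these paths have admissible lengths. -/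
structure IsSharedConfig (k l n m : ℤ) (β h : ℤ → ℤ) (t : ℤ → ℤ → ℤ) : Prop where
  odd : k % 2 = 1
  five_le : 5 ≤ k
  one_le : 1 ≤ l
  left_eq : n = k ∨ n = k + 2 * l
  right_eq : m = k ∨ m = k + 2 * l
  pos : ∀ i, 1 ≤ h i
  bounds : ∀ i, 0 < i → i < n → 0 < β i ∧ β i < m
  single : ∀ i, 0 < i → i < n →
    IsAdm k l (h i + i + β i) ∧ IsAdm k l (h i + (n - i) + β i) ∧
      IsAdm k l (h i + i + (m - β i)) ∧ IsAdm k l (h i + (n - i) + (m - β i))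
  meet : ∀ i j, 0 ≤ t i j ∧ t i j < h i ∧ t i j < h j ∧ (β i ≠ β j → t i j = 0)
  ultra : ∀ i j p, β i = β j → β i = β p → min (t i j) (t i p) ≤ t j p
  pair : ∀ i j, 0 < i → i < j → j < n →
    IsAdm k l (h i + h j + |β j - β i| - 2 * t i j + (j - i)) ∧
      IsAdm k l (h i + h j + |β j - β i| - 2 * t i j + (n - (j - i))) ∧
      (β i ≠ β j → IsAdm k l (h i + h j + (m - |β j - β i|) + (j - i)))
  three : ∀ i p q, 0 < i → i < p → p < q → q < n →
    (β i < min (β p) (β q) → IsAdm k l ((h i + β i) +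
      (h p + h q + |β q - β p| - 2 * t p q) + n - i - (q - p))) ∧
    (max (β p) (β q) < β i → IsAdm k l ((h i + (m - β i)) +
      (h p + h q + |β q - β p| - 2 * t p q) + n - i - (q - p)))
  four : ∀ i j p q, 0 < i → i < j → j < p → p < q → q < n →
    (max (β i) (β j) < min (β p) (β q) ∨ max (β p) (β q) < min (β i) (β j)) →
    IsAdm k l ((h i + h j + |β j - β i| - 2 * t i j) +
      (h p + h q + |β q - β p| - 2 * t p q) + n - (j - i) - (q - p))

namespace IsSharedConfig

variable {k l n m : ℤ} {β h : ℤ → ℤ} {t : ℤ → ℤ → ℤ}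

lemma reflect (H : IsSharedConfig k l n m β h t) :
    IsSharedConfig k l n m (fun i => m - β i) h t where
  odd := H.odd
  five_le := H.five_le
  one_le := H.one_le
  left_eq := H.left_eq
  right_eq := H.right_eq
  pos := H.pos
  bounds i h1 h2 := by
    have := H.bounds i h1 h2
    omega
  single i h1 h2 := by
    have := H.single i h1 h2
    rw [sub_sub_cancel]
    exact ⟨this.2.2.1, this.2.2.2, this.1, this.2.1⟩
  meet i j := by
    have := H.meet i j
    omega
  ultra i j p h1 h2 := H.ultra i j p (by omega) (by omega)
  pair i j h1 h2 h3 := by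
    have := H.pair i j h1 h2 h3
    rw [show m - β j - (m - β i) = -(β j - β i) by ring, abs_neg]
    exact ⟨this.1, this.2.1, fun h => this.2.2 (by omega)⟩
  three i p q h1 h2 h3 h4 := by
    have := H.three i p q h1 h2 h3 h4
    rw [show m - β q - (m - β p) = -(β q - β p) by ring, abs_neg, sub_sub_cancel]
    exact ⟨fun h => this.2 (by omega), fun h => this.1 (by omega)⟩
  four i j p q h1 h2 h3 h4 h5 h6 := by
    have := H.four i j p q h1 h2 h3 h4 h5 (by omega)
    rwa [show m - β q - (m - β p) = -(β q - β p) by ring, abs_neg,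
      show m - β j - (m - β i) = -(β j - β i) by ring, abs_neg]

lemma left_eq_and_single (H : IsSharedConfig k l n m β h t) {i : ℤ} (h0 : 0 < i) (hi : i < n) :
    (n = k ∧ m = k ∧ CrossRel k l i (β i) (h i)) ∨
      (n = k ∧ m = k + 2 * l ∧ h i = l ∧ (β i = i + l ∨ m - β i = i + l)) ∨
      (n = k + 2 * l ∧ m = k ∧ h i = l ∧ (i = β i + l ∨ n - i = β i + l)) := by
  obtain ⟨q1, q2, q3, q4⟩ := H.single i h0 hi
  exact crossRel_of_isAdm H.odd H.one_le H.left_eq H.right_eq (H.pos i) q1 q2 q3 q4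

/-- The possible end and length of the path at a vertex near the common vertex. -/
lemma single_cases (H : IsSharedConfig k l k k β h t) {i : ℤ} (h0 : 0 < i) (hi : i < k) :
    (h i = 2 * l ∧ (β i = i ∨ β i = k - i)) ∨ (h i = l ∧ (β i = i + l ∨ β i = i - l ∨
      β i = k - i - l ∨ β i = k - i + l)) := by
  have h1 := H.one_le
  obtain h | h | h := H.left_eq_and_single h0 hi
  · exact h.2.2
  all_goals omega

/-- The relation forced by the three cycles through a pair of paths. -/
lemma pair_cases (H : IsSharedConfig k l k k β h t) {i j : ℤ} (h0 : 0 < i) (hij : i < j)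
    (hj : j < k) : ∃ y p, (β i < β j ∧ y = β j - β i ∧ t i j = 0 ∨
        β j < β i ∧ y = β i - β j ∧ t i j = 0 ∨ β i = β j ∧ y = 0) ∧
      p = h i + h j + y - 2 * t i j ∧ |β j - β i| = y ∧
      (p = j - i ∨ p = k - (j - i) ∨ p = j - i + 2 * l ∨ p = k - (j - i) + 2 * l) ∧
      (y = 0 ∨ (h i + h j - y + (j - i)) % 2 = 1 ∨ h i + h j - y + (j - i) = 0 ∨
        h i + h j - y + (j - i) = 2 * l) := by
  obtain ⟨q1, q2, q3⟩ := H.pair i j h0 hij hj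
  have ht := (H.meet i j).2.2.2
  have hko := H.odd
  refine ⟨|β j - β i|, h i + h j + |β j - β i| - 2 * t i j, ?_, rfl, rfl, ?_, ?_⟩
  · rcases abs_cases (β j - β i) with ⟨e, e'⟩ | ⟨e, e'⟩ <;> omega
  · clear q3
    generalize h i + h j + |β j - β i| - 2 * t i j = p at *
    by_cases hp : (p + (j - i)) % 2 = 1
    · have := q1 hp
      omega
    · have := q2 (by omega)
      omega
  · by_cases hβ : β i = β j
    · simp [hβ]
    · have q3 := q3 hβ
      clear q1 q2
      unfold IsAdm at q3
      generalize |β j - β i| = y at *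
      omega

end IsSharedConfig

/-- The possible ends and lengths of the paths at two consecutive vertices next to the common
vertex of the two cycles, if the admissible lengths differ by more than two. -/
lemma shared_two_consecutive {k l x₁ x₂ h₁ h₂ t y p : ℤ} (hk : 5 ≤ k) (hko : k % 2 = 1)
    (hl : 2 ≤ l) (b1 : 0 < x₁) (b1' : 2 * x₁ < k) (b2 : 0 < x₂ ∧ x₂ < k)
    (ht : 0 ≤ t ∧ t < h₁ ∧ t < h₂)
    (s1 : (h₁ = 2 * l ∧ x₁ = 1) ∨ (h₁ = l ∧ (x₁ = 1 + l ∨ x₁ = k - 1 - l)))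
    (s2 : (h₂ = 2 * l ∧ (x₂ = 2 ∨ x₂ = k - 2)) ∨ (h₂ = l ∧ (x₂ = 2 + l ∨ x₂ = 2 - l ∨
      x₂ = k - 2 - l ∨ x₂ = k - 2 + l)))
    (e : x₁ < x₂ ∧ y = x₂ - x₁ ∧ t = 0 ∨ x₂ < x₁ ∧ y = x₁ - x₂ ∧ t = 0 ∨ x₁ = x₂ ∧ y = 0)
    (hp : p = h₁ + h₂ + y - 2 * t)
    (hp' : p = 1 ∨ p = k - 1 ∨ p = 1 + 2 * l ∨ p = k - 1 + 2 * l)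
    (hy : y = 0 ∨ (h₁ + h₂ - y + 1) % 2 = 1 ∨ h₁ + h₂ - y + 1 = 0 ∨ h₁ + h₂ - y + 1 = 2 * l) :
    (h₁ = l ∧ h₂ = l ∧ (x₁ = 1 + l ∧ x₂ = 2 + l ∨ x₁ = k - 1 - l ∧ x₂ = k - 2 - l)) ∨
      (l = k - 3 ∧ (x₁ = 1 ∧ h₁ = 2 * l ∧ x₂ = 1 ∧ h₂ = l ∨
        x₁ = 2 ∧ h₁ = l ∧ x₂ = 2 ∧ h₂ = 2 * l)) ∨
      (l = k - 2 ∧ x₁ = 1 ∧ h₁ = l ∧ x₂ = 2 ∧ h₂ = 2 * l) := by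
  rcases s1 with ⟨a, b⟩ | ⟨a, b | b⟩ <;>
    rcases s2 with ⟨c, d | d⟩ | ⟨c, d | d | d | d⟩ <;>
    rcases e with e | e | e <;> try (exfalso; clear * - e b d b1 b1' b2 hl hk hko; omega)
  all_goals
    rcases hp' with f | f | f | f <;>
      try (exfalso; clear * - a b c d e f hp hl hko hk b1 b2 ht b1'; omega)
  all_goals
    rcases hy with g | g | g | g <;>
      try (exfalso; omega)
  all_goals omega

namespace IsSharedConfig

variable {k l n m : ℤ} {β h : ℤ → ℤ} {t : ℤ → ℤ → ℤ}

set_option maxHeartbeats 1000000 in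
lemma eq_one_of_lt (H : IsSharedConfig k l k k β h t) (h1 : 2 * β 1 < k) : l = 1 := by
  have hk := H.five_le
  have hko := H.odd
  have hl := H.one_le
  by_contra hl1
  replace hl1 : 2 ≤ l := by omega
  have b1 := H.bounds 1 (by omega) (by omega)
  have b2 := H.bounds 2 (by omega) (by omega)
  have b3 := H.bounds (k - 1) (by omega) (by omega)
  have p3 := H.pos (k - 1)
  have s1 := H.single_cases (i := 1) (by omega) (by omega)
  have s2 := H.single_cases (i := 2) (by omega) (by omega)
  have s3 := H.single_cases (i := k - 1) (by omega) (by omega)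
  have t12 := H.meet 1 2
  have t13 := H.meet 1 (k - 1)
  have t23 := H.meet 2 (k - 1)
  obtain ⟨y, p, e, hp, -, hp', hy⟩ := H.pair_cases (i := 1) (j := 2) (by omega) (by omega) (by omega)
  obtain ⟨y', p', e', hq, -, hq', hy'⟩ :=
    H.pair_cases (i := 1) (j := k - 1) (by omega) (by omega) (by omega)
  obtain ⟨y'', p'', e'', hr, -, hr', hy''⟩ :=
    H.pair_cases (i := 2) (j := k - 1) (by omega) (by omega) (by omega)
  have hu := H.ultra 1 2 (k - 1)
  have key := shared_two_consecutive hk hko hl1 b1.1 h1 b2 ⟨t12.1, t12.2.1, t12.2.2.1⟩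
    (by clear * - s1 h1 b1 hl1 hk; omega) s2 (by omega) hp
    (by clear * - hp'; omega) (by clear * - hy; omega)
  clear s1 s2 hy hl b1 b2
  replace s3 : (h (k - 1) = 2 * l ∧ (β (k - 1) = 1 ∨ β (k - 1) = k - 1)) ∨
      (h (k - 1) = l ∧ (β (k - 1) = 1 + l ∨ β (k - 1) = k - 1 - l)) := by
    clear * - s3 b3 hl1
    omega
  generalize β 1 = x₁ at *
  generalize β 2 = x₂ at *
  generalize β (k - 1) = x₃ at *
  generalize h 1 = h₁ at *
  generalize h 2 = h₂ at *
  generalize h (k - 1) = h₃ at *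
  generalize t 1 2 = t₁ at *
  generalize t 1 (k - 1) = t₂ at *
  generalize t 2 (k - 1) = t₃ at *
  clear H
  rcases key with ⟨a, b, ⟨c, d⟩ | ⟨c, d⟩⟩ | ⟨z, ⟨c, a, d, b⟩ | ⟨c, a, d, b⟩⟩ | ⟨z, c, a, d, b⟩ <;>
    rcases s3 with ⟨r, s | s⟩ | ⟨r, s | s⟩ <;>
    rcases e' with e' | e' | e' <;>
    try (exfalso; clear * - a b c d r s e' h1 hl1 hk hko b3; omega)
  all_goals
    rcases e'' with e'' | e'' | e'' <;>
    try (exfalso; clear * - a b c d r s e' e'' h1 hl1 hk hko b3; omega)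
  all_goals
    rcases hq' with f | f | f | f <;>
    try (exfalso; clear * - a b c d r s e' e'' h1 hl1 hk hko b3 hq f t13; omega)
  all_goals
    rcases hr' with g | g | g | g <;>
    try (exfalso; clear * - a b c d r s e' e'' h1 hl1 hk hko b3 hq f t13 hr g t23; omega)
  all_goals omega

end IsSharedConfig

namespace IsSharedConfig

variable {k l n m : ℤ} {β h : ℤ → ℤ} {t : ℤ → ℤ → ℤ}

lemma eq_one (H : IsSharedConfig k l k k β h t) : l = 1 := by
  have hko := H.odd
  rcases lt_or_ge (2 * β 1) k with h1 | h1
  · exact H.eq_one_of_lt h1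
  · exact H.reflect.eq_one_of_lt (by omega)

lemma false_of_eq_add (H : IsSharedConfig k l k (k + 2 * l) β h t) (h1 : β 1 = 1 + l) : False := by
  have hk := H.five_le
  have hko := H.odd
  have hl := H.one_le
  have s : ∀ i, 0 < i → i < k → h i = l ∧ (β i = i + l ∨ β i = k + l - i) := by
    intro i h0 hi
    rcases H.left_eq_and_single h0 hi with h | h | h <;> omega
  obtain ⟨a1, -⟩ := s 1 (by omega) (by omega)
  obtain ⟨a2, s2⟩ := s 2 (by omega) (by omega)
  obtain ⟨a3, s3⟩ := s (k - 1) (by omega) (by omega)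
  obtain ⟨q1, q2, q3⟩ := H.pair 1 2 (by omega) (by omega) (by omega)
  obtain ⟨r1, r2, r3⟩ := H.pair 1 (k - 1) (by omega) (by omega) (by omega)
  obtain ⟨u1, u2, u3⟩ := H.pair 2 (k - 1) (by omega) (by omega) (by omega)
  have t1 := H.meet 1 2
  have t2 := H.meet 1 (k - 1)
  have t3 := H.meet 2 (k - 1)
  unfold IsAdm at *
  rw [h1, a1, a2] at *
  rw [a3] at *
  clear H s a1 a2 a3 h1
  generalize β 2 = x₂ at *
  generalize β (k - 1) = x₃ at *
  rcases s2 with rfl | rfl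
  · rw [show 2 + l - (1 + l) = 1 by ring, abs_one] at *
    omega
  · rw [show k + l - 2 - (1 + l) = k - 3 by ring, abs_of_pos (show 0 < k - 3 by omega)] at *
    rcases s3 with rfl | rfl
    · rw [show k - 1 + l - (1 + l) = k - 2 by ring, abs_of_pos (show 0 < k - 2 by omega)] at *
      clear u1 u2 u3
      omega
    · rw [show k + l - (k - 1) - (k + l - 2) = -(k - 3) by ring, abs_neg,
        abs_of_pos (show 0 < k - 3 by omega)] at *
      clear r1 r2 r3
      omega

/-- The two cycles have the smaller of the two admissible lengths. -/
lemma eq_left_eq_right (H : IsSharedConfig k l n m β h t) : n = k ∧ m = k := by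
  have hk := H.five_le
  have hl := H.one_le
  have hn : 5 ≤ n := by rcases H.left_eq with h | h <;> omega
  have b1 := H.bounds 1 (by omega) (by omega)
  rcases H.left_eq_and_single (i := 1) (by omega) (by omega) with s1 | ⟨rfl, rfl, s1, s1'⟩ | s1
  · exact ⟨s1.1, s1.2.1⟩
  · rcases s1' with s1' | s1'
    · exact (H.false_of_eq_add s1').elim
    · exact (H.reflect.false_of_eq_add s1').elim
  · omega

end IsSharedConfig

/-- The possible ends `x₁`, `x₂` and lengths of the paths at the vertices `1` and `2`, if the
admissible lengths are `k` and `k + 2`. -/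
lemma shared_one_two {k x₁ x₂ h₁ h₂ t y p : ℤ} (hk : 7 ≤ k) (hko : k % 2 = 1)
    (b1 : 0 < x₁ ∧ x₁ < k) (b1' : 2 * x₁ < k) (b2 : 0 < x₂ ∧ x₂ < k)
    (ht : 0 ≤ t ∧ t < h₁ ∧ t < h₂)
    (s1 : (h₁ = 2 ∧ (x₁ = 1 ∨ x₁ = k - 1)) ∨ (h₁ = 1 ∧ (x₁ = 1 + 1 ∨ x₁ = 1 - 1 ∨
      x₁ = k - 1 - 1 ∨ x₁ = k - 1 + 1)))
    (s2 : (h₂ = 2 ∧ (x₂ = 2 ∨ x₂ = k - 2)) ∨ (h₂ = 1 ∧ (x₂ = 2 + 1 ∨ x₂ = 2 - 1 ∨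
      x₂ = k - 2 - 1 ∨ x₂ = k - 2 + 1)))
    (e : x₁ < x₂ ∧ y = x₂ - x₁ ∧ t = 0 ∨ x₂ < x₁ ∧ y = x₁ - x₂ ∧ t = 0 ∨ x₁ = x₂ ∧ y = 0)
    (hp : p = h₁ + h₂ + y - 2 * t)
    (hp' : p = 1 ∨ p = k - 1 ∨ p = 1 + 2 ∨ p = k - 1 + 2)
    (hy : y = 0 ∨ (h₁ + h₂ - y + 1) % 2 = 1 ∨ h₁ + h₂ - y + 1 = 0 ∨ h₁ + h₂ - y + 1 = 2) :
    (h₁ = 2 ∧ x₁ = 1 ∧ (h₂ = 1 ∧ (x₂ = 1 ∧ p = 3 ∨ x₂ = k - 3 ∨ x₂ = k - 1) ∨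
      h₂ = 2 ∧ x₂ = k - 2)) ∨
    (h₁ = 1 ∧ x₁ = 2 ∧ (h₂ = 1 ∧ (x₂ = 1 ∧ p = 3 ∨ x₂ = 3 ∨ x₂ = k - 1) ∨
      h₂ = 2 ∧ (x₂ = 2 ∧ p = 3 ∨ x₂ = k - 2))) := by
  rcases s1 with ⟨a, b | b⟩ | ⟨a, b | b | b | b⟩ <;>
    rcases s2 with ⟨c, d | d⟩ | ⟨c, d | d | d | d⟩ <;>
    rcases e with e | e | e <;> try (exfalso; clear * - e b d b1 b1' b2 hk hko; omega)
  all_goals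
    rcases hp' with f | f | f | f <;>
      try (exfalso; clear * - a b c d e f hp hko hk b1 b2 ht b1'; omega)
  all_goals
    rcases hy with g | g | g | g <;>
      try (exfalso; omega)
  all_goals omega

/-- The vertices `1` and `3`; the hypotheses of this and the next three lemmas are those that
`IsSharedConfig.single_cases` and `IsSharedConfig.pair_cases` provide. -/
lemma shared_one_three {k x₁ x₃ h₁ h₃ t y p : ℤ} (hk : 7 ≤ k) (hko : k % 2 = 1)
    (b3 : 0 < x₃ ∧ x₃ < k) (ht : 0 ≤ t ∧ t < h₁ ∧ t < h₃)
    (s1 : h₁ = 2 ∧ x₁ = 1 ∨ h₁ = 1 ∧ x₁ = 2)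
    (s3 : (h₃ = 2 ∧ (x₃ = 3 ∨ x₃ = k - 3)) ∨ (h₃ = 1 ∧ (x₃ = 3 + 1 ∨ x₃ = 3 - 1 ∨
      x₃ = k - 3 - 1 ∨ x₃ = k - 3 + 1)))
    (e : x₁ < x₃ ∧ y = x₃ - x₁ ∧ t = 0 ∨ x₃ < x₁ ∧ y = x₁ - x₃ ∧ t = 0 ∨ x₁ = x₃ ∧ y = 0)
    (hp : p = h₁ + h₃ + y - 2 * t)
    (hp' : p = 2 ∨ p = k - 2 ∨ p = 2 + 2 ∨ p = k - 2 + 2)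
    (hy : y = 0 ∨ (h₁ + h₃ - y + 2) % 2 = 1 ∨ h₁ + h₃ - y + 2 = 0 ∨ h₁ + h₃ - y + 2 = 2) :
    (h₁ = 2 ∧ x₁ = 1 ∧ (h₃ = 2 ∧ x₃ = k - 3 ∨ h₃ = 1 ∧ (x₃ = k - 4 ∨ x₃ = k - 2))) ∨
    (h₁ = 1 ∧ x₁ = 2 ∧ (h₃ = 2 ∧ x₃ = k - 3 ∨ h₃ = 1 ∧ (x₃ = 4 ∨ x₃ = 2 ∨ x₃ = k - 2))) := by
  rcases s1 with ⟨a, b⟩ | ⟨a, b⟩ <;>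
    rcases s3 with ⟨c, d | d⟩ | ⟨c, d | d | d | d⟩ <;>
    rcases e with e | e | e <;> try (exfalso; clear * - e b d b3 hk hko; omega)
  all_goals
    rcases hp' with f | f | f | f <;>
      try (exfalso; clear * - a b c d e f hp hko hk b3 ht; omega)
  all_goals
    rcases hy with g | g | g | g <;>
      try (exfalso; omega)
  all_goals omega

lemma shared_two_three {k x₂ x₃ h₂ h₃ t y p : ℤ} (hk : 7 ≤ k) (hko : k % 2 = 1)
    (b2 : 0 < x₂ ∧ x₂ < k) (b3 : 0 < x₃ ∧ x₃ < k) (ht : 0 ≤ t ∧ t < h₂ ∧ t < h₃)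
    (s2 : h₂ = 2 ∧ (x₂ = 2 ∨ x₂ = k - 2) ∨ h₂ = 1 ∧ (x₂ = 3 ∨ x₂ = 1 ∨ x₂ = k - 3 ∨ x₂ = k - 1))
    (s3 : h₃ = 2 ∧ (x₃ = k - 3) ∨ h₃ = 1 ∧ (x₃ = 4 ∨ x₃ = 2 ∨ x₃ = k - 4 ∨ x₃ = k - 2))
    (e : x₂ < x₃ ∧ y = x₃ - x₂ ∧ t = 0 ∨ x₃ < x₂ ∧ y = x₂ - x₃ ∧ t = 0 ∨ x₂ = x₃ ∧ y = 0)
    (hp : p = h₂ + h₃ + y - 2 * t)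
    (hp' : p = 1 ∨ p = k - 1 ∨ p = 1 + 2 ∨ p = k - 1 + 2)
    (hy : y = 0 ∨ (h₂ + h₃ - y + 1) % 2 = 1 ∨ h₂ + h₃ - y + 1 = 0 ∨ h₂ + h₃ - y + 1 = 2) :
    h₃ = 1 ∧ x₃ = 2 ∨ (p = 3 ∧ 2 < x₂ ∧ 2 < x₃) ∨
      (h₂ = 2 ∧ x₂ = 2 ∨ h₂ = 1 ∧ x₂ = 1) ∧ (h₃ = 2 ∧ x₃ = k - 3 ∨ h₃ = 1 ∧ x₃ = k - 2) := by
  rcases s2 with ⟨a, b | b⟩ | ⟨a, b | b | b | b⟩ <;>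
    rcases s3 with ⟨c, d⟩ | ⟨c, d | d | d | d⟩ <;>
    rcases e with e | e | e <;> try (exfalso; clear * - e b d b2 b3 hk hko; omega)
  all_goals
    rcases hp' with f | f | f | f <;>
      try (exfalso; clear * - a b c d e f hp hko hk b3 b2 ht; omega)
  all_goals
    rcases hy with g | g | g | g <;>
      try (exfalso; omega)
  all_goals omega

lemma shared_one_four {k x₁ x₄ h₁ h₄ t y p : ℤ} (hk : 7 ≤ k) (hko : k % 2 = 1)
    (ht : 0 ≤ t ∧ t < h₁ ∧ t < h₄)
    (s1 : h₁ = 2 ∧ x₁ = 1 ∨ h₁ = 1 ∧ x₁ = 2)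
    (s4 : (h₄ = 2 ∧ (x₄ = 4 ∨ x₄ = k - 4)) ∨ (h₄ = 1 ∧ (x₄ = 4 + 1 ∨ x₄ = 4 - 1 ∨
      x₄ = k - 4 - 1 ∨ x₄ = k - 4 + 1)))
    (e : x₁ < x₄ ∧ y = x₄ - x₁ ∧ t = 0 ∨ x₄ < x₁ ∧ y = x₁ - x₄ ∧ t = 0 ∨ x₁ = x₄ ∧ y = 0)
    (hp : p = h₁ + h₄ + y - 2 * t)
    (hp' : p = 3 ∨ p = k - 3 ∨ p = 3 + 2 ∨ p = k - 3 + 2)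
    (hy : y = 0 ∨ (h₁ + h₄ - y + 3) % 2 = 1 ∨ h₁ + h₄ - y + 3 = 0 ∨ h₁ + h₄ - y + 3 = 2) :
    h₄ = 2 ∧ x₄ = k - 4 ∨ h₄ = 1 ∧ (x₄ = k - 5 ∨ x₄ = k - 3 ∨ x₄ = 5) := by
  rcases s1 with ⟨a, b⟩ | ⟨a, b⟩ <;>
    rcases s4 with ⟨c, d | d⟩ | ⟨c, d | d | d | d⟩ <;>
    rcases e with e | e | e <;> try (exfalso; clear * - e b d hk hko; omega)
  all_goals
    rcases hp' with f | f | f | f <;>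
      try (exfalso; clear * - a b c d e f hp hko hk ht; omega)
  all_goals
    rcases hy with g | g | g | g <;>
      try (exfalso; omega)
  all_goals omega

lemma shared_three_four {k x₃ x₄ h₃ h₄ t y p : ℤ} (hk : 7 ≤ k) (hko : k % 2 = 1)
    (ht : 0 ≤ t ∧ t < h₃ ∧ t < h₄)
    (s3 : h₃ = 2 ∧ x₃ = k - 3 ∨ h₃ = 1 ∧ (x₃ = k - 2 ∨ x₃ = 2))
    (s4 : h₄ = 2 ∧ x₄ = k - 4 ∨ h₄ = 1 ∧ (x₄ = k - 5 ∨ x₄ = k - 3 ∨ x₄ = 5))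
    (e : x₃ < x₄ ∧ y = x₄ - x₃ ∧ t = 0 ∨ x₄ < x₃ ∧ y = x₃ - x₄ ∧ t = 0 ∨ x₃ = x₄ ∧ y = 0)
    (hp : p = h₃ + h₄ + y - 2 * t)
    (hp' : p = 1 ∨ p = k - 1 ∨ p = 1 + 2 ∨ p = k - 1 + 2)
    (hy : y = 0 ∨ (h₃ + h₄ - y + 1) % 2 = 1 ∨ h₃ + h₄ - y + 1 = 0 ∨ h₃ + h₄ - y + 1 = 2) :
    p = 3 ∧ 3 < x₃ ∧ 3 < x₄ := by
  rcases s3 with ⟨a, b⟩ | ⟨a, b | b⟩ <;>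
    rcases s4 with ⟨c, d⟩ | ⟨c, d | d | d⟩ <;>
    rcases e with e | e | e <;> try (exfalso; clear * - e b d hk hko; omega)
  all_goals
    rcases hp' with f | f | f | f <;>
      try (exfalso; clear * - a b c d e f hp hko hk ht; omega)
  all_goals
    rcases hy with g | g | g | g <;>
      try (exfalso; omega)
  all_goals omega

namespace IsSharedConfig

variable {k l n m : ℤ} {β h : ℤ → ℤ} {t : ℤ → ℤ → ℤ}

/-- The lengths `h i + h j + |β j - β i| - 2 * t i j` equal to `3` that occur for the pairs `1, 2`
and `3, 4`, or for the pair `2, 3`, make a cycle of the odd length `k + 4`. -/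
lemma false_of_lt (H : IsSharedConfig k 1 k k β h t) (hk : 7 ≤ k) (h1 : 2 * β 1 < k) : False := by
  have hko := H.odd
  have b1 := H.bounds 1 (by omega) (by omega)
  have b2 := H.bounds 2 (by omega) (by omega)
  have b3 := H.bounds 3 (by omega) (by omega)
  have t12 := H.meet 1 2
  have t13 := H.meet 1 3
  have t23 := H.meet 2 3
  have t14 := H.meet 1 4
  have t34 := H.meet 3 4
  have s1 := H.single_cases (i := 1) (by omega) (by omega)
  have s2 := H.single_cases (i := 2) (by omega) (by omega)
  have s3 := H.single_cases (i := 3) (by omega) (by omega)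
  have s4 := H.single_cases (i := 4) (by omega) (by omega)
  obtain ⟨y₁, p₁, e₁, hp₁, a₁, hp₁', hy₁⟩ :=
    H.pair_cases (i := 1) (j := 2) (by omega) (by omega) (by omega)
  obtain ⟨y₂, p₂, e₂, hp₂, -, hp₂', hy₂⟩ :=
    H.pair_cases (i := 1) (j := 3) (by omega) (by omega) (by omega)
  obtain ⟨y₃, p₃, e₃, hp₃, a₃, hp₃', hy₃⟩ :=
    H.pair_cases (i := 2) (j := 3) (by omega) (by omega) (by omega)
  obtain ⟨y₄, p₄, e₄, hp₄, -, hp₄', hy₄⟩ :=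
    H.pair_cases (i := 1) (j := 4) (by omega) (by omega) (by omega)
  obtain ⟨y₅, p₅, e₅, hp₅, a₅, hp₅', hy₅⟩ :=
    H.pair_cases (i := 3) (j := 4) (by omega) (by omega) (by omega)
  have r := (H.three 1 2 3 (by omega) (by omega) (by omega) (by omega)).1
  have r' := H.four 1 2 3 4 (by omega) (by omega) (by omega) (by omega) (by omega)
  rw [a₃, ← hp₃] at r
  rw [a₁, ← hp₁, a₅, ← hp₅] at r'
  have c12 := shared_one_two hk hko b1 h1 b2 ⟨t12.1, t12.2.1, t12.2.2.1⟩ s1 s2 e₁ hp₁ hp₁' hy₁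
  have c1 : h 1 = 2 ∧ β 1 = 1 ∨ h 1 = 1 ∧ β 1 = 2 := by
    clear * - c12
    omega
  have c13 := shared_one_three hk hko b3 ⟨t13.1, t13.2.1, t13.2.2.1⟩ c1 s3 e₂ hp₂ hp₂' hy₂
  have c23 := shared_two_three hk hko b2 b3 ⟨t23.1, t23.2.1, t23.2.2.1⟩
    (by clear * - c12; omega) (by clear * - c13; omega) e₃ hp₃ hp₃' hy₃
  have c14 := shared_one_four hk hko ⟨t14.1, t14.2.1, t14.2.2.1⟩ c1 s4 e₄ hp₄ hp₄' hy₄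
  have hne : ¬ (p₃ = 3 ∧ 2 < β 2 ∧ 2 < β 3) := by
    rintro ⟨h3, h4, h5⟩
    have := r (by clear * - c1 h4 h5; omega)
    rw [h3] at this
    unfold IsAdm at this
    clear * - this c1 hko
    omega
  have c34 := shared_three_four hk hko ⟨t34.1, t34.2.1, t34.2.2.1⟩
    (by clear * - c23 hne; omega) c14 e₅ hp₅ hp₅' hy₅
  have c : p₁ = 3 ∧ β 2 ≤ 2 ∨ p₃ = 3 ∧ 2 < β 2 ∧ 2 < β 3 := by
    clear * - c23 c12 c34 hk
    omega
  replace c := c.resolve_right hne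
  have := r' (.inl (by clear * - c c1 c34; omega))
  rw [c.1, c34.1] at this
  unfold IsAdm at this
  clear * - this hko
  omega

/-- The smaller admissible length is five. -/
lemma eq_five (H : IsSharedConfig k 1 k k β h t) : k = 5 := by
  have hko := H.odd
  have hk := H.five_le
  by_contra hne
  rcases lt_or_ge (2 * β 1) k with h1 | h1
  · exact H.false_of_lt (by omega) h1
  · exact H.reflect.false_of_lt (by omega) (by omega)

end IsSharedConfig

namespace IsSharedConfig

variable {k l n m : ℤ} {β h : ℤ → ℤ} {t : ℤ → ℤ → ℤ}

lemma ends_parity_of_eq_five (H : IsSharedConfig 5 1 5 5 β h t) :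
    (β 1 + h 1 - (β 4 + h 4)) % 2 = 0 := by
  have b1 := H.bounds 1 (by omega) (by omega)
  have b4 := H.bounds 4 (by omega) (by omega)
  have t14 := H.meet 1 4
  have s1 := H.single_cases (i := 1) (by omega) (by omega)
  have s4 := H.single_cases (i := 4) (by omega) (by omega)
  obtain ⟨y, p, e, hp, -, hp', hy⟩ :=
    H.pair_cases (i := 1) (j := 4) (by omega) (by omega) (by omega)
  clear H
  rcases e with e | e | e <;> rcases hp' with f | f | f | f <;> rcases hy with g | g | g | g <;>
    omega

lemma one_two_of_eq_five {x₁ x₂ h₁ h₂ t y p : ℤ} (b1 : 0 < x₁ ∧ x₁ < 5) (b1' : 2 * x₁ < 5)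
    (b2 : 0 < x₂ ∧ x₂ < 5) (ht : 0 ≤ t ∧ t < h₁ ∧ t < h₂)
    (s1 : (h₁ = 2 ∧ (x₁ = 1 ∨ x₁ = 4)) ∨ (h₁ = 1 ∧ (x₁ = 2 ∨ x₁ = 3)))
    (s2 : (h₂ = 2 ∧ (x₂ = 2 ∨ x₂ = 3)) ∨ h₂ = 1)
    (e : x₁ < x₂ ∧ y = x₂ - x₁ ∧ t = 0 ∨ x₂ < x₁ ∧ y = x₁ - x₂ ∧ t = 0 ∨ x₁ = x₂ ∧ y = 0)
    (hp : p = h₁ + h₂ + y - 2 * t) (hp' : p = 1 ∨ p = 4 ∨ p = 3 ∨ p = 6)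
    (hy : y = 0 ∨ (h₁ + h₂ - y + 1) % 2 = 1 ∨ h₁ + h₂ - y + 1 = 0 ∨ h₁ + h₂ - y + 1 = 2)
    (h12 : (x₂ + h₂ - (x₁ + h₁)) % 2 = 0) :
    h₁ = 1 ∧ x₁ = 2 ∧ (h₂ = 1 ∧ x₂ = 4 ∨ h₂ = 2 ∧ x₂ = 3) ∨ h₁ = 2 ∧ x₁ = 1 := by
  rcases e with e | e | e <;> rcases hp' with f | f | f | f <;> rcases hy with g | g | g | g <;>
    omega

lemma parity_of_eq_five_of_lt (H : IsSharedConfig 5 1 5 5 β h t) (h1 : 2 * β 1 < 5) :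
    ¬ ((β 2 + h 2 - (β 1 + h 1)) % 2 = 0 ∧ (β 3 + h 3 - (β 1 + h 1)) % 2 = 0) := by
  rintro ⟨h12, h13⟩
  have h14 := H.ends_parity_of_eq_five
  have b1 := H.bounds 1 (by omega) (by omega)
  have b2 := H.bounds 2 (by omega) (by omega)
  have b3 := H.bounds 3 (by omega) (by omega)
  have b4 := H.bounds 4 (by omega) (by omega)
  have t12 := H.meet 1 2
  have t13 := H.meet 1 3
  have t23 := H.meet 2 3
  have t24 := H.meet 2 4
  have t34 := H.meet 3 4
  have s1 := H.single_cases (i := 1) (by omega) (by omega)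
  have s2 := H.single_cases (i := 2) (by omega) (by omega)
  have s3 := H.single_cases (i := 3) (by omega) (by omega)
  have s4 := H.single_cases (i := 4) (by omega) (by omega)
  obtain ⟨y₁, p₁, e₁, hp₁, -, hp₁', hy₁⟩ :=
    H.pair_cases (i := 1) (j := 2) (by omega) (by omega) (by omega)
  obtain ⟨y₂, p₂, e₂, hp₂, -, hp₂', hy₂⟩ :=
    H.pair_cases (i := 1) (j := 3) (by omega) (by omega) (by omega)
  obtain ⟨y₃, p₃, e₃, hp₃, -, hp₃', hy₃⟩ :=
    H.pair_cases (i := 2) (j := 3) (by omega) (by omega) (by omega)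
  obtain ⟨y₄, p₄, e₄, hp₄, -, hp₄', hy₄⟩ :=
    H.pair_cases (i := 2) (j := 4) (by omega) (by omega) (by omega)
  obtain ⟨y₅, p₅, e₅, hp₅, -, hp₅', hy₅⟩ :=
    H.pair_cases (i := 3) (j := 4) (by omega) (by omega) (by omega)
  clear H
  have c12 := one_two_of_eq_five b1 h1 b2 ⟨t12.1, t12.2.1, t12.2.2.1⟩
    (by clear * - s1 b1; omega) (by clear * - s2 b2; omega) e₁ hp₁ (by clear * - hp₁'; omega) hy₁ h12
  have c13 : h 1 = 1 ∧ β 1 = 2 ∧ h 3 = 1 ∧ (β 3 = 2 ∨ β 3 = 4) := by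
    clear * - c12 t13 b3 s3 hp₂ hp₂' hy₂ e₂ h13
    rcases e₂ with e | e | e <;> rcases hp₂' with f | f | f | f <;> omega
  have c24 : h 2 = 1 ∧ β 2 = 4 ∧ h 4 = 1 ∧ β 4 = 2 := by
    replace c12 : h 2 = 1 ∧ β 2 = 4 ∨ h 2 = 2 ∧ β 2 = 3 := by clear * - c12 c13; omega
    clear * - c12 c13 t24 b4 s4 hp₄ hp₄' hy₄ e₄ h14
    rcases e₄ with e | e | e <;> rcases hp₄' with f | f | f | f <;> omega
  have c34 : β 3 = 4 := by
    clear * - c13 c24 t34 hp₅ hp₅' hy₅ e₅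
    rcases e₅ with e | e | e <;> rcases hp₅' with f | f | f | f <;> omega
  clear * - c13 c24 c34 t23 hp₃ hp₃' e₃
  omega

/-- The data of two cycles with one common vertex: both are pentagons, and the parities of
`β i + h i` agree for the two neighbours of the common vertex, but not for all four vertices. -/
theorem eq_five_and_parity (H : IsSharedConfig k l n m β h t) :
    n = 5 ∧ m = 5 ∧ k = 5 ∧ l = 1 ∧ (β 1 + h 1 - (β 4 + h 4)) % 2 = 0 ∧
      ¬ ((β 2 + h 2 - (β 1 + h 1)) % 2 = 0 ∧ (β 3 + h 3 - (β 1 + h 1)) % 2 = 0) := by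
  obtain ⟨rfl, rfl⟩ := H.eq_left_eq_right
  obtain rfl := H.eq_one
  obtain rfl := H.eq_five
  refine ⟨rfl, rfl, rfl, rfl, H.ends_parity_of_eq_five, ?_⟩
  rcases lt_or_ge (2 * β 1) 5 with h1 | h1
  · exact H.parity_of_eq_five_of_lt h1
  · have := H.reflect.parity_of_eq_five_of_lt (by omega)
    omega

end IsSharedConfig

namespace SimpleGraph

variable {V : Type*} {G : SimpleGraph V}

/-! ### Two odd cycles with one common vertex -/

open IsForest

lemma IsForest.meetHt_comm {par : V → V} {ht : V → ℕ} {u v : V}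
    (h : forestAnc par ht u 0 = forestAnc par ht v 0) : meetHt par ht u v = meetHt par ht v u := by
  have h1 := meetHt_le par ht u v
  have h2 := meetHt_le par ht v u
  exact le_antisymm (le_meetHt (by omega) (by omega) (anc_meetHt h).symm)
    (le_meetHt (by omega) (by omega) (anc_meetHt h.symm).symm)

namespace IsForest

variable {n m : ℤ} {c d f : ℤ → V} {K : Set V} {par : V → V} {ht : V → ℕ} {β : ℤ → ℤ}

/-- The forest path from a vertex of `c` to its end on `d`. -/
lemma path_leg {B : Set V} (hF : G.IsForest K B par ht) {x u v : V} (hx : x ∉ K) (hu : u ∈ K)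
    (hxu : G.Adj x u) (hv : forestAnc par ht u 0 = v) :
    G.HasPathIn (insert x (rootsIn par ht K {v})) x v (ht u + 1) := by
  subst hv
  have h1 := HasPathIn.of_adj hxu (S := {x, u}) (by simp) (by simp)
  have h2 := hF.path_to_root hu
  have h3 := h1.append h2 (by
    rintro z (rfl | rfl) hz
    · exact (hx hz.1).elim
    · rfl)
  rw [add_comm]
  refine h3.mono ?_
  rintro z ((rfl | rfl) | hz)
  · exact .inl rfl
  · exact .inr h2.left_mem
  · exact .inr hz

/-- The path from a vertex of `c` along the forest and then along `d` to the common vertex, which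
has the indices `0` and `m` on `d`. -/
lemma path_to_common (hF : G.IsForest K (d '' Set.Ioo 0 m) par ht) (hd : G.IsCyclicEnum m d)
    (hcK : ∀ t, c t ∉ K) (hw : c 0 = d 0) {i : ℤ} (hi : c i ≠ c 0) (hfK : f i ∈ K)
    (hadj : G.Adj (c i) (f i)) (hb : 0 < β i ∧ β i < m) (hβ : forestAnc par ht (f i) 0 = d (β i))
    {s : ℤ} (hs : s = 0 ∨ s = m) :
    G.HasPathIn (rootsIn par ht K (d '' (Set.Icc (min (β i) s) (max (β i) s) ∩ Set.Ioo 0 m)) ∪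
      {c i, c 0}) (c i) (c 0) (ht (f i) + 1 + |s - β i|) := by
  have hds : d s = c 0 := by
    rw [hw, hd.eq_iff]
    rcases hs with rfl | rfl <;> simp
  have h1 := hF.path_leg (hcK i) hfK hadj hβ
  have h2 := hd.arc_uIcc (u := β i) (v := s) (by omega)
  have hdt : ∀ t ∈ Set.Icc (min (β i) s) (max (β i) s), t ∈ Set.Ioo 0 m ∨ d t = c 0 := by
    rintro t ⟨ht1, ht2⟩
    by_cases hts : t = s
    · exact .inr (hts ▸ hds)
    · left
      rw [Set.mem_Ioo]
      omega
  have h3 := h1.append h2 (by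
    rintro z hz ⟨t, ht, rfl⟩
    rcases hdt t ht with htm | htm
    · rcases hz with hz | hz
      · exact (hcK i (hz ▸ hF.subset ⟨t, htm, rfl⟩)).elim
      · rw [← hF.root_of_mem ⟨t, htm, rfl⟩]
        exact hz.2
    · rcases hz with hz | hz
      · exact (hi (hz.symm.trans htm)).elim
      · exact (hcK 0 (htm ▸ hz.1)).elim)
  rw [hds] at h3
  refine h3.mono ?_
  rintro z ((rfl | hz) | ⟨t, ht, rfl⟩)
  · exact .inr (.inl rfl)
  · refine .inl ⟨hz.1, β i, ⟨by simp, hb⟩, hz.2.symm⟩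
  · rcases hdt t ht with htm | htm
    · exact .inl ⟨hF.subset ⟨t, htm, rfl⟩, t, ⟨ht, htm⟩, (hF.root_of_mem ⟨t, htm, rfl⟩).symm⟩
    · exact .inr (.inr htm)

/-- The path between two vertices of `c` along the forest and, if necessary, the part of `d` that
avoids the common vertex. -/
lemma path_pair (hF : G.IsForest K (d '' Set.Ioo 0 m) par ht) (hd : G.IsCyclicEnum m d)
    (hcK : ∀ t, c t ∉ K) {i j : ℤ} (hij : c i ≠ c j) (hfK : ∀ i, f i ∈ K)
    (hadj : ∀ i, G.Adj (c i) (f i)) (hb : ∀ i, 0 < β i ∧ β i < m)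
    (hβ : ∀ i, forestAnc par ht (f i) 0 = d (β i)) {t : ℤ}
    (ht' : t = if β i = β j then (meetHt par ht (f i) (f j) : ℤ) else 0) :
    G.HasPathIn (rootsIn par ht K (d '' Set.Icc (min (β i) (β j)) (max (β i) (β j))) ∪
      {c i, c j}) (c i) (c j) ((ht (f i) + 1) + (ht (f j) + 1) + |β j - β i| - 2 * t) := by
  have hbi := hb i
  have hbj := hb j
  split_ifs at ht' with h
  · have h1 := (hF.path_within (hfK i) (hfK j) (by rw [hβ, hβ, h])).extend (fun v hv => hv.1)
      (hcK i) (hcK j) hij (hadj i) (hadj j)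
    rw [hβ] at h1
    rw [h, min_self, max_self, Set.Icc_self, Set.image_singleton, sub_self, abs_zero, ht']
    rw [h] at h1
    convert h1 using 1
    ring
  · have h1 := hF.path_between (hfK i) (hfK j)
      (I := d '' Set.Icc (min (β i) (β j)) (max (β i) (β j))) (Set.image_mono (by
        rintro x ⟨h1, h2⟩
        rw [Set.mem_Ioo]
        omega))
      (by rw [hβ, hβ]; exact hd.arc_uIcc (by omega)) (by
        rw [hβ, hβ]
        intro h'
        exact h (hd.eq_of_abs_lt h' (by omega) (by omega)))
    have h1 := h1.extend (fun v hv => hv.1) (hcK i) (hcK j) hij (hadj i) (hadj j)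
    rw [ht']
    convert h1 using 1
    ring

/-- The cycle formed by the part of `c` between two vertices, their forest paths to `d` and the part
of `d` that contains the common vertex. -/
lemma evenOrCycleLength_around (hF : G.IsForest K (d '' Set.Ioo 0 m) par ht)
    (hc : G.IsCyclicEnum n c) (hd : G.IsCyclicEnum m d) (hcK : ∀ t, c t ∉ K) (hw : c 0 = d 0)
    {i j : ℤ} (h0i : 0 < i) (hij : i < j) (hjn : j < n) (hfK : ∀ i, f i ∈ K)
    (hadj : ∀ i, G.Adj (c i) (f i)) (hb : ∀ i, 0 < β i ∧ β i < m)
    (hβ : ∀ i, forestAnc par ht (f i) 0 = d (β i)) (hne : β i ≠ β j) :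
    G.EvenOrCycleLength
      ((ht (f i) + 1) + (ht (f j) + 1) + (m - |β j - β i|) + (j - i)) := by
  have hbi := hb i
  have hbj := hb j
  have hA := hc.arc hij.le (by omega)
  have hS := hF.path_leg (hcK j) (hfK j) (hadj j) (hβ j)
  have hT := (hF.path_leg (hcK i) (hfK i) (hadj i) (hβ i)).symm
  obtain ⟨J, hB, hJ⟩ : ∃ J : Set ℤ,
      G.HasPathIn (d '' J) (d (β j)) (d (β i)) (m - |β j - β i|) ∧
        ∀ t ∈ J, (∃ s ∈ Set.Ioo 0 m, d t = d s) ∨ d t = c 0 := by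
    have key : ∀ a b : ℤ, 0 < a → a < b → b < m →
        G.HasPathIn (d '' Set.Icc b (a + m)) (d b) (d a) (m - (b - a)) ∧
        ∀ t ∈ Set.Icc b (a + m), (∃ s ∈ Set.Ioo 0 m, d t = d s) ∨ d t = c 0 := by
      intro a b ha hab hbm
      constructor
      · have := hd.arc (i := b) (j := a + m) (by omega) (by omega)
        rw [hd.period] at this
        convert this using 1
        ring
      · rintro t ⟨h1, h2⟩
        rcases lt_trichotomy t m with h | rfl | h
        · exact .inl ⟨t, ⟨by omega, h⟩, rfl⟩
        · right
          rw [hw, hd.eq_iff]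
          simp
        · refine .inl ⟨t - m, ⟨by omega, by omega⟩, ?_⟩
          rw [hd.eq_iff]
          simp
    rcases lt_or_gt_of_ne hne with h | h
    · rw [abs_of_pos (by omega)]
      exact ⟨_, key _ _ hbi.1 h hbj.2⟩
    · rw [abs_of_neg (by omega)]
      obtain ⟨h1, h2⟩ := key _ _ hbj.1 h hbi.2
      refine ⟨_, ?_, h2⟩
      rw [neg_sub]
      exact h1.symm
  have hc0 : ∀ t, 0 < t → t < n → c t ≠ c 0 := fun t h1 h2 h => by
    have := hc.eq_of_abs_lt h (by omega) (by omega)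
    omega
  -- A vertex of `d` in the forest is its own root.
  have hroot : ∀ {x : ℤ} {z : V}, z ∈ rootsIn par ht K {d x} → z ∈ d '' J → z = d x := by
    rintro x _ hz ⟨t, ht, rfl⟩
    rcases hJ t ht with ⟨s, hs, h⟩ | h
    · rw [h] at hz ⊢
      rw [← hF.root_of_mem ⟨s, hs, rfl⟩]
      exact hz.2
    · exact (hcK 0 (h ▸ hz.1)).elim
  have hcd : ∀ t, 0 < t → t < n → c t ∉ d '' J := by
    rintro t h1 h2 ⟨x, hx, h⟩
    rcases hJ x hx with ⟨s, hs, h'⟩ | h'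
    · exact hcK t (h ▸ h' ▸ hF.subset ⟨s, hs, rfl⟩)
    · exact hc0 t h1 h2 (h.symm.trans h')
  have hcij : c i ≠ c j := fun h => by
    have := hc.eq_of_abs_lt h (by omega) (by omega)
    omega
  have := evenOrCycleLength_of_four hA hS hB hT ?_ ?_ ?_ ?_ ?_ ?_
  · convert this using 1
    ring
  · rintro _ ⟨t, ht, rfl⟩ (h | h)
    · exact h
    · exact (hcK t h.1).elim
  · rintro z (rfl | h) hz
    · exact (hcd j (by omega) (by omega) hz).elim
    · exact hroot h hz
  · rintro z hz (rfl | h)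
    · exact (hcd i (by omega) (by omega) hz).elim
    · exact hroot h hz
  · rintro _ (h | h) ⟨t, ht, rfl⟩
    · exact h
    · exact (hcK t h.1).elim
  · rw [Set.disjoint_left]
    rintro _ ⟨t, ht, rfl⟩
    exact hcd t (lt_of_lt_of_le h0i ht.1) (lt_of_le_of_lt ht.2 hjn)
  · rw [Set.disjoint_left]
    rintro z (rfl | h) (h' | h')
    · exact hcij h'.symm
    · exact hcK _ h'.1
    · exact hcK _ (h' ▸ h.1)
    · have := h.2.symm.trans h'.2
      exact hne (hd.eq_of_abs_lt this.symm (by omega) (by omega))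

lemma two_handles_of_disjoint (hc : G.IsCyclicEnum n c) (hd : G.IsCyclicEnum m d)
    (hcK : ∀ t, c t ∉ K) {I J : Set ℤ} (hI : I ⊆ Set.Ioo 0 m) (hJ : J ⊆ Set.Ioo 0 m)
    (hIJ : Disjoint I J) {i j p q r s : ℤ} (hij : i < j) (hjp : j < p) (hpq : p < q)
    (hqi : q < i + n)
    (hS : G.HasPathIn (rootsIn par ht K (d '' I) ∪ {c i, c j}) (c i) (c j) r)
    (hT : G.HasPathIn (rootsIn par ht K (d '' J) ∪ {c p, c q}) (c p) (c q) s) :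
    G.EvenOrCycleLength (r + s + n - (j - i) - (q - p)) := by
  have hne : ∀ {i j : ℤ}, i < j → j < i + n → c i ≠ c j := fun h1 h2 h => by
    have := hc.eq_of_abs_lt h (by omega) (by omega)
    omega
  refine hc.two_handles hij hjp hpq hqi hS hT ?_ ?_ ?_
  · rintro _ (hv | hv) ⟨t, rfl⟩
    · exact (hcK t hv.1).elim
    · exact hv
  · rintro _ (hv | hv) ⟨t, rfl⟩
    · exact (hcK t hv.1).elim
    · exact hv
  · rw [Set.disjoint_union_left, Set.disjoint_union_right, Set.disjoint_union_right]
    refine ⟨⟨disjoint_rootsIn ?_, ?_⟩, ?_, ?_⟩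
    · rw [Set.disjoint_left]
      rintro _ ⟨a, ha, rfl⟩ ⟨b, hb, hab⟩
      have h1 := hI ha
      have h2 := hJ hb
      rw [Set.mem_Ioo] at h1 h2
      have := hd.eq_of_abs_lt hab (by omega) (by omega)
      exact Set.disjoint_left.1 hIJ ha (this ▸ hb)
    · rw [Set.disjoint_left]
      rintro z hz (rfl | rfl)
      · exact hcK _ hz.1
      · exact hcK _ hz.1
    · rw [Set.disjoint_left]
      rintro z (rfl | rfl) hz
      · exact hcK _ hz.1
      · exact hcK _ hz.1
    · rw [Set.disjoint_left]
      rintro z (rfl | rfl) (h | h)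
      · exact hne (by omega) (by omega) h
      · exact hne (by omega) (by omega) h
      · exact hne (by omega) (by omega) h
      · exact hne (by omega) (by omega) h

/-- The forest paths from the vertices of a cycle to a cycle that meets it in one vertex satisfy the
arithmetic constraints of a shared configuration. -/
theorem isSharedConfig {k l : ℕ} (hk : 5 ≤ k) (hl : 1 ≤ l)
    (hL : G.oddCycleLengths = {k, k + 2 * l}) (hc : G.IsCyclicEnum n c) (hd : G.IsCyclicEnum m d)
    (hn : Odd n) (hm : Odd m) (hcK : ∀ t, c t ∉ K) (hw : c 0 = d 0)
    (hF : G.IsForest K (d '' Set.Ioo 0 m) par ht) (hfK : ∀ i, f i ∈ K)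
    (hadj : ∀ i, G.Adj (c i) (f i)) (hb : ∀ i, 0 < β i ∧ β i < m)
    (hβ : ∀ i, forestAnc par ht (f i) 0 = d (β i)) :
    IsSharedConfig k l n m β (fun i => ht (f i) + 1)
      (fun i j => if β i = β j then (meetHt par ht (f i) (f j) : ℤ) else 0) := by
  have hne : ∀ {i j : ℤ}, i < j → j < i + n → c i ≠ c j := fun h1 h2 h => by
    have := hc.eq_of_abs_lt h (by omega) (by omega)
    omega
  have hadm : ∀ {z : ℤ}, G.EvenOrCycleLength z → IsAdm k l z := fun h => h.isAdm hL
  have hcommon : ∀ i, 0 < i → i < n → ∀ s, s = 0 ∨ s = m → _ := fun i h0 hi s hs =>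
    hF.path_to_common hd hcK hw (hne h0 (by omega)).symm (hfK i) (hadj i) (hb i) (hβ i) hs
  have hodd : k % 2 = 1 := by
    have : k ∈ G.oddCycleLengths := by rw [hL]; simp
    exact Nat.odd_iff.1 this.1
  have hsub : ∀ i j, Set.Icc (min (β i) (β j)) (max (β i) (β j)) ⊆ Set.Ioo 0 m := by
    rintro i j x ⟨h1, h2⟩
    have := hb i
    have := hb j
    rw [Set.mem_Ioo]
    omega
  have hcn : c n = c 0 := by simpa using hc.period 0
  refine ⟨by omega, by omega, by omega, hadm hc.evenOrCycleLength (Int.odd_iff.1 hn),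
    hadm hd.evenOrCycleLength (Int.odd_iff.1 hm), fun i => by omega, fun i _ _ => hb i,
    ?_, ?_, ?_, ?_, ?_, ?_⟩
  · intro i h0 hi
    have hbi := hb i
    have key : ∀ s, s = 0 ∨ s = m → _ := fun s hs =>
      hc.one_handle_both (i := i) (j := n) hi (by omega) (by rw [hcn]; exact hcommon i h0 hi s hs)
        (by exact fun t ht => hcK t ht.1)
    have h1 := key 0 (.inl rfl)
    have h2 := key m (.inr rfl)
    rw [zero_sub, abs_neg, abs_of_pos hbi.1] at h1
    rw [abs_of_pos (show 0 < m - β i by omega)] at h2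
    refine ⟨hadm ?_, hadm ?_, hadm ?_, hadm ?_⟩
    · convert h1.2 using 1; ring
    · convert h1.1 using 1; ring
    · convert h2.2 using 1; ring
    · convert h2.1 using 1; ring
  · intro i j
    have := meetHt_le par ht (f i) (f j)
    split_ifs with h
    · exact ⟨by omega, by omega, by omega, fun h' => (h' h).elim⟩
    · exact ⟨le_rfl, by omega, by omega, fun _ => rfl⟩
  · intro i j p h1 h2
    have e1 : forestAnc par ht (f i) 0 = forestAnc par ht (f j) 0 := by rw [hβ, hβ, h1]
    have e2 : forestAnc par ht (f i) 0 = forestAnc par ht (f p) 0 := by rw [hβ, hβ, h2]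
    simp only [if_pos h1, if_pos h2, if_pos (h1.symm.trans h2)]
    rw [meetHt_comm e1]
    exact_mod_cast hF.meetHt_ultrametric (hfK j) (hfK i) (hfK p) e1.symm e2
  · intro i j h0 hij hj
    have h1 := hF.path_pair hd hcK (hne hij (by omega)) hfK hadj hb hβ rfl
    have h1 := hc.one_handle_both hij (by omega) h1 (fun t ht => hcK t ht.1)
    exact ⟨hadm h1.1, hadm h1.2, fun h =>
      hadm (hF.evenOrCycleLength_around hc hd hcK hw h0 hij hj hfK hadj hb hβ h)⟩
  · intro i p q h0 hip hpq hq
    have hbi := hb i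
    have h1 := hF.path_pair hd hcK (hne hpq (by omega)) hfK hadj hb hβ rfl
    have key : ∀ s, s = 0 ∨ s = m →
        Disjoint (Set.Icc (min (β i) s) (max (β i) s) ∩ Set.Ioo 0 m)
          (Set.Icc (min (β p) (β q)) (max (β p) (β q))) → _ := fun s hs hdis =>
      two_handles_of_disjoint hc hd hcK Set.inter_subset_right (hsub p q) hdis h0 hip hpq
        (by omega) (by rw [Set.pair_comm]; exact (hcommon i h0 (by omega) s hs).symm) h1
    constructor
    · intro h
      have := key 0 (.inl rfl) (by
        rw [Set.disjoint_left]
        rintro x ⟨⟨h1, h2⟩, -⟩ ⟨h3, h4⟩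
        omega)
      rw [zero_sub, abs_neg, abs_of_pos hbi.1] at this
      convert hadm this using 1
      ring
    · intro h
      have := key m (.inr rfl) (by
        rw [Set.disjoint_left]
        rintro x ⟨⟨h1, h2⟩, -⟩ ⟨h3, h4⟩
        omega)
      rw [abs_of_pos (show 0 < m - β i by omega)] at this
      convert hadm this using 1
      ring
  · intro i j p q h0 hij hjp hpq hq h
    have h1 := hF.path_pair hd hcK (hne hij (by omega)) hfK hadj hb hβ rfl
    have h2 := hF.path_pair hd hcK (hne hpq (by omega)) hfK hadj hb hβ rfl
    refine hadm (two_handles_of_disjoint hc hd hcK (hsub i j) (hsub p q) ?_ hij hjp hpq (by omega)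
      h1 h2)
    rw [Set.disjoint_left]
    rintro x ⟨h1, h2⟩ ⟨h3, h4⟩
    omega

end IsForest

end SimpleGraph

namespace SimpleGraph

variable {V : Type*} {G : SimpleGraph V}

open IsForest

lemma IsProperOn.eq_iff_even_of_hasPathIn {X : Set V} {κ : V → Bool} (hκ : G.IsProperOn X κ)
    {x y : V} {r : ℤ} (h : G.HasPathIn X x y r) : κ x = κ y ↔ Even r := by
  obtain ⟨p, -, rfl, hp⟩ := h
  rw [Int.even_coe_nat]
  induction p with
  | nil => simp
  | cons hadj q ih =>
    have ih := ih fun v hv => hp v (by simp [hv])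
    have := hκ _ (hp _ (by simp)) _ (hp _ (by simp)) hadj
    rw [Walk.length_cons, Nat.even_add_one, ← ih]
    rw [Bool.eq_not_of_ne this]
    cases κ _ <;> cases κ _ <;> simp

lemma isConnOn_image_Icc {d : ℤ → V} (hd : ∀ t, G.Adj (d t) (d (t + 1))) (i j : ℤ) :
    G.IsConnOn (d '' Set.Icc i j) := by
  intro X hX ⟨x, hx⟩ hne
  obtain ⟨a, ⟨hia, haj⟩, rfl⟩ := hX hx
  by_contra! hcon
  have hup : ∀ t, a ≤ t → t ≤ j → d t ∈ X := by
    intro t hat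
    induction t, hat using Int.leInduction with
    | base => exact fun _ => hx
    | succ t hat ih =>
      intro htj
      by_contra h
      exact hcon _ (ih (by omega)) _ ⟨t + 1, ⟨by omega, htj⟩, rfl⟩ h (hd t)
  have hdown : ∀ t, t ≤ a → i ≤ t → d t ∈ X := by
    intro t hta
    induction t, hta using Int.leInductionDown with
    | base => exact fun _ => hx
    | pred t hta ih =>
      intro hit
      by_contra h
      refine hcon _ (ih (by omega)) _ ⟨t - 1, ⟨hit, by omega⟩, rfl⟩ h ?_
      have := hd (t - 1)
      rw [sub_add_cancel] at this
      exact this.symm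
  refine hne (hX.antisymm ?_)
  rintro _ ⟨t, ⟨h1, h2⟩, rfl⟩
  rcases le_total a t with h | h
  · exact hup t h h2
  · exact hdown t h h1

/-- A 2-colouring of `K` restricts the colours of the neighbours in `K` of a complementary cycle `c`,
if there is an odd cycle that meets `c` in a single vertex. -/
theorem attachment_colours {k l : ℕ} (hk : 5 ≤ k) (hl : 1 ≤ l)
    (hL : G.oddCycleLengths = {k, k + 2 * l}) {n m : ℤ} {c d : ℤ → V} {K : Set V} {par : V → V}
    {ht : V → ℕ} (hc : G.IsCyclicEnum n c) (hd : G.IsCyclicEnum m d) (hn : Odd n) (hm : Odd m)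
    (hcK : ∀ t, c t ∉ K) (hw : c 0 = d 0) (hF : G.IsForest K (d '' Set.Ioo 0 m) par ht)
    {κ : V → Bool} (hκ : G.IsProperOn K κ) {f : ℤ → V} (hf : ∀ i, f i ∈ K ∧ G.Adj (c i) (f i)) :
    n = 5 ∧ m = 5 ∧ k = 5 ∧ l = 1 ∧ κ (f 1) = κ (f 4) ∧
      ¬ (κ (f 2) = κ (f 1) ∧ κ (f 3) = κ (f 1)) := by
  have hr : ∀ i, ∃ t, (0 < t ∧ t < m) ∧ d t = forestAnc par ht (f i) 0 := fun i =>
    hF.root_mem (hf i).1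
  choose β hb hβ using hr
  have H := isSharedConfig hk hl hL hc hd hn hm hcK hw hF (fun i => (hf i).1) (fun i => (hf i).2)
    hb (fun i => (hβ i).symm)
  obtain ⟨rfl, rfl, h1, h2, h3, h4⟩ := H.eq_five_and_parity
  have hpar : ∀ i, κ (f i) = κ (d 1) ↔ (β i + (ht (f i) + 1)) % 2 = 0 := by
    intro i
    have hbi := hb i
    have e1 := hκ.eq_iff_even_of_hasPathIn ((hF.path_to_root (hf i).1).mono fun v hv => hv.1)
    have e2 := hκ.eq_iff_even hd.adj (i := 1) (j := β i) (by omega) (fun t h1 h2 =>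
      hF.subset ⟨t, ⟨by omega, by omega⟩, rfl⟩)
    rw [← hβ, Int.even_iff] at e1
    rw [Int.even_iff] at e2
    rw [show κ (f i) = κ (d 1) ↔ (κ (f i) = κ (d (β i)) ↔ κ (d 1) = κ (d (β i))) by
      cases κ (f i) <;> cases κ (d 1) <;> cases κ (d (β i)) <;> simp, e1, e2]
    omega
  have heq : ∀ i j, κ (f i) = κ (f j) ↔
      (β i + (ht (f i) + 1) - (β j + (ht (f j) + 1))) % 2 = 0 := by
    intro i j
    have h1 := hpar i
    have h2 := hpar j
    rw [show κ (f i) = κ (f j) ↔ (κ (f i) = κ (d 1) ↔ κ (f j) = κ (d 1)) by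
      cases κ (f i) <;> cases κ (d 1) <;> cases κ (f j) <;> simp, h1, h2]
    omega
  refine ⟨rfl, rfl, by omega, by omega, (heq 1 4).2 h3, ?_⟩
  rw [heq, heq]
  exact h4

lemma exists_pentagon_colouring (x : Fin 3) (hx : x = 0 ∨ x = 2) : ∃ A : ZMod 5 → Fin 3,
    (∀ i, A i ≠ A (i + 1)) ∧ A 0 = 2 ∧ A 1 = 1 ∧ A 2 = x ∧ A 3 = 2 - x ∧ A 4 = 1 := by
  change ∃ A : Fin 5 → Fin 3,
    (∀ i, A i ≠ A (i + 1)) ∧ A 0 = 2 ∧ A 1 = 1 ∧ A 2 = x ∧ A 3 = 2 - x ∧ A 4 = 1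
  rcases hx with rfl | rfl
  · exact ⟨![2, 1, 0, 2, 1], by decide⟩
  · exact ⟨![2, 1, 2, 0, 1], by decide⟩

/-- No odd cycle meets, in exactly one vertex, an odd cycle `c` whose complement `K` is connected. -/
theorem IsVertexCritical.false_of_common_vertex (hG : G.IsVertexCritical) {k l : ℕ} (hk : 5 ≤ k)
    (hl : 1 ≤ l) (hL : G.oddCycleLengths = {k, k + 2 * l}) {K : Set V} {n m : ℤ} {c d : ℤ → V}
    (hc : G.IsCyclicEnum n c) (hd : G.IsCyclicEnum m d) (hn : Odd n) (hm : Odd m)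
    (hKconn : G.IsConnOn K) (hK : Kᶜ = Set.range c) (hcK : ∀ t, ∃ y ∈ K, G.Adj (c t) y)
    (hw : c 0 = d 0) (hdK : ∀ t, 0 < t → t < m → d t ∈ K) : False := by
  classical
  have := hG.finite
  have hcK' : ∀ t, c t ∉ K := fun t => by
    have : c t ∈ Kᶜ := hK ▸ ⟨t, rfl⟩
    exact this
  have hm3 := hd.three_le
  obtain ⟨κ, hκ⟩ := hG.exists_isProperOn_bool hk hl hL hc hn hKconn hK hcK
  obtain ⟨par, ht, hF⟩ := hKconn.exists_isForest (B := d '' Set.Ioo 0 m)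
    (by rintro _ ⟨t, ht, rfl⟩; exact hdK t ht.1 ht.2)
    ⟨d 1, 1, ⟨by omega, by omega⟩, rfl⟩
  choose g hg using hcK
  have main : ∀ f : ℤ → V, (∀ i, f i ∈ K ∧ G.Adj (c i) (f i)) → _ := fun f hf =>
    attachment_colours hk hl hL hc hd hn hm hcK' hw hF hκ hf
  have hupd : ∀ (f : ℤ → V) (i : ℤ) (y : V), (∀ i, f i ∈ K ∧ G.Adj (c i) (f i)) → y ∈ K →
      G.Adj (c i) y → ∀ j, Function.update f i y j ∈ K ∧ G.Adj (c j) (Function.update f i y j) := by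
    intro f i y hf hy hiy j
    rcases eq_or_ne j i with rfl | hj
    · simpa using ⟨hy, hiy⟩
    · rw [Function.update_of_ne hj]
      exact hf j
  obtain ⟨rfl, rfl, rfl, rfl, hg14, -⟩ := main g hg
  have h1 : ∀ y ∈ K, G.Adj (c 1) y → κ y = κ (g 1) := by
    intro y hy hcy
    obtain ⟨-, -, -, -, h, -⟩ := main _ (hupd g 1 y hg hy hcy)
    simpa [hg14] using h
  have h4 : ∀ y ∈ K, G.Adj (c 4) y → κ y = κ (g 1) := by
    intro y hy hcy
    obtain ⟨-, -, -, -, h, -⟩ := main _ (hupd g 4 y hg hy hcy)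
    simpa using h.symm
  have h23 : ∀ y ∈ K, G.Adj (c 2) y → ∀ z ∈ K, G.Adj (c 3) z →
      ¬ (κ y = κ (g 1) ∧ κ z = κ (g 1)) := by
    intro y hy hcy z hz hcz
    obtain ⟨-, -, -, -, -, h⟩ := main _ (hupd _ 3 z (hupd g 2 y hg hy hcy) hz hcz)
    simpa using h
  have h3 : ¬ G.EvenOrCycleLength 3 := fun h => by
    rcases h.isAdm hL (by norm_num) with h | h <;> norm_num at h
  have hcast : ∀ {i j : ℤ}, c i = c j → (i : ZMod 5) = j := fun {i j} h => by
    rw [eq_comm, ZMod.intCast_eq_intCast_iff_dvd_sub]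
    exact (hc.eq_iff _ _).1 h
  -- The second colour of `K` is free at the vertices `1` and `4` of `c`, the first colour at the
  -- vertex `2` or `3`, and the third colour of `G` at all of them.
  obtain ⟨A, hA, hAK⟩ : ∃ A : ZMod 5 → Fin 3, (∀ i, A i ≠ A (i + 1)) ∧
      ∀ i : ℤ, ∀ y ∈ K, G.Adj (c i) y → A i ≠ if κ y = κ (g 1) then 0 else 1 := by
    have key : ∀ A : ZMod 5 → Fin 3, A 0 = 2 → A 1 = 1 → A 4 = 1 →
        (A 2 = 2 ∨ A 2 = 0 ∧ ∀ y ∈ K, G.Adj (c 2) y → κ y ≠ κ (g 1)) →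
        (A 3 = 2 ∨ A 3 = 0 ∧ ∀ y ∈ K, G.Adj (c 3) y → κ y ≠ κ (g 1)) →
        ∀ i : ℤ, ∀ y ∈ K, G.Adj (c i) y → A i ≠ if κ y = κ (g 1) then 0 else 1 := by
      intro A a0 a1 a4 a2 a3 i y hy hcy
      obtain ⟨s, hs0, hs5, hs⟩ := hc.exists_window 0 i
      rw [← hs] at hcy
      rw [← hcast hs]
      obtain rfl | rfl | rfl | rfl | rfl : s = 0 ∨ s = 1 ∨ s = 2 ∨ s = 3 ∨ s = 4 := by omega
      · rw [Int.cast_zero, a0]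
        split_ifs <;> decide
      · rw [Int.cast_one, a1, if_pos (h1 y hy hcy)]
        decide
      · rw [show ((2 : ℤ) : ZMod 5) = 2 from rfl]
        rcases a2 with a2 | ⟨a2, h⟩
        · rw [a2]
          split_ifs <;> decide
        · rw [a2, if_neg (h y hy hcy)]
          decide
      · rw [show ((3 : ℤ) : ZMod 5) = 3 from rfl]
        rcases a3 with a3 | ⟨a3, h⟩
        · rw [a3]
          split_ifs <;> decide
        · rw [a3, if_neg (h y hy hcy)]
          decide
      · rw [show ((4 : ℤ) : ZMod 5) = 4 from rfl, a4, if_pos (h4 y hy hcy)]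
        decide
    by_cases h2 : ∀ y ∈ K, G.Adj (c 2) y → κ y ≠ κ (g 1)
    · obtain ⟨A, hA, a0, a1, a2, a3, a4⟩ := exists_pentagon_colouring 0 (.inl rfl)
      exact ⟨A, hA, key A a0 a1 a4 (.inr ⟨a2, h2⟩) (.inl a3)⟩
    · push Not at h2
      obtain ⟨y, hy, hcy, hκy⟩ := h2
      obtain ⟨A, hA, a0, a1, a2, a3, a4⟩ := exists_pentagon_colouring 2 (.inr rfl)
      exact ⟨A, hA, key A a0 a1 a4 (.inl a2)
        (.inr ⟨a3, fun z hz hcz h => h23 y hy hcy z hz hcz ⟨hκy, h⟩⟩)⟩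
  let φ : V → Fin 3 := fun v => if h : v ∈ Set.range c then A (h.choose : ℤ) else
    if κ v = κ (g 1) then 0 else 1
  have hφc : ∀ i : ℤ, φ (c i) = A i := fun i => by
    have h : c i ∈ Set.range c := ⟨i, rfl⟩
    simp only [φ, dif_pos h]
    rw [hcast h.choose_spec]
  have hφK : ∀ v ∈ K, φ v = if κ v = κ (g 1) then 0 else 1 := fun v hv => by
    have h : v ∉ Set.range c := by rintro ⟨t, rfl⟩; exact hcK' t hv
    simp only [φ, dif_neg h]
  have hcov : ∀ v, v ∈ K ∨ ∃ t, c t = v := fun v => by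
    by_cases h : v ∈ K
    · exact .inl h
    · exact .inr (show v ∈ Set.range c from hK ▸ h)
  refine hG.not_proper φ fun u _ v _ huv => ?_
  rcases hcov u with hu | ⟨i, rfl⟩ <;> rcases hcov v with hv | ⟨j, rfl⟩
  · rw [hφK u hu, hφK v hv]
    have := hκ u hu v hv huv
    split_ifs with e1 e2 e2
    · exact (this (e1.trans e2.symm)).elim
    · decide
    · decide
    · revert this e1 e2
      cases κ u <;> cases κ v <;> cases κ (g 1) <;> simp
  · rw [hφK u hu, hφc]
    exact (hAK j u hu huv.symm).symm
  · rw [hφK v hv, hφc]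
    exact hAK i v hv huv
  · rw [hφc, hφc]
    rcases hc.eq_add_one_of_adj h3 huv with h | h
    · rw [h]; exact hA _
    · rw [h]; exact (hA _).symm

end SimpleGraph
theorem mainTheorem4 {V : Type*} (G : SimpleGraph V) (k l : ℕ) (hk : 5 ≤ k) (hl : 1 ≤ l)
    (hcrit : G.IsCriticalGraph 4) (hL : G.oddCycleLengths = {k, k + 2 * l})
    {u v : V} (C : G.Walk u u) (D : G.Walk v v)
    (hC : C.IsCycle) (hCodd : Odd C.length) (hD : D.IsCycle) (hDodd : Odd D.length) :
    2 ≤ ({x | x ∈ C.support} ∩ {x | x ∈ D.support} : Set V).ncard := by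
  have hG := hcrit.isVertexCritical
  by_contra! hlt
  obtain ⟨c₀, hc₀, hcr⟩ := hC.exists_isCyclicEnum
  obtain ⟨d₀, hd₀, hdr⟩ := hD.exists_isCyclicEnum
  -- If the cycles are disjoint, then `w` is an arbitrary vertex of `D`.
  obtain ⟨s, hs⟩ : ∃ s, ∀ a b, c₀ a = d₀ b → d₀ b = d₀ s := by
    by_cases h : ∃ a s, c₀ a = d₀ s
    · obtain ⟨a', s, h⟩ := h
      refine ⟨s, fun a b hab => ?_⟩
      rw [← hcr, ← hdr] at hlt
      have hfin : (Set.range c₀ ∩ Set.range d₀).Finite := by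
        rw [hcr]
        exact (List.finite_toSet C.support).inter_of_left _
      exact (Set.ncard_le_one hfin).1 (by omega) _ ⟨⟨a, hab⟩, ⟨b, rfl⟩⟩ _ ⟨⟨a', h⟩, ⟨s, rfl⟩⟩
    · exact ⟨0, fun a b hab => (h ⟨a, b, hab⟩).elim⟩
  have hd := hd₀.shift s
  set d : ℤ → V := fun t => d₀ (t + s)
  have hs' : ∀ a b, c₀ a = d b → d b = d 0 := fun a b h => by
    simpa [d] using hs a (b + s) h
  have hm := hd.three_le
  have hCodd' : Odd (C.length : ℤ) := by exact_mod_cast hCodd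
  have hDodd' : Odd (D.length : ℤ) := by exact_mod_cast hDodd
  obtain ⟨K, n, c, hTK, hKconn, hn, hc, hK, hcK⟩ := hG.exists_isConnOn_compl_eq_range
    (SimpleGraph.isConnOn_image_Icc hd.adj 1 (D.length - 1)) ⟨d 1, 1, ⟨le_rfl, by omega⟩, rfl⟩ (by
      rintro ⟨κ, hκ⟩
      refine hc₀.not_isProperOn hCodd' (fun t => ?_) κ hκ
      rintro ⟨b, ⟨hb1, hb2⟩, hb⟩
      have := hd.eq_of_abs_lt (hs' t b hb.symm) (by omega) (by omega)
      omega)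
  have hdK : ∀ t, 0 < t → t < (D.length : ℤ) → d t ∈ K := fun t h1 h2 =>
    hTK ⟨t, ⟨by omega, by omega⟩, rfl⟩
  by_cases h0 : d 0 ∈ K
  · obtain ⟨κ, hκ⟩ := hG.exists_isProperOn_bool hk hl hL hc hn hKconn hK hcK
    refine hd.not_isProperOn hDodd' (fun t => ?_) κ hκ
    obtain ⟨b, hb1, hb2, hb⟩ := hd.exists_window 0 t
    rw [← hb]
    rcases hb1.eq_or_lt with rfl | hb1
    · exact h0
    · exact hdK b hb1 (by omega)
  · obtain ⟨a, ha⟩ : d 0 ∈ Set.range c := hK ▸ h0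
    refine hG.false_of_common_vertex hk hl hL (hc.shift a) hd hn hDodd' hKconn ?_
      (fun t => hcK (t + a)) (by simpa using ha) hdK
    rw [hK]
    exact ((Equiv.addRight a).surjective.range_comp c).symm
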